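/- Let $d\ge 1$, let $(A_n)_{n\in\mathbb Z}$ be complex $d\times d$ matrices with $\sum_n|A_n|<\infty$, let $\mathbf A$ be the block convolution operator $(\mathbf A u)_n=\sum_k A_{n-k}u_k$ on $\ell_2(\mathbb Z;\mathbb C^d)$, and let $A(z)=\sum_n A_nz^n$, $z\in\mathbb T$, be its symbol. A *Schur system* of $A$ consists of functions $\lambda_1,\dots,\lambda_d:\mathbb T\to\mathbb C$ such that each $t\mapsto\lambda_k(e^{it})$ is continuous on $[0,2\pi)$, and measurable functions $\varphi^{(1)},\dots,\varphi^{(d)}:\mathbb T\to\mathbb C^d$ that form an orthonormal basis of $\mathbb C^d$ at each $z$ with $A(z)\varphi^{(k)}(z)-\lambda_k(z)\varphi^{(k)}(z)\in\operatorname{span}\{\varphi^{(l)}(z):l<k\}$ (so $\lambda_1(z),\dots,\lambda_d(z)$ are the eigenvalues of $A(z)$). Put $\Delta P_k(z)=\langle\cdot,\varphi^{(k)}(z)\rangle\varphi^{(k)}(z)$, $P_k(z)=\sum_{l\le k}\Delta P_l(z)$, $A_0(z)=\sum_k\lambda_k(z)\Delta P_k(z)$, $A_+(z)=\sum_kP_{k-1}(z)A(z)\Delta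 P_k(z)$. Points of the oriented curves $\lambda_k(\mathbb T)$ are taken with their parameter: a point is $\nu=(k,t)$, $1\le k\le d$, $t\in[0,2\pi]$, with value $\lambda_k(e^{it})$; $\alpha_k=(k,0)$ and $\beta_k=(k,2\pi)$ are the initial and end point of the $k$-th curve, and $(k,t)\prec(l,s)$ means $k<l$, or $k=l$ and $t<s$. For $\nu=(k,t)$ let $$P_\nu(z)=P_{k-1}(z)+\chi_{[0,t)}(\arg z)\,\Delta P_k(z),\qquad \arg z\in[0,2\pi),$$ (if $\lambda_k$ is injective, $\chi_{[0,t)}(\arg z)$ is the indicator function of the arc $\{\lambda_k(e^{is}):0\le s<t\}$ at $\lambda_k(z)$). Let $\mathbf F:L_2(\mathbb T;\mathbb C^d)\to\ell_2(\mathbb Z;\mathbb C^d)$ be the unitary operator that assigns to a function its Fourier coefficients, and let $\mathbf P_\nu$, $\mathbf A_0$, $\mathbf A_+$ be the operators $\mathbf F M\mathbf F^*$, where $M$ is multiplication by $P_\nu(z)$, $A_0(z)$, $A_+(z)$, respectively. Let $\mathbb P$ be the set of all $\mathbf P_\nu$. Projections (bounded idempotents) are ordered by $P\le Q\iff PQ=QP=P$;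 a chain is a linearly ordered set of projections containing $O$ and $I$; it is maximal if it is not properly included in any other chain. The integrals $\int_{\mathbb P}(dP)\mathbf A(dP)$ and $\int_{\mathbb P}P\mathbf A(dP)$ are the limits, in the operator norm and along refinement of finite partitions $O=P_0\le\dots\le P_n=I$ of $\mathbb P$, of $\sum_i(P_{i+1}-P_i)\mathbf A(P_{i+1}-P_i)$ and $\sum_iP_i\mathbf A(P_{i+1}-P_i)$. **Theorem.** The symbol $A$ has a Schur system, and for every Schur system of $A$ the following holds. The $\mathbf P_\nu$ are orthogonal projections, $\mathbf P_{\alpha_1}=O$, $\mathbf P_{\beta_d}=I$, and $\mathbf P_\nu<\mathbf P_\mu$ whenever $\nu\prec\mu$ and $\nu$ is not an end point $\beta_k$. (i) $\mathbb P$ is a maximal chain on $\ell_2(\mathbb Z;\mathbb C^d)$, and it is invariant under $\mathbf A$: $P\mathbf AP=\mathbf AP$ for $P\in\mathbb P$. (ii) $\mathbf A=\mathbf A_0+\mathbf A_+$, where $\mathbf A_0=\int_{\mathbb P}(dP)\mathbf A(dP)$ commutes with every $P\in\mathbb P$, and $\mathbf A_+=\int_{\mathbb P}P\mathbf A(dP)$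 satisfies $P\mathbf A_+P=\mathbf A_+P$ for $P\in\mathbb P$ and is nilpotent of an index $\le d$. (iii) For each $\nu$, the spectrum of $\mathbf A\mathbf P_\nu$ as an operator on $\mathbf P_\nu\ell_2(\mathbb Z;\mathbb C^d)$ is the closure of the set of all values $\lambda_l(e^{is})$ with $s\in[0,2\pi)$ and $(l,s)\prec\nu$, and the spectrum of $(I-\mathbf P_\nu)\mathbf A$ as an operator on $(I-\mathbf P_\nu)\ell_2(\mathbb Z;\mathbb C^d)$ is the closure of the set of all $\lambda_l(e^{is})$ with $s\in[0,2\pi)$ and $\nu\prec(l,s)$. Moreover $\sigma(\mathbf A)=\sigma(\mathbf A_0)=\bigcup_{k=1}^d\overline{\lambda_k(\mathbb T)}$. -/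

import Mathlib

open MeasureTheory
open scoped ENNReal Matrix.Norms.L2Operator

namespace BlockConv

noncomputable section

/-! ### The spaces -/

instance factTwoPiPos : Fact (0 < 2 * Real.pi) := ⟨Real.two_pi_pos⟩

/-- The unit circle in the angular coordinate: the class of `t` stands for `z = e^{it}`. -/
abbrev Torus : Type := AddCircle (2 * Real.pi)

/-- The normalized Lebesgue measure `τ` on the circle. -/
abbrev tau : Measure Torus := AddCircle.haarAddCircle

/-- `ℂ^d` with its Euclidean norm. -/
abbrev Cd (d : ℕ) : Type := EuclideanSpace ℂ (Fin d)

/-- `L₂(𝕋; ℂ^d)`. -/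
abbrev L2T (d : ℕ) : Type := Lp (Cd d) 2 tau

/-- `ℓ₂(ℤ; ℂ^d)`. -/
abbrev l2Z (d : ℕ) : Type := lp (fun _ : ℤ => Cd d) 2

/-- The operator on `ℂ^d` given by a matrix. -/
abbrev matOp {d : ℕ} (M : Matrix (Fin d) (Fin d) ℂ) : Cd d →L[ℂ] Cd d :=
  Matrix.toEuclideanCLM (𝕜 := ℂ) M

/-! ### The block convolution operator -/

lemma memlp_shift {d : ℕ} (M : Cd d →L[ℂ] Cd d) (m : ℤ) (u : l2Z d) :
    Memℓp (fun n : ℤ => M (u (n - m))) 2 := by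
  have h2 : 0 < (2 : ℝ≥0∞).toReal := by norm_num
  have hu := (memℓp_gen_iff h2).1 (lp.memℓp u)
  refine memℓp_gen ?_
  have hs : Summable fun n : ℤ => ‖u (n - m)‖ ^ (2 : ℝ≥0∞).toReal :=
    (Equiv.subRight m).summable_iff.2 hu
  refine Summable.of_nonneg_of_le (fun n => by positivity) (fun n => ?_)
    (hs.mul_left (‖M‖ ^ (2 : ℝ≥0∞).toReal))
  rw [← Real.mul_rpow (norm_nonneg _) (norm_nonneg _)]
  exact Real.rpow_le_rpow (norm_nonneg _) (M.le_opNorm _) h2.le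

/-- The operator `M S^m`, where `S` is the block shift `(S u)_n = u_{n-1}`:
`(M S^m u)_n = M u_{n-m}`. -/
def shiftTerm {d : ℕ} (M : Cd d →L[ℂ] Cd d) (m : ℤ) : l2Z d →L[ℂ] l2Z d :=
  LinearMap.mkContinuous
    { toFun := fun u => ⟨fun n : ℤ => M (u (n - m)), memlp_shift M m u⟩
      map_add' := fun u v => by ext n : 2; exact map_add M (u (n - m)) (v (n - m))
      map_smul' := fun c u => by ext n : 2; exact map_smul M c (u (n - m)) }
    ‖M‖ (fun u => by
      have h2 : 0 < (2 : ℝ≥0∞).toReal := by norm_num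
      refine lp.norm_le_of_tsum_le h2 (by positivity) ?_
      have hs : Summable fun n : ℤ => ‖u (n - m)‖ ^ (2 : ℝ≥0∞).toReal :=
        (Equiv.subRight m).summable_iff.2 ((memℓp_gen_iff h2).1 (lp.memℓp u))
      rw [Real.mul_rpow (norm_nonneg _) (norm_nonneg _), lp.norm_rpow_eq_tsum h2,
        ← (Equiv.subRight m).tsum_eq (fun n : ℤ => ‖u n‖ ^ (2 : ℝ≥0∞).toReal), ← tsum_mul_left]
      refine Summable.tsum_le_tsum (fun n => ?_)
        ((memℓp_gen_iff h2).1 (memlp_shift M m u)) (hs.mul_left _)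
      rw [Equiv.subRight_apply, ← Real.mul_rpow (norm_nonneg _) (norm_nonneg _)]
      exact Real.rpow_le_rpow (norm_nonneg _) (M.le_opNorm _) h2.le)

lemma shiftTerm_apply {d : ℕ} (M : Cd d →L[ℂ] Cd d) (m : ℤ) (u : l2Z d) (n : ℤ) :
    shiftTerm M m u n = M (u (n - m)) := rfl

lemma norm_shiftTerm_le {d : ℕ} (M : Cd d →L[ℂ] Cd d) (m : ℤ) : ‖shiftTerm M m‖ ≤ ‖M‖ :=
  LinearMap.mkContinuous_norm_le _ (norm_nonneg _) _

/-- The block convolution (block Laurent) operator `∑ A_m S^m` on `ℓ₂(ℤ; ℂ^d)`; for an absolutely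
summable sequence `A` the series converges in the operator norm. -/
def convOp {d : ℕ} (A : ℤ → Matrix (Fin d) (Fin d) ℂ) : l2Z d →L[ℂ] l2Z d :=
  ∑' m : ℤ, shiftTerm (matOp (A m)) m

/-- `convOp A` is convolution with `A`: `(A * u)_n = ∑_k A_{n-k} u_k`. -/
lemma hasSum_convOp_apply {d : ℕ} {A : ℤ → Matrix (Fin d) (Fin d) ℂ}
    (hA : Summable fun n => ‖A n‖) (u : l2Z d) (n : ℤ) :
    HasSum (fun k : ℤ => matOp (A (n - k)) (u k)) (convOp A u n) := by
  have hs : Summable fun m : ℤ => shiftTerm (matOp (A m)) m :=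
    Summable.of_norm_bounded hA (fun m => norm_shiftTerm_le _ _)
  have h1 := (hs.hasSum.mapL (ContinuousLinearMap.apply ℂ (l2Z d) u)).mapL
    (lp.evalCLM ℂ (fun _ : ℤ => Cd d) (p := 2) n)
  have h2 := (Equiv.subLeft n).hasSum_iff.2 h1
  have h3 : ∀ k : ℤ, matOp (A (n - k)) (u k) = shiftTerm (matOp (A (n - k))) (n - k) u n := by
    intro k
    rw [shiftTerm_apply, sub_sub_cancel]
  simp_rw [h3]
  exact h2

/-- The symbol `A(z) = ∑ A_n z^n`, as an operator on `ℂ^d`. -/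
def symbol {d : ℕ} (A : ℤ → Matrix (Fin d) (Fin d) ℂ) (z : Torus) : Cd d →L[ℂ] Cd d :=
  ∑' n : ℤ, fourier n z • matOp (A n)

/-! ### Fourier transformation and multiplication operators -/

lemma fourierCoeff_compLp {E F : Type*} [NormedAddCommGroup E] [NormedSpace ℂ E] [CompleteSpace E]
    [NormedAddCommGroup F] [NormedSpace ℂ F] [CompleteSpace F]
    (L : E →L[ℂ] F) (u : Lp E 2 tau) (n : ℤ) :
    fourierCoeff (L.compLp u : Lp F 2 tau) n = L (fourierCoeff u n) := by
  have hi : Integrable (fun t : Torus => fourier (-n) t • u t) tau :=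
    ((Lp.memLp u).integrable (by norm_num)).fourier_smul _
  rw [fourierCoeff, fourierCoeff, ← L.integral_comp_comm hi]
  refine integral_congr_ae ?_
  filter_upwards [L.coeFn_compLp u] with t ht
  rw [ht, map_smul]

lemma hasSum_norm_sq_fourierCoeff {d : ℕ} (u : L2T d) :
    HasSum (fun n : ℤ => ‖fourierCoeff u n‖ ^ 2) (‖u‖ ^ 2) := by
  have hc : ∀ i : Fin d, HasSum (fun n : ℤ => ‖fourierCoeff u n i‖ ^ 2)
      (∫ t, ‖u t i‖ ^ 2 ∂tau) := by
    intro i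
    have h := hasSum_sq_fourierCoeff ((EuclideanSpace.proj (𝕜 := ℂ) i).compLp u : Lp ℂ 2 tau)
    convert h using 1
    · ext n
      rw [fourierCoeff_compLp]; rfl
    · refine integral_congr_ae ?_
      filter_upwards [(EuclideanSpace.proj (𝕜 := ℂ) i).coeFn_compLp u] with t ht
      rw [ht]; rfl
  have hint : ∀ i : Fin d, Integrable (fun t => ‖u t i‖ ^ 2) tau := by
    intro i
    have h := (Lp.memLp ((EuclideanSpace.proj (𝕜 := ℂ) i).compLp u : Lp ℂ 2 tau)).integrable_norm_pow
      (by norm_num)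
    refine h.congr ?_
    filter_upwards [(EuclideanSpace.proj (𝕜 := ℂ) i).coeFn_compLp u] with t ht
    rw [ht]; rfl
  have hsum := hasSum_sum (s := Finset.univ) (fun i _ => hc i)
  convert hsum using 1
  · ext n
    exact EuclideanSpace.norm_sq_eq _
  · rw [← integral_finsetSum _ (fun i _ => hint i)]
    have h : ‖u‖ ^ 2 = ∫ t, ‖u t‖ ^ 2 ∂tau := by
      have h0 := congrArg Complex.re (L2.inner_def (𝕜 := ℂ) u u)
      rw [inner_self_eq_norm_sq_to_K] at h0
      have h1 : ∀ t, inner ℂ (u t) (u t) = ((‖u t‖ ^ 2 : ℝ) : ℂ) := by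
        intro t; rw [inner_self_eq_norm_sq_to_K]; norm_cast
      simp_rw [h1] at h0
      rw [integral_complex_ofReal] at h0
      norm_cast at h0
    rw [h]
    refine integral_congr_ae (.of_forall fun t => ?_)
    exact EuclideanSpace.norm_sq_eq _

lemma memlp_fourierCoeff {d : ℕ} (u : L2T d) : Memℓp (fun n : ℤ => fourierCoeff u n) 2 := by
  refine memℓp_gen ?_
  simpa using (hasSum_norm_sq_fourierCoeff u).summable

/-- The Fourier transformation as a linear isometry: `u ↦ (u_n)`, `u_n = ∫ u(z) z^{-n} dτ`. -/
def fourierIsom (d : ℕ) : L2T d →ₗᵢ[ℂ] l2Z d where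
  toFun u := ⟨fun n : ℤ => fourierCoeff u n, memlp_fourierCoeff u⟩
  map_add' u v := by
    ext n : 2
    have hu := (Lp.memLp u).integrable (by norm_num : (1 : ℝ≥0∞) ≤ 2)
    have hv := (Lp.memLp v).integrable (by norm_num : (1 : ℝ≥0∞) ≤ 2)
    change fourierCoeff (u + v : L2T d) n = fourierCoeff u n + fourierCoeff v n
    rw [fourierCoeff_congr_ae (Lp.coeFn_add u v), fourierCoeff.add hu hv]; rfl
  map_smul' c u := by
    ext n : 2
    change fourierCoeff (c • u : L2T d) n = c • fourierCoeff u n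
    rw [fourierCoeff_congr_ae (Lp.coeFn_smul c u), fourierCoeff.const_smul]
  norm_map' u := by
    have h2 : 0 < (2 : ℝ≥0∞).toReal := by norm_num
    have h := lp.norm_rpow_eq_tsum h2
      (⟨fun n : ℤ => fourierCoeff u n, memlp_fourierCoeff u⟩ : l2Z d)
    have h' := (hasSum_norm_sq_fourierCoeff u).tsum_eq
    simp only [ENNReal.toReal_ofNat, Real.rpow_ofNat] at h
    rw [h'] at h
    exact (sq_eq_sq₀ (norm_nonneg _) (norm_nonneg _)).1 h

lemma fourierIsom_apply {d : ℕ} (u : L2T d) (n : ℤ) : fourierIsom d u n = fourierCoeff u n := rfl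

lemma fourierIsom_surjective (d : ℕ) : Function.Surjective (fourierIsom d) := by
  intro v
  have hv : ∀ i : Fin d, Memℓp (fun n : ℤ => v n i) 2 := by
    intro i
    have h2 : 0 < (2 : ℝ≥0∞).toReal := by norm_num
    refine memℓp_gen (Summable.of_nonneg_of_le (fun n => by positivity) (fun n => ?_)
      ((memℓp_gen_iff h2).1 (lp.memℓp v)))
    exact Real.rpow_le_rpow (norm_nonneg _) (PiLp.norm_apply_le _ _) h2.le
  let f : Fin d → Lp ℂ 2 tau := fun i => fourierBasis.repr.symm ⟨_, hv i⟩
  have hf : ∀ i n, fourierCoeff (f i) n = v n i := by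
    intro i n
    rw [← fourierBasis_repr, LinearIsometryEquiv.apply_symm_apply]
  refine ⟨∑ i, (ContinuousLinearMap.toSpanSingleton ℂ (EuclideanSpace.single i (1 : ℂ))).compLp
    (f i), ?_⟩
  ext n j
  rw [map_sum, lp.coeFn_sum, Finset.sum_apply]
  simp_rw [fourierIsom_apply, fourierCoeff_compLp, hf]
  simp [Finset.sum_apply, Pi.single_apply]

/-- The unitary Fourier operator `F : L₂(𝕋; ℂ^d) → ℓ₂(ℤ; ℂ^d)`. -/
def fourierOp (d : ℕ) : L2T d ≃ₗᵢ[ℂ] l2Z d :=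
  LinearIsometryEquiv.ofSurjective (fourierIsom d) (fourierIsom_surjective d)

open Classical in
/-- The operator `(M u)(z) = M(z) u(z)` of multiplication by a measurable essentially bounded
operator-valued function `M` (and `0` for other `M`). -/
def multOp {d : ℕ} (M : Torus → (Cd d →L[ℂ] Cd d)) : L2T d →L[ℂ] L2T d :=
  if h : MemLp M ∞ tau then
    (ContinuousLinearMap.id ℂ (Cd d →L[ℂ] Cd d)).holderL tau ∞ 2 2 h.toLp
  else 0

lemma multOp_apply {d : ℕ} {M : Torus → (Cd d →L[ℂ] Cd d)} (h : MemLp M ∞ tau) (u : L2T d) :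
    multOp M u =ᵐ[tau] fun z => M z (u z) := by
  rw [multOp, dif_pos h]
  filter_upwards [(ContinuousLinearMap.id ℂ (Cd d →L[ℂ] Cd d)).coeFn_holder (r := 2) h.toLp u,
    h.coeFn_toLp] with z h1 h2
  rw [ContinuousLinearMap.holderL_apply_apply, h1, h2]; rfl

/-- The convolution operator with symbol `M`: `F M F*`. -/
def convOfSymbol {d : ℕ} (M : Torus → (Cd d →L[ℂ] Cd d)) : l2Z d →L[ℂ] l2Z d :=
  (fourierOp d).toContinuousLinearEquiv.toContinuousLinearMap ∘L multOp M ∘L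
    (fourierOp d).symm.toContinuousLinearEquiv.toContinuousLinearMap

/-! ### Schur bases of the symbol and the chain -/

/-- `lam k`, `phi k` (`k = 0, …, d-1`) are eigenvalue functions and Schur vectors of `A(z)`: the
eigenvalues are continuous along `t ∈ [0, 2π)`, `z = e^{it}`, the vectors are measurable in `z` and
form an orthonormal basis of `ℂ^d` in which `A(z)` is upper triangular with diagonal `lam`. -/
structure IsSchurSystem {d : ℕ} (A : ℤ → Matrix (Fin d) (Fin d) ℂ)
    (lam : Fin d → Torus → ℂ) (phi : Fin d → Torus → Cd d) : Prop where
  continuousOn_lam : ∀ k, ContinuousOn (fun t : ℝ => lam k (t : Torus)) (Set.Ico 0 (2 * Real.pi))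
  measurable_phi : ∀ k, Measurable (phi k)
  orthonormal : ∀ z, Orthonormal ℂ (fun k => phi k z)
  triangular : ∀ z k, ∃ mu : Fin d → ℂ,
    symbol A z (phi k z) = lam k z • phi k z + ∑ l ∈ Finset.Iio k, mu l • phi l z

/-- The orthogonal projection `ΔP_k(z) = ⟨·, φ_k(z)⟩ φ_k(z)`. -/
def deltaP {d : ℕ} (phi : Fin d → Torus → Cd d) (k : Fin d) (z : Torus) : Cd d →L[ℂ] Cd d :=
  InnerProductSpace.rankOne ℂ (phi k z) (phi k z)

/-- `∑_{l < k} ΔP_l(z)`: the projection onto the Schur vectors preceding the one with index `k`. -/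
def projBelow {d : ℕ} (phi : Fin d → Torus → Cd d) (k : Fin d) (z : Torus) : Cd d →L[ℂ] Cd d :=
  ∑ l ∈ Finset.Iio k, deltaP phi l z

/-- `A_0(z) = ∑_k λ_k(z) ΔP_k(z)`. -/
def diagSymbol {d : ℕ} (lam : Fin d → Torus → ℂ) (phi : Fin d → Torus → Cd d) (z : Torus) :
    Cd d →L[ℂ] Cd d :=
  ∑ k, lam k z • deltaP phi k z

/-- `A_+(z) = ∑_k (∑_{l < k} ΔP_l(z)) A(z) ΔP_k(z)`. -/
def upperSymbol {d : ℕ} (A : ℤ → Matrix (Fin d) (Fin d) ℂ) (phi : Fin d → Torus → Cd d)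
    (z : Torus) : Cd d →L[ℂ] Cd d :=
  ∑ k, projBelow phi k z ∘L symbol A z ∘L deltaP phi k z

/-- The argument of `z` in `[0, 2π)`. -/
def argT (z : Torus) : ℝ := (AddCircle.equivIco (2 * Real.pi) 0 z : ℝ)

/-- A point `ν` of the oriented curves `λ_k(𝕋)`: the number `k` of the curve and the parameter
`t ∈ [0, 2π]`, so that `ν = λ_k(e^{it})`; `t = 0` is the initial and `t = 2π` the end point. -/
abbrev CurvePt (d : ℕ) : Type := Fin d × Set.Icc (0 : ℝ) (2 * Real.pi)

/-- The order `ν ≺ μ`: smaller number of the curve, or the same curve and smaller parameter. -/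
def CurvePt.Prec {d : ℕ} (ν μ : CurvePt d) : Prop :=
  ν.1 < μ.1 ∨ ν.1 = μ.1 ∧ (ν.2 : ℝ) < μ.2

open Classical in
/-- `P_ν(z) = ∑_{l < k} ΔP_l(z) + χ ΔP_k(z)`, `ν = (k, t)`, where `χ = 1` if the point `λ_k(z)` of
the curve with number `k` lies on its arc from the initial point up to (not including) `ν`, that
is if `arg z < t`, and `χ = 0` otherwise. -/
def chainSymbol {d : ℕ} (phi : Fin d → Torus → Cd d) (ν : CurvePt d) (z : Torus) :
    Cd d →L[ℂ] Cd d :=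
  projBelow phi ν.1 z + (if argT z < (ν.2 : ℝ) then (1 : ℂ) else 0) • deltaP phi ν.1 z

lemma coe_argT (z : Torus) : ((argT z : ℝ) : Torus) = z :=
  (AddCircle.equivIco (2 * Real.pi) 0).symm_apply_apply z

lemma argT_mem (z : Torus) : argT z ∈ Set.Ico 0 (2 * Real.pi) := by
  have h := (AddCircle.equivIco (2 * Real.pi) 0 z).2
  exact ⟨h.1, h.2.trans_eq (zero_add _)⟩

open Classical in
/-- On a simple curve the cut-off in `chainSymbol` is the indicator function of the arc
`{λ_k(e^{is}) : 0 ≤ s < t}` of the complex plane, evaluated at `λ_k(z)`. -/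
lemma chainSymbol_eq_of_injective {d : ℕ} {lam : Fin d → Torus → ℂ} {phi : Fin d → Torus → Cd d}
    (ν : CurvePt d) (hinj : Function.Injective (lam ν.1)) (z : Torus) :
    chainSymbol phi ν z = projBelow phi ν.1 z +
      Set.indicator ((fun s : ℝ => lam ν.1 (s : Torus)) '' Set.Ico 0 (ν.2 : ℝ)) (fun _ => (1 : ℂ))
        (lam ν.1 z) • deltaP phi ν.1 z := by
  have key : lam ν.1 z ∈ (fun s : ℝ => lam ν.1 (s : Torus)) '' Set.Ico 0 (ν.2 : ℝ) ↔
      argT z < (ν.2 : ℝ) := by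
    constructor
    · rintro ⟨s, ⟨hs0, hs1⟩, hs⟩
      have hz : (s : Torus) = ((argT z : ℝ) : Torus) := by rw [coe_argT]; exact hinj hs
      have hz' := (AddCircle.coe_eq_coe_iff_of_mem_Ico (p := 2 * Real.pi) (a := 0)
        ⟨hs0, by simpa using hs1.trans_le ν.2.2.2⟩ (by simpa using argT_mem z)).1 hz
      rwa [← hz']
    · intro h
      exact ⟨argT z, ⟨(argT_mem z).1, h⟩, by simp only [coe_argT]⟩
  rw [chainSymbol, Set.indicator_apply]
  simp only [key]

/-- The projection `F P_ν F*` on `ℓ₂(ℤ; ℂ^d)`. -/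
def chainProj {d : ℕ} (phi : Fin d → Torus → Cd d) (ν : CurvePt d) : l2Z d →L[ℂ] l2Z d :=
  convOfSymbol (chainSymbol phi ν)

/-- The chain of all projections `F P_ν F*`. -/
def chainOf {d : ℕ} (phi : Fin d → Torus → Cd d) : Set (l2Z d →L[ℂ] l2Z d) :=
  Set.range (chainProj phi)

/-! ### Chains of projections, triangular integrals, parts of operators -/

section Chains

variable {X : Type*} [NormedAddCommGroup X] [NormedSpace ℂ X]

/-- The order of projections: `P ≤ Q` iff `PQ = QP = P`. -/
def ProjLE (P Q : X →L[ℂ] X) : Prop := P * Q = P ∧ Q * P = P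

/-- A chain: a set of projections that contains `O` and `I` and is linearly ordered. -/
structure IsProjChain (C : Set (X →L[ℂ] X)) : Prop where
  idem : ∀ P ∈ C, P * P = P
  zero_mem : 0 ∈ C
  one_mem : 1 ∈ C
  total : ∀ P ∈ C, ∀ Q ∈ C, ProjLE P Q ∨ ProjLE Q P

/-- A chain that is not properly included in any other chain. -/
def IsMaximalProjChain (C : Set (X →L[ℂ] X)) : Prop :=
  IsProjChain C ∧ ∀ C' : Set (X →L[ℂ] X), IsProjChain C' → C ⊆ C' → C' = C

/-- The chain `C` is invariant under `B`. -/
def IsInvariantChain (C : Set (X →L[ℂ] X)) (B : X →L[ℂ] X) : Prop :=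
  ∀ P ∈ C, P * B * P = B * P

/-- The chain `C` reduces `B`. -/
def IsReducingChain (C : Set (X →L[ℂ] X)) (B : X →L[ℂ] X) : Prop :=
  ∀ P ∈ C, B * P = P * B

/-- A finite partition `O = P_0 ≤ P_1 ≤ … ≤ P_n = I` of a chain. -/
structure ChainPartition (C : Set (X →L[ℂ] X)) where
  n : ℕ
  proj : ℕ → (X →L[ℂ] X)
  mem : ∀ i ≤ n, proj i ∈ C
  first : proj 0 = 0
  last : proj n = 1
  mono : ∀ i < n, ProjLE (proj i) (proj (i + 1))

/-- `π'` refines `π`: every projection in `π` occurs in `π'`. -/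
def ChainPartition.Refines {C : Set (X →L[ℂ] X)} (π' π : ChainPartition C) : Prop :=
  ∀ i ≤ π.n, ∃ j ≤ π'.n, π'.proj j = π.proj i

/-- `∑_i (P_{i+1} - P_i) B (P_{i+1} - P_i)`. -/
def ChainPartition.diagSum {C : Set (X →L[ℂ] X)} (π : ChainPartition C) (B : X →L[ℂ] X) :
    X →L[ℂ] X :=
  ∑ i ∈ Finset.range π.n, (π.proj (i + 1) - π.proj i) * B * (π.proj (i + 1) - π.proj i)

/-- `∑_i P_i B (P_{i+1} - P_i)`. -/
def ChainPartition.upperSum {C : Set (X →L[ℂ] X)} (π : ChainPartition C) (B : X →L[ℂ] X) :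
    X →L[ℂ] X :=
  ∑ i ∈ Finset.range π.n, π.proj i * B * (π.proj (i + 1) - π.proj i)

/-- `D = ∫_C (dP) B (dP)`: the limit of the sums in the operator norm as the partitions are
refined. -/
def IsDiagIntegral (C : Set (X →L[ℂ] X)) (B D : X →L[ℂ] X) : Prop :=
  ∀ ε > 0, ∃ π₀ : ChainPartition C, ∀ π : ChainPartition C, π.Refines π₀ → ‖π.diagSum B - D‖ < ε

/-- `U = ∫_C P B (dP)`, in the same sense. -/
def IsUpperIntegral (C : Set (X →L[ℂ] X)) (B U : X →L[ℂ] X) : Prop :=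
  ∀ ε > 0, ∃ π₀ : ChainPartition C, ∀ π : ChainPartition C, π.Refines π₀ → ‖π.upperSum B - U‖ < ε

/-- The operator `P B` on the range of the projection `P`, as an operator on that space. -/
def partOn (P B : X →L[ℂ] X) : P.range →L[ℂ] P.range :=
  (P ∘L B ∘L P.range.subtypeL).codRestrict P.range (fun x => ⟨B x, rfl⟩)

/-- The spectrum of `P B` regarded as an operator on the range of the projection `P`. -/
def spectrumOn (P B : X →L[ℂ] X) : Set ℂ := spectrum ℂ (partOn P B)

end Chains

end

end BlockConv

/-! The Fourier transformation turns the convolution operator into multiplication by its symbol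
(`convOp_eq_convOfSymbol`), and `convOfSymbol` is an algebra homomorphism on bounded measurable
symbols. An algebraic identity between the operators is therefore checked pointwise, on the vectors
of the Schur frame (`clm_ext_orthonormal`).

The curves are concatenated to one interval $[0,2\pi d]$. The chain becomes a family $E(r)$ of
multiplications by coordinate cut-offs in the frame, with $E(r)E(s)=E(\min(r,s))$. Points are null
sets, so $E$ is strongly continuous; open arcs have positive measure, so $E$ is injective on
$[0,2\pi d]$. If a projection $Q$ is comparable with every $E(r)$, then $\{r: E(r)\le Q\}$ and $\{r:
Q\le E(r)\}$ are nonempty closed sets covering the line; by connectedness they meet, and $Q=E(r)$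
there. This is maximality. At each $z$ the range of $E(r)$ is spanned by an initial segment of the
Schur basis, which gives invariance.

A partition that contains the end points of the curves has increments that act on a single frame
vector. For such a partition the two integral sums are equal to $\mathbf A_0$ and $\mathbf A_+$, so
no estimate is needed. At each $z$, $A_+(z)$ is strictly triangular, hence its $d$-th power is zero.

The spectral statements hold for the compression to any coordinate subspace, given by measurable
sets $s_l$ of the circle. If $w$ keeps a distance from all values $\lambda_l(z)$, $z\in s_l$, the
diagonal part of $A-w$ has a bounded inverse on the subspace and the rest is a nilpotent
perturbation (`exists_corner_inverse`). Conversely, each $\lambda_l(z)-w$ is an eigenvalue of the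
compressed matrix, so an inverse $C$ forces $1\le\|C\|\,|\lambda_l(z)-w|$ for almost all $z\in s_l$
(`ae_one_le`); continuity of $\lambda_l$ from the right removes the exceptional null set.

For existence, the eigenvalues are enumerated continuously along $[0,2\pi]$: nearest-neighbour
enumerations on finer and finer grids have an ultrafilter limit, and they stay under control because
small steps cannot cross a gap in the set of distances between eigenvalues (`norm_sub_lt_of_chain`).
The Schur vectors come from deflation: a measurable unit kernel vector is chosen, the projection is
enlarged by it, and the determinant loses one linear factor (`exists_measurable_schur`). -/

namespace BlockConv

/-! ### Multiplication operators with bounded symbols -/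

/-- A measurable and bounded operator-valued function on the circle. -/
structure BoundedSymbol {d : ℕ} (M : Torus → (Cd d →L[ℂ] Cd d)) : Prop where
  meas : StronglyMeasurable M
  bound : ∃ C : ℝ, ∀ z, ‖M z‖ ≤ C

namespace BoundedSymbol

variable {d : ℕ} {M N : Torus → (Cd d →L[ℂ] Cd d)}

lemma memLp (h : BoundedSymbol M) : MemLp M ∞ tau := by
  obtain ⟨C, hC⟩ := h.bound
  exact memLp_top_of_bound h.meas.aestronglyMeasurable C (.of_forall hC)

lemma const (L : Cd d →L[ℂ] Cd d) : BoundedSymbol (fun _ => L) :=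
  ⟨stronglyMeasurable_const, ‖L‖, fun _ => le_rfl⟩

lemma add (hM : BoundedSymbol M) (hN : BoundedSymbol N) : BoundedSymbol (fun z => M z + N z) := by
  obtain ⟨C, hC⟩ := hM.bound
  obtain ⟨D, hD⟩ := hN.bound
  exact ⟨hM.meas.add hN.meas, C + D,
    fun z => (norm_add_le _ _).trans (add_le_add (hC z) (hD z))⟩

lemma sub (hM : BoundedSymbol M) (hN : BoundedSymbol N) : BoundedSymbol (fun z => M z - N z) := by
  obtain ⟨C, hC⟩ := hM.bound
  obtain ⟨D, hD⟩ := hN.bound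
  exact ⟨hM.meas.sub hN.meas, C + D,
    fun z => (norm_sub_le _ _).trans (add_le_add (hC z) (hD z))⟩

lemma mul (hM : BoundedSymbol M) (hN : BoundedSymbol N) : BoundedSymbol (fun z => M z * N z) := by
  obtain ⟨C, hC⟩ := hM.bound
  obtain ⟨D, hD⟩ := hN.bound
  refine ⟨hM.meas.mul hN.meas, C * D, fun z => (norm_mul_le _ _).trans ?_⟩
  exact mul_le_mul (hC z) (hD z) (norm_nonneg _) ((norm_nonneg _).trans (hC z))

lemma pow (hM : BoundedSymbol M) (n : ℕ) : BoundedSymbol (fun z => M z ^ n) := by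
  induction n with
  | zero => simpa using const 1
  | succ n ih => simpa only [pow_succ] using ih.mul hM

lemma smul {g : Torus → ℂ} (hg : Measurable g) (hgb : ∃ C : ℝ, ∀ z, ‖g z‖ ≤ C)
    (hM : BoundedSymbol M) : BoundedSymbol (fun z => g z • M z) := by
  obtain ⟨C, hC⟩ := hM.bound
  obtain ⟨D, hD⟩ := hgb
  refine ⟨hg.stronglyMeasurable.smul hM.meas, D * C, fun z => ?_⟩
  rw [norm_smul]
  exact mul_le_mul (hD z) (hC z) (norm_nonneg _) ((norm_nonneg _).trans (hD z))

lemma sum {ι : Type*} (s : Finset ι) {f : ι → Torus → (Cd d →L[ℂ] Cd d)}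
    (hf : ∀ i, BoundedSymbol (f i)) : BoundedSymbol (fun z => ∑ i ∈ s, f i z) := by
  classical
  induction s using Finset.induction_on with
  | empty => simpa using const 0
  | insert a s ha ih => simpa only [Finset.sum_insert ha] using (hf a).add ih

end BoundedSymbol

/-! ### The homomorphism from bounded symbols to operators. -/

section MultOp

variable {d : ℕ} {M N : Torus → (Cd d →L[ℂ] Cd d)}

/-- Boundedness cannot be dropped: `multOp` takes the default value 0 on symbols that are not in
$L_\infty$, so it is additive only where all three symbols are admissible. -/
lemma multOp_add (hM : BoundedSymbol M) (hN : BoundedSymbol N) :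
    multOp (fun z => M z + N z) = multOp M + multOp N := by
  ext1 u
  apply Lp.ext
  rw [add_apply]
  filter_upwards [multOp_apply (hM.add hN).memLp u, multOp_apply hM.memLp u,
    multOp_apply hN.memLp u, Lp.coeFn_add (multOp M u) (multOp N u)] with z h1 h2 h3 h4
  rw [h1, h4, Pi.add_apply, h2, h3]; rfl

lemma multOp_sub (hM : BoundedSymbol M) (hN : BoundedSymbol N) :
    multOp (fun z => M z - N z) = multOp M - multOp N := by
  ext1 u
  apply Lp.ext
  rw [sub_apply]
  filter_upwards [multOp_apply (hM.sub hN).memLp u, multOp_apply hM.memLp u,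
    multOp_apply hN.memLp u, Lp.coeFn_sub (multOp M u) (multOp N u)] with z h1 h2 h3 h4
  rw [h1, h4, Pi.sub_apply, h2, h3]; rfl

lemma multOp_mul (hM : BoundedSymbol M) (hN : BoundedSymbol N) :
    multOp (fun z => M z * N z) = multOp M * multOp N := by
  ext1 u
  apply Lp.ext
  rw [mul_apply_eq_comp]
  filter_upwards [multOp_apply (hM.mul hN).memLp u, multOp_apply hM.memLp (multOp N u),
    multOp_apply hN.memLp u] with z h1 h2 h3
  rw [h1, h2, h3]; rfl

lemma multOp_const_smul_one (c : ℂ) :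
    multOp (fun _ => c • (1 : Cd d →L[ℂ] Cd d)) = c • 1 := by
  ext1 u
  apply Lp.ext
  filter_upwards [multOp_apply (BoundedSymbol.const (c • (1 : Cd d →L[ℂ] Cd d))).memLp u,
    Lp.coeFn_smul c u] with z h1 h2
  rw [h1]
  exact h2.symm

lemma convOfSymbol_fourierOp (M : Torus → (Cd d →L[ℂ] Cd d)) (u : L2T d) :
    convOfSymbol M (fourierOp d u) = fourierOp d (multOp M u) := by
  change fourierOp d (multOp M ((fourierOp d).symm (fourierOp d u))) = _
  rw [LinearIsometryEquiv.symm_apply_apply]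

lemma ext_fourierOp {S T : l2Z d →L[ℂ] l2Z d}
    (h : ∀ u, S (fourierOp d u) = T (fourierOp d u)) : S = T := by
  ext1 v
  obtain ⟨u, rfl⟩ := (fourierOp d).surjective v
  exact h u

lemma convOfSymbol_add (hM : BoundedSymbol M) (hN : BoundedSymbol N) :
    convOfSymbol (fun z => M z + N z) = convOfSymbol M + convOfSymbol N :=
  ext_fourierOp fun u => by
    simp only [add_apply, convOfSymbol_fourierOp, multOp_add hM hN, map_add]

lemma convOfSymbol_sub (hM : BoundedSymbol M) (hN : BoundedSymbol N) :
    convOfSymbol (fun z => M z - N z) = convOfSymbol M - convOfSymbol N :=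
  ext_fourierOp fun u => by
    simp only [sub_apply, convOfSymbol_fourierOp, multOp_sub hM hN, map_sub]

lemma convOfSymbol_mul (hM : BoundedSymbol M) (hN : BoundedSymbol N) :
    convOfSymbol (fun z => M z * N z) = convOfSymbol M * convOfSymbol N :=
  ext_fourierOp fun u => by
    simp only [mul_apply_eq_comp, convOfSymbol_fourierOp, multOp_mul hM hN]

lemma convOfSymbol_const_smul_one (c : ℂ) :
    convOfSymbol (fun _ => c • (1 : Cd d →L[ℂ] Cd d)) = c • 1 :=
  ext_fourierOp fun u => by
    simp only [smul_apply, one_apply_eq_self,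
      convOfSymbol_fourierOp, multOp_const_smul_one, map_smul]

lemma convOfSymbol_one : convOfSymbol (fun _ => (1 : Cd d →L[ℂ] Cd d)) = 1 := by
  simpa using convOfSymbol_const_smul_one (d := d) 1

lemma convOfSymbol_zero : convOfSymbol (fun _ => (0 : Cd d →L[ℂ] Cd d)) = 0 := by
  simpa only [sub_self] using
    convOfSymbol_sub (BoundedSymbol.const (1 : Cd d →L[ℂ] Cd d)) (BoundedSymbol.const 1)

lemma convOfSymbol_pow (hM : BoundedSymbol M) (n : ℕ) :
    convOfSymbol (fun z => M z ^ n) = convOfSymbol M ^ n := by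
  induction n with
  | zero => simpa using convOfSymbol_one
  | succ n ih => simp only [pow_succ, convOfSymbol_mul (hM.pow n) hM, ih]

lemma convOfSymbol_isSelfAdjoint (hM : BoundedSymbol M) (h : ∀ z, IsSelfAdjoint (M z)) :
    IsSelfAdjoint (convOfSymbol M) := by
  rw [ContinuousLinearMap.isSelfAdjoint_iff_isSymmetric]
  intro x y
  obtain ⟨u, rfl⟩ := (fourierOp d).surjective x
  obtain ⟨v, rfl⟩ := (fourierOp d).surjective y
  simp only [ContinuousLinearMap.coe_coe, convOfSymbol_fourierOp, LinearIsometryEquiv.inner_map_map,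
    L2.inner_def]
  refine integral_congr_ae ?_
  filter_upwards [multOp_apply hM.memLp u, multOp_apply hM.memLp v] with z h1 h2
  rw [h1, h2]
  exact (ContinuousLinearMap.isSelfAdjoint_iff_isSymmetric.1 (h z)) _ _

lemma norm_sq_eq_integral (u : L2T d) : ‖u‖ ^ 2 = ∫ t, ‖u t‖ ^ 2 ∂tau := by
  have h0 := congrArg Complex.re (L2.inner_def (𝕜 := ℂ) u u)
  rw [inner_self_eq_norm_sq_to_K] at h0
  have h1 : ∀ t, inner ℂ (u t) (u t) = ((‖u t‖ ^ 2 : ℝ) : ℂ) := by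
    intro t; rw [inner_self_eq_norm_sq_to_K]; norm_cast
  simp_rw [h1] at h0
  rw [integral_complex_ofReal] at h0
  norm_cast at h0

/-! ### The symbol of a block convolution operator -/

lemma norm_fourier_smul_le (A : ℤ → Matrix (Fin d) (Fin d) ℂ) (n : ℤ) (z : Torus) :
    ‖fourier n z • matOp (A n)‖ ≤ ‖A n‖ := by
  have h : ‖fourier n z‖ = 1 := by rw [fourier_apply, Circle.norm_coe]
  rw [norm_smul, h, one_mul]
  exact le_rfl

lemma continuous_symbol {A : ℤ → Matrix (Fin d) (Fin d) ℂ} (hA : Summable fun n => ‖A n‖) :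
    Continuous (symbol A) :=
  continuous_tsum (fun n => (fourier n).continuous.smul continuous_const) hA
    (norm_fourier_smul_le A)

lemma hasSum_symbol {A : ℤ → Matrix (Fin d) (Fin d) ℂ} (hA : Summable fun n => ‖A n‖)
    (z : Torus) : HasSum (fun n => fourier n z • matOp (A n)) (symbol A z) :=
  (Summable.of_norm_bounded hA (fun n => norm_fourier_smul_le A n z)).hasSum

lemma boundedSymbol_symbol {A : ℤ → Matrix (Fin d) (Fin d) ℂ} (hA : Summable fun n => ‖A n‖) :
    BoundedSymbol (symbol A) :=
  ⟨(continuous_symbol hA).stronglyMeasurable, ∑' n, ‖A n‖,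
    fun z => tsum_of_norm_bounded hA.hasSum (fun n => norm_fourier_smul_le A n z)⟩

/-- The $n$-th Fourier coefficient of $A(z)u(z)$ may be integrated term by term, because $u\in
L_2\subset L_1$ and $\sum_m\|A_m\|\,\|u\|_1<\infty$. The $m$-th term contributes $A_mu_{n-m}$, and
$k=n-m$ gives the convolution sum. -/
lemma convOp_eq_convOfSymbol {A : ℤ → Matrix (Fin d) (Fin d) ℂ} (hA : Summable fun n => ‖A n‖) :
    convOp A = convOfSymbol (symbol A) := by
  refine ext_fourierOp fun u => ?_
  rw [convOfSymbol_fourierOp]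
  ext1
  funext n
  have hu : Integrable u tau := (Lp.memLp u).integrable (by norm_num)
  have h1 := hasSum_convOp_apply hA (fourierOp d u) n
  have hint : ∀ m : ℤ, Integrable (fun z => fourier (-n) z • (fourier m z • matOp (A m)) (u z))
      tau := by
    intro m
    have := ((matOp (A m)).integrable_comp hu).fourier_smul m
    exact this.fourier_smul (-n)
  have hnorm : ∀ (m : ℤ) (z : Torus),
      ‖fourier (-n) z • (fourier m z • matOp (A m)) (u z)‖ ≤ ‖A m‖ * ‖u z‖ := by
    intro m z
    have h : ‖fourier (-n) z‖ = 1 := by rw [fourier_apply, Circle.norm_coe]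
    rw [norm_smul, h, one_mul]
    exact (ContinuousLinearMap.le_opNorm _ _).trans
      (mul_le_mul_of_nonneg_right (norm_fourier_smul_le A m z) (norm_nonneg _))
  have h2 := hasSum_integral_of_summable_integral_norm hint (by
    refine Summable.of_nonneg_of_le (fun m => integral_nonneg fun z => norm_nonneg _) (fun m => ?_)
      (hA.mul_right (∫ z, ‖u z‖ ∂tau))
    rw [← integral_const_mul]
    exact integral_mono (hint m).norm (hu.norm.const_mul _) (hnorm m))
  have h3 : ∫ z, ∑' m : ℤ, fourier (-n) z • (fourier m z • matOp (A m)) (u z) ∂tau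
      = fourierOp d (multOp (symbol A) u) n := by
    change _ = fourierCoeff (multOp (symbol A) u) n
    rw [fourierCoeff]
    refine integral_congr_ae ?_
    filter_upwards [multOp_apply (boundedSymbol_symbol hA).memLp u] with z hz
    rw [hz]
    exact (((hasSum_symbol hA z).mapL (ContinuousLinearMap.apply ℂ (Cd d) (u z))).const_smul
      _).tsum_eq
  rw [h3] at h2
  have h4 : ∀ m : ℤ, ∫ z, fourier (-n) z • (fourier m z • matOp (A m)) (u z) ∂tau
      = matOp (A m) (fourierOp d u (n - m)) := by
    intro m
    change _ = matOp (A m) (fourierCoeff u (n - m))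
    rw [fourierCoeff, ← (matOp (A m)).integral_comp_comm (hu.fourier_smul _)]
    refine integral_congr_ae (.of_forall fun z => ?_)
    simp only [smul_apply, map_smul, smul_smul, ← fourier_add]
    congr 2
    rw [show -n + m = -(n - m) by ring]
  simp_rw [h4] at h2
  refine h1.unique ?_
  have h5 := (Equiv.subLeft n).hasSum_iff.2 h2
  simpa only [Function.comp_def, Equiv.subLeft_apply, sub_sub_cancel] using h5

end MultOp

end BlockConv

namespace BlockConv

/-! ### Operators in an orthonormal frame -/

/-- A measurable orthonormal frame on the circle. -/
structure IsFrame {d : ℕ} (phi : Fin d → Torus → Cd d) : Prop where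
  meas : ∀ k, Measurable (phi k)
  orthonormal : ∀ z, Orthonormal ℂ (fun k => phi k z)

/-- A bounded symbol that is upper triangular in the frame `phi`, with diagonal `lam`. -/
structure IsTriangularSymbol {d : ℕ} (M : Torus → (Cd d →L[ℂ] Cd d)) (lam : Fin d → Torus → ℂ)
    (phi : Fin d → Torus → Cd d) : Prop extends IsFrame phi where
  bounded : BoundedSymbol M
  triangular : ∀ z k, ∃ mu : Fin d → ℂ,
    M z (phi k z) = lam k z • phi k z + ∑ l ∈ Finset.Iio k, mu l • phi l z

variable {d : ℕ} {phi : Fin d → Torus → Cd d} {lam : Fin d → Torus → ℂ}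
  {M : Torus → (Cd d →L[ℂ] Cd d)} {A : ℤ → Matrix (Fin d) (Fin d) ℂ}

lemma IsSchurSystem.isTriangularSymbol (h : IsSchurSystem A lam phi)
    (hA : Summable fun n => ‖A n‖) : IsTriangularSymbol (symbol A) lam phi :=
  ⟨⟨h.measurable_phi, h.orthonormal⟩, boundedSymbol_symbol hA, h.triangular⟩

/-- There are as many orthonormal vectors as dimensions, so they form a basis. Nearly all pointwise
identities below are reduced to frame vectors by this. -/
lemma clm_ext_orthonormal {e : Fin d → Cd d} (he : Orthonormal ℂ e) {S T : Cd d →L[ℂ] Cd d}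
    (h : ∀ k, S (e k) = T (e k)) : S = T := by
  have hli := he.linearIndependent
  let b := basisOfLinearIndependentOfCardEqFinrank' e hli (by simp)
  have hb : ∀ k, b k = e k := fun k => by simp [b]
  apply ContinuousLinearMap.coe_injective
  exact b.ext fun k => by rw [hb]; exact h k

/-! ### Diagonal operators in the frame. -/

section Pointwise

lemma deltaP_apply_self (hphi : IsFrame phi) (k : Fin d) (z : Torus) :
    deltaP phi k z (phi k z) = phi k z := by
  simp [deltaP, (hphi.orthonormal z).1 k]

lemma deltaP_apply_of_ne (hphi : IsFrame phi) {k j : Fin d} (hkj : k ≠ j) (z : Torus) :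
    deltaP phi k z (phi j z) = 0 := by
  simp [deltaP, (hphi.orthonormal z).2 hkj]

lemma sum_smul_deltaP_apply (hphi : IsFrame phi) (s : Finset (Fin d)) (c : Fin d → ℂ) (j : Fin d)
    (z : Torus) : (∑ k ∈ s, c k • deltaP phi k z) (phi j z) =
      if j ∈ s then c j • phi j z else 0 := by
  rw [sum_apply]
  split_ifs with h
  · rw [Finset.sum_eq_single_of_mem j h, smul_apply, deltaP_apply_self hphi]
    intro k _ hk
    rw [smul_apply, deltaP_apply_of_ne hphi hk, smul_zero]
  · refine Finset.sum_eq_zero fun k hk => ?_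
    rw [smul_apply, deltaP_apply_of_ne hphi (by rintro rfl; exact h hk), smul_zero]

lemma diagSymbol_apply (hphi : IsFrame phi) (g : Fin d → Torus → ℂ) (j : Fin d) (z : Torus) :
    diagSymbol g phi z (phi j z) = g j z • phi j z := by
  rw [diagSymbol, sum_smul_deltaP_apply hphi, if_pos (Finset.mem_univ j)]

lemma projBelow_apply (hphi : IsFrame phi) (k j : Fin d) (z : Torus) :
    projBelow phi k z (phi j z) = if j < k then phi j z else 0 := by
  have h := sum_smul_deltaP_apply hphi (Finset.Iio k) (fun _ => 1) j z
  simpa [projBelow] using h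

lemma diagSymbol_mul (hphi : IsFrame phi) (g h : Fin d → Torus → ℂ) (z : Torus) :
    diagSymbol g phi z * diagSymbol h phi z = diagSymbol (fun k z => g k z * h k z) phi z := by
  refine clm_ext_orthonormal (hphi.orthonormal z) fun k => ?_
  rw [mul_apply_eq_comp, diagSymbol_apply hphi, map_smul, diagSymbol_apply hphi,
    diagSymbol_apply hphi, smul_smul, mul_comm]

lemma diagSymbol_one (hphi : IsFrame phi) (z : Torus) :
    diagSymbol (fun _ _ => 1) phi z = 1 := by
  refine clm_ext_orthonormal (hphi.orthonormal z) fun k => ?_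
  rw [diagSymbol_apply hphi, one_smul]; rfl

/-- Carries measurability from the frame vectors to their projections. In finite dimension norm
continuity may be tested on each vector. -/
lemma continuous_rankOne_self :
    Continuous fun v : Cd d => (InnerProductSpace.rankOne ℂ v v : Cd d →L[ℂ] Cd d) := by
  rw [continuous_clm_apply (𝕜 := ℂ)]
  intro y
  simp only [InnerProductSpace.rankOne_apply]
  fun_prop

lemma boundedSymbol_deltaP (hphi : IsFrame phi) (k : Fin d) : BoundedSymbol (deltaP phi k) := by
  constructor
  · exact continuous_rankOne_self.comp_stronglyMeasurable (hphi.meas k).stronglyMeasurable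
  · refine ⟨1, fun z => ?_⟩
    simp [deltaP, (hphi.orthonormal z).1 k]

lemma boundedSymbol_diagSymbol (hphi : IsFrame phi) {g : Fin d → Torus → ℂ}
    (hg : ∀ k, Measurable (g k)) (hb : ∀ k, ∃ C : ℝ, ∀ z, ‖g k z‖ ≤ C) :
    BoundedSymbol (diagSymbol g phi) :=
  BoundedSymbol.sum _ fun k => (boundedSymbol_deltaP hphi k).smul (hg k) (hb k)

lemma isSelfAdjoint_diagSymbol {g : Fin d → Torus → ℂ} {z : Torus}
    (hg : ∀ k, IsSelfAdjoint (g k z)) : IsSelfAdjoint (diagSymbol g phi z) := by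
  rw [ContinuousLinearMap.isSelfAdjoint_iff_isSymmetric]
  intro x y
  simp only [diagSymbol, ContinuousLinearMap.coe_coe, sum_apply, sum_inner, inner_sum]
  refine Finset.sum_congr rfl fun k _ => ?_
  have hk : (starRingEnd ℂ) (g k z) = g k z := hg k
  simp only [smul_apply, deltaP, InnerProductSpace.rankOne_apply, inner_smul_left,
    inner_smul_right, hk, inner_conj_symm]
  ring

end Pointwise

/-! ### Diagonal and strictly upper part of a triangular symbol. -/

namespace IsTriangularSymbol

/-- Pairing the triangular relation with $\varphi_k$ kills the lower vectors. Measurability and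
boundedness of the eigenvalue functions, which are not assumed, follow from this formula. -/
lemma lam_eq (h : IsTriangularSymbol M lam phi) (k : Fin d) (z : Torus) :
    lam k z = inner ℂ (phi k z) (M z (phi k z)) := by
  obtain ⟨mu, hmu⟩ := h.triangular z k
  have ho := h.orthonormal z
  rw [hmu, inner_add_right, inner_smul_right, inner_self_eq_norm_sq_to_K, ho.1 k, inner_sum,
    Finset.sum_eq_zero]
  · simp
  · intro l hl
    rw [inner_smul_right, ho.2 (Finset.mem_Iio.1 hl).ne', mul_zero]

lemma measurable_lam (h : IsTriangularSymbol M lam phi) (k : Fin d) : Measurable (lam k) := by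
  have hs : StronglyMeasurable (fun z => inner ℂ (phi k z) (M z (phi k z))) := by
    have h1 := (h.meas k).stronglyMeasurable
    have h2 : StronglyMeasurable (fun z => M z (phi k z)) :=
      (continuous_fst.clm_apply continuous_snd).comp_stronglyMeasurable
        (h.bounded.meas.prodMk h1)
    exact h1.inner h2
  exact (funext fun z => h.lam_eq k z) ▸ hs.measurable

lemma bound_lam (h : IsTriangularSymbol M lam phi) (k : Fin d) : ∃ C : ℝ, ∀ z, ‖lam k z‖ ≤ C := by
  obtain ⟨C, hC⟩ := h.bounded.bound
  refine ⟨C, fun z => ?_⟩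
  rw [h.lam_eq]
  refine (norm_inner_le_norm _ _).trans ?_
  refine (mul_le_mul_of_nonneg_left ((M z).le_opNorm _) (norm_nonneg _)).trans ?_
  rw [(h.orthonormal z).1 k, mul_one, one_mul]
  exact hC z

lemma boundedSymbol_diag (h : IsTriangularSymbol M lam phi) :
    BoundedSymbol (diagSymbol lam phi) :=
  boundedSymbol_diagSymbol h.toIsFrame h.measurable_lam h.bound_lam

lemma diag (h : IsTriangularSymbol M lam phi) :
    IsTriangularSymbol (diagSymbol lam phi) lam phi :=
  ⟨h.toIsFrame, h.boundedSymbol_diag, fun z k => ⟨0, by simp [diagSymbol_apply h.toIsFrame]⟩⟩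

lemma sub_diag_apply (h : IsTriangularSymbol M lam phi) (z : Torus) (k : Fin d) :
    ∃ mu : Fin d → ℂ,
      (M z - diagSymbol lam phi z) (phi k z) = ∑ l ∈ Finset.Iio k, mu l • phi l z := by
  obtain ⟨mu, hmu⟩ := h.triangular z k
  refine ⟨mu, ?_⟩
  rw [sub_apply, hmu, diagSymbol_apply h.toIsFrame, add_sub_cancel_left]

end IsTriangularSymbol

/-- On $\varphi_k$ only the $k$-th summand acts; there the projection onto the preceding vectors
removes the term $\lambda_k\varphi_k$ and fixes the others. -/
lemma upperSymbol_eq (h : IsTriangularSymbol (symbol A) lam phi) (z : Torus) :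
    upperSymbol A phi z = symbol A z - diagSymbol lam phi z := by
  refine clm_ext_orthonormal (h.orthonormal z) fun k => ?_
  obtain ⟨mu, hmu⟩ := h.triangular z k
  rw [sub_apply, diagSymbol_apply h.toIsFrame, upperSymbol, sum_apply,
    Finset.sum_eq_single_of_mem k (Finset.mem_univ k)]
  · rw [ContinuousLinearMap.comp_apply, ContinuousLinearMap.comp_apply,
      deltaP_apply_self h.toIsFrame, hmu, map_add, map_smul, projBelow_apply h.toIsFrame,
      if_neg (lt_irrefl k), smul_zero, zero_add, add_sub_cancel_left, map_sum]
    refine Finset.sum_congr rfl fun l hl => ?_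
    rw [map_smul, projBelow_apply h.toIsFrame, if_pos (Finset.mem_Iio.1 hl)]
  · intro j _ hj
    rw [ContinuousLinearMap.comp_apply, ContinuousLinearMap.comp_apply,
      deltaP_apply_of_ne h.toIsFrame hj, map_zero, map_zero]

/-- A strictly upper triangular operator is nilpotent. -/
lemma pow_eq_zero_of_strictly_triangular {e : Fin d → Cd d} (he : Orthonormal ℂ e)
    {L : Cd d →L[ℂ] Cd d} (hL : ∀ k, ∃ mu : Fin d → ℂ, L (e k) = ∑ l ∈ Finset.Iio k, mu l • e l) :
    L ^ d = 0 := by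
  -- Each application of $L$ strictly lowers the largest index that occurs.
  have key : ∀ (j : ℕ) (k : Fin d), (k : ℕ) < j → (L ^ j) (e k) = 0 := by
    intro j
    induction j with
    | zero => intro k hk; exact absurd hk (Nat.not_lt_zero _)
    | succ j ih =>
      intro k hk
      obtain ⟨mu, hmu⟩ := hL k
      rw [pow_succ, mul_apply_eq_comp, hmu, map_sum]
      refine Finset.sum_eq_zero fun l hl => ?_
      have hl' : l < k := Finset.mem_Iio.1 hl
      rw [Fin.lt_def] at hl'
      rw [map_smul, ih l (by omega), smul_zero]
  exact clm_ext_orthonormal he fun k => by rw [key d k k.2]; rfl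

/-! ### Projections onto coordinate subspaces of the frame -/

/-- The projection that cuts off the `l`-th coordinate in the frame `phi` outside of the set
`s l`. -/
noncomputable def frameProjSymbol (phi : Fin d → Torus → Cd d) (s : Fin d → Set Torus) :
    Torus → (Cd d →L[ℂ] Cd d) :=
  diagSymbol (fun l => (s l).indicator 1) phi

/-- The operator on `ℓ₂` with the symbol `frameProjSymbol phi s`. -/
noncomputable def frameProj (phi : Fin d → Torus → Cd d) (s : Fin d → Set Torus) :
    l2Z d →L[ℂ] l2Z d :=
  convOfSymbol (frameProjSymbol phi s)

open Classical in
lemma frameProjSymbol_apply (hphi : IsFrame phi) (s : Fin d → Set Torus) (k : Fin d) (z : Torus) :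
    frameProjSymbol phi s z (phi k z) = if z ∈ s k then phi k z else 0 := by
  rw [frameProjSymbol, diagSymbol_apply hphi, Set.indicator_apply]
  split_ifs <;> simp

lemma boundedSymbol_frameProjSymbol (hphi : IsFrame phi) {s : Fin d → Set Torus}
    (hs : ∀ l, MeasurableSet (s l)) : BoundedSymbol (frameProjSymbol phi s) := by
  refine boundedSymbol_diagSymbol hphi (fun k => measurable_one.indicator (hs k))
    fun k => ⟨1, fun z => ?_⟩
  by_cases hz : z ∈ s k <;> simp [hz]

lemma frameProjSymbol_mul (hphi : IsFrame phi) (s t : Fin d → Set Torus) (z : Torus) :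
    frameProjSymbol phi s z * frameProjSymbol phi t z =
      frameProjSymbol phi (fun l => s l ∩ t l) z := by
  refine clm_ext_orthonormal (hphi.orthonormal z) fun k => ?_
  rw [mul_apply_eq_comp, frameProjSymbol_apply hphi t, frameProjSymbol_apply hphi]
  by_cases ht : z ∈ t k <;> by_cases hs : z ∈ s k <;>
    simp [hs, ht, frameProjSymbol_apply hphi]

lemma frameProj_mul (hphi : IsFrame phi) {s t : Fin d → Set Torus}
    (hs : ∀ l, MeasurableSet (s l)) (ht : ∀ l, MeasurableSet (t l)) :
    frameProj phi s * frameProj phi t = frameProj phi (fun l => s l ∩ t l) := by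
  rw [frameProj, frameProj, ← convOfSymbol_mul (boundedSymbol_frameProjSymbol hphi hs)
    (boundedSymbol_frameProjSymbol hphi ht), frameProj]
  simp only [frameProjSymbol_mul hphi]

lemma frameProj_univ (hphi : IsFrame phi) : frameProj phi (fun _ => Set.univ) = 1 := by
  rw [← convOfSymbol_one, frameProj, frameProjSymbol]
  congr 1
  funext z
  rw [← diagSymbol_one hphi]
  simp only [Set.indicator_univ]; rfl

lemma frameProj_empty (hphi : IsFrame phi) : frameProj phi (fun _ => ∅) = 0 := by
  rw [← convOfSymbol_zero, frameProj]
  congr 1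
  funext z
  refine clm_ext_orthonormal (hphi.orthonormal z) fun k => ?_
  simp [frameProjSymbol_apply hphi]

lemma frameProj_compl (hphi : IsFrame phi) {s : Fin d → Set Torus}
    (hs : ∀ l, MeasurableSet (s l)) :
    1 - frameProj phi s = frameProj phi (fun l => (s l)ᶜ) := by
  rw [← convOfSymbol_one, frameProj, ← convOfSymbol_sub (.const 1)
    (boundedSymbol_frameProjSymbol hphi hs), frameProj]
  congr 1
  funext z
  refine clm_ext_orthonormal (hphi.orthonormal z) fun k => ?_
  rw [sub_apply, frameProjSymbol_apply hphi, frameProjSymbol_apply hphi]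
  by_cases hz : z ∈ s k <;> simp [hz]

lemma isSelfAdjoint_frameProj (hphi : IsFrame phi) {s : Fin d → Set Torus}
    (hs : ∀ l, MeasurableSet (s l)) : IsSelfAdjoint (frameProj phi s) := by
  refine convOfSymbol_isSelfAdjoint (boundedSymbol_frameProjSymbol hphi hs) fun z => ?_
  refine isSelfAdjoint_diagSymbol fun k => ?_
  by_cases hz : z ∈ s k <;> simp [hz]

end BlockConv

namespace BlockConv

variable {d : ℕ} {phi : Fin d → Torus → Cd d} {lam : Fin d → Torus → ℂ}
  {M N : Torus → (Cd d →L[ℂ] Cd d)} {A : ℤ → Matrix (Fin d) (Fin d) ℂ}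

/-! ### The argument on the circle -/

lemma measurable_argT : Measurable argT :=
  measurable_subtype_coe.comp (AddCircle.measurableEquivIco (2 * Real.pi) 0).measurable

lemma argT_coe {t : ℝ} (ht : t ∈ Set.Ico 0 (2 * Real.pi)) : argT (t : Torus) = t := by
  have h : t ∈ Set.Ico 0 (0 + 2 * Real.pi) := by simpa using ht
  rw [argT]
  exact AddCircle.equivIco_coe_of_mem h

lemma tau_isOpen_pos {U : Set Torus} (hU : IsOpen U) (hne : U.Nonempty) : 0 < tau U := by
  have : tau.IsOpenPosMeasure := by
    unfold tau AddCircle.haarAddCircle; infer_instance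
  exact hU.measure_pos tau hne

lemma tau_argT_Ioo_pos {a b : ℝ} (ha : 0 ≤ a) (hab : a < b) (hb : b ≤ 2 * Real.pi) :
    0 < tau {z | argT z ∈ Set.Ioo a b} := by
  have h1 : IsOpen ((fun t : ℝ => (t : Torus)) '' Set.Ioo a b) :=
    QuotientAddGroup.isOpenMap_coe _ isOpen_Ioo
  refine (tau_isOpen_pos h1 ((Set.nonempty_Ioo.2 hab).image _)).trans_le (measure_mono ?_)
  rintro _ ⟨t, ht, rfl⟩
  rw [Set.mem_ofPred_eq, argT_coe ⟨ha.trans ht.1.le, ht.2.trans_le hb⟩]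
  exact ht

lemma tau_singleton (z : Torus) : tau {z} = 0 := by
  have h : volume ({z} : Set Torus) = 0 := by
    have h := AddCircle.volume_closedBall (2 * Real.pi) (x := z) 0
    rwa [Metric.closedBall_zero, mul_zero, min_eq_right Real.two_pi_pos.le,
      ENNReal.ofReal_zero] at h
  rw [AddCircle.volume_eq_smul_haarAddCircle, Measure.smul_apply, smul_eq_mul, mul_eq_zero] at h
  exact h.resolve_left (by simp [Real.pi_pos])

/-! ### The symbol is determined by the operator -/

/-- The constant functions with the standard basis vectors as values lie in $L_2$, and testing on
these finitely many functions already determines the matrix almost everywhere. -/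
lemma ae_eq_of_convOfSymbol_eq (hM : BoundedSymbol M) (hN : BoundedSymbol N)
    (h : convOfSymbol M = convOfSymbol N) : M =ᵐ[tau] N := by
  have h1 : ∀ u, multOp M u = multOp N u := by
    intro u
    apply (fourierOp d).injective
    rw [← convOfSymbol_fourierOp, h, convOfSymbol_fourierOp]
  have h2 : ∀ i : Fin d, ∀ᵐ z ∂tau,
      M z (EuclideanSpace.single i 1) = N z (EuclideanSpace.single i 1) := by
    intro i
    have hc : MemLp (fun _ : Torus => (EuclideanSpace.single i (1 : ℂ) : Cd d)) 2 tau :=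
      memLp_const _
    have h3 := multOp_apply hN.memLp hc.toLp
    rw [← h1] at h3
    filter_upwards [h3, multOp_apply hM.memLp hc.toLp, hc.coeFn_toLp] with z h4 h5 h6
    rw [← h6, ← h4, ← h5]
  filter_upwards [ae_all_iff.2 h2] with z hz
  refine clm_ext_orthonormal (EuclideanSpace.basisFun (Fin d) ℂ).orthonormal fun k => ?_
  simpa using hz k

/-! ### The family of spectral projections along the curves -/

/-- The part of the circle on which the `l`-th curve, run through in the parameter interval
`[2πl, 2π(l+1))`, has parameter smaller than `r`. -/
def below (r : ℝ) (l : Fin d) : Set Torus := {z | argT z + 2 * Real.pi * l < r}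

/-- The chain, parametrized by a real number. -/
noncomputable def chainFamily (phi : Fin d → Torus → Cd d) (r : ℝ) : l2Z d →L[ℂ] l2Z d :=
  frameProj phi (below r)

lemma measurableSet_below (r : ℝ) (l : Fin d) : MeasurableSet (below r l) :=
  measurableSet_lt (measurable_argT.add_const _) measurable_const

/-- The position of a curve point on the concatenation of the curves. -/
noncomputable def CurvePt.pos (ν : CurvePt d) : ℝ := 2 * Real.pi * (ν.1 : ℕ) + ν.2

lemma two_pi_mul_succ_le {m n : ℕ} (h : m < n) :
    2 * Real.pi * m + 2 * Real.pi ≤ 2 * Real.pi * n := by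
  have h1 : (m : ℝ) + 1 ≤ n := by exact_mod_cast h
  nlinarith [Real.pi_pos]

/-- The argument lies in $[0,2\pi)$, so different curves occupy disjoint parameter intervals;
comparing positions is then the same as the order of curve points. -/
lemma mem_below_pos (ν : CurvePt d) (l : Fin d) (z : Torus) :
    z ∈ below ν.pos l ↔ l < ν.1 ∨ l = ν.1 ∧ argT z < ν.2 := by
  have h1 := argT_mem z
  have h2 := ν.2.2
  rw [below, Set.mem_ofPred_eq, CurvePt.pos]
  rcases lt_trichotomy l ν.1 with h | h | h
  · have := two_pi_mul_succ_le (Fin.lt_def.1 h)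
    exact iff_of_true (by linarith [h1.2, h2.1]) (Or.inl h)
  · simp only [h, lt_irrefl, false_or, true_and]
    constructor <;> intro <;> linarith
  · have := two_pi_mul_succ_le (Fin.lt_def.1 h)
    refine iff_of_false (by linarith [h1.1, h2.2]) ?_
    rintro (h3 | ⟨h3, -⟩)
    · exact lt_asymm h h3
    · exact h.ne' h3

lemma chainSymbol_eq (hphi : IsFrame phi) (ν : CurvePt d) :
    chainSymbol phi ν = frameProjSymbol phi (below ν.pos) := by
  classical
  funext z
  refine clm_ext_orthonormal (hphi.orthonormal z) fun k => ?_
  have hmem := mem_below_pos ν k z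
  have h0 : chainSymbol phi ν z (phi k z) = projBelow phi ν.1 z (phi k z) +
      (if argT z < (ν.2 : ℝ) then (1 : ℂ) else 0) • deltaP phi ν.1 z (phi k z) := by
    unfold chainSymbol
    congr 2
  rw [frameProjSymbol_apply hphi, h0, projBelow_apply hphi]
  by_cases hk : k = ν.1
  · subst hk
    rw [deltaP_apply_self hphi]
    by_cases ht : argT z < ν.2 <;> simp [hmem, ht]
  · rw [deltaP_apply_of_ne hphi (Ne.symm hk)]
    by_cases hlt : k < ν.1 <;> simp [hmem, hk, hlt]

lemma chainProj_eq (hphi : IsFrame phi) (ν : CurvePt d) :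
    chainProj phi ν = chainFamily phi ν.pos := by
  rw [chainProj, chainSymbol_eq hphi]; rfl

lemma chainFamily_mul (hphi : IsFrame phi) (r s : ℝ) :
    chainFamily phi r * chainFamily phi s = chainFamily phi (min r s) := by
  rw [chainFamily, chainFamily, frameProj_mul hphi (measurableSet_below r) (measurableSet_below s)]
  congr 1
  funext l
  ext z
  simp [below]

lemma chainFamily_of_nonpos (hphi : IsFrame phi) {r : ℝ} (hr : r ≤ 0) : chainFamily phi r = 0 := by
  rw [← frameProj_empty hphi, chainFamily]
  congr 1
  funext l
  ext z
  have := (argT_mem z).1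
  have : 0 ≤ 2 * Real.pi * l := by positivity
  simp only [below, Set.mem_ofPred_eq, Set.mem_empty_iff_false, iff_false, not_lt]
  linarith

lemma chainFamily_of_le (hphi : IsFrame phi) {r : ℝ} (hr : 2 * Real.pi * d ≤ r) :
    chainFamily phi r = 1 := by
  rw [← frameProj_univ hphi, chainFamily]
  congr 1
  funext l
  ext z
  have := (argT_mem z).2
  have := two_pi_mul_succ_le l.2
  simp only [below, Set.mem_ofPred_eq, Set.mem_univ, iff_true]
  linarith

lemma projLE_chainFamily (hphi : IsFrame phi) {r s : ℝ} (h : r ≤ s) :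
    ProjLE (chainFamily phi r) (chainFamily phi s) := by
  rw [ProjLE, chainFamily_mul hphi, chainFamily_mul hphi, min_eq_left h, min_eq_right h]
  exact ⟨rfl, rfl⟩

/-- The curve number is $\lfloor r/2\pi\rfloor$. At a multiple of $2\pi$ this picks the initial
point of the next curve and not the end point of the previous one, which has the same position. -/
lemma exists_curvePt {r : ℝ} (h0 : 0 ≤ r) (h1 : r < 2 * Real.pi * d) :
    ∃ ν : CurvePt d, (ν.2 : ℝ) < 2 * Real.pi ∧ ν.pos = r := by
  have hpi := Real.two_pi_pos
  have hk0 : 0 ≤ r / (2 * Real.pi) := by positivity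
  have hfl := Nat.floor_le hk0
  have hlt := Nat.lt_floor_add_one (r / (2 * Real.pi))
  rw [le_div_iff₀ hpi] at hfl
  rw [div_lt_iff₀ hpi] at hlt
  have hk : ⌊r / (2 * Real.pi)⌋₊ < d := by
    rw [Nat.floor_lt hk0, div_lt_iff₀ hpi]; linarith
  refine ⟨(⟨_, hk⟩, ⟨r - 2 * Real.pi * ⌊r / (2 * Real.pi)⌋₊, by linarith, by linarith⟩), ?_, ?_⟩
  · simp only; linarith
  · simp [CurvePt.pos]

lemma CurvePt.pos_mem (ν : CurvePt d) : ν.pos ∈ Set.Icc 0 (2 * Real.pi * d) := by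
  have h1 := two_pi_mul_succ_le ν.1.2
  have h2 := ν.2.2
  have h3 : 0 ≤ 2 * Real.pi * (ν.1 : ℕ) := by positivity
  rw [CurvePt.pos]
  exact ⟨by linarith [h2.1], by linarith [h2.2]⟩

lemma chainFamily_mem (hd : 0 < d) (hphi : IsFrame phi) (r : ℝ) :
    chainFamily phi r ∈ chainOf phi := by
  have hpi := Real.two_pi_pos
  rcases lt_or_ge r 0 with h0 | h0
  · refine ⟨(⟨0, hd⟩, ⟨0, Set.left_mem_Icc.2 hpi.le⟩), ?_⟩
    rw [chainProj_eq hphi, chainFamily_of_nonpos hphi h0.le, chainFamily_of_nonpos hphi]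
    simp [CurvePt.pos]
  · rcases lt_or_ge r (2 * Real.pi * d) with h1 | h1
    · obtain ⟨ν, -, hν⟩ := exists_curvePt h0 h1
      exact ⟨ν, by rw [chainProj_eq hphi, hν]⟩
    · refine ⟨(⟨d - 1, Nat.sub_lt hd one_pos⟩, ⟨2 * Real.pi, Set.right_mem_Icc.2 hpi.le⟩), ?_⟩
      rw [chainProj_eq hphi, chainFamily_of_le hphi h1, chainFamily_of_le hphi]
      simp only [CurvePt.pos]
      have h2 : ((d - 1 : ℕ) : ℝ) + 1 = d := by exact_mod_cast Nat.sub_add_cancel hd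
      rw [← h2]
      linarith

lemma exists_of_mem_chainOf (hphi : IsFrame phi) {P : l2Z d →L[ℂ] l2Z d} (hP : P ∈ chainOf phi) :
    ∃ r ∈ Set.Icc 0 (2 * Real.pi * d), chainFamily phi r = P := by
  obtain ⟨ν, rfl⟩ := hP
  exact ⟨ν.pos, ν.pos_mem, (chainProj_eq hphi ν).symm⟩

/-- If $r$ lies on the $k$-th curve, there is an arc of positive measure just after $r$, on that
curve and before $s$, where $E(s)$ keeps $\varphi_k$ and $E(r)$ kills it. -/
lemma chainFamily_ne (hphi : IsFrame phi) {r s : ℝ} (h0 : 0 ≤ r) (hrs : r < s)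
    (hs : s ≤ 2 * Real.pi * d) : chainFamily phi r ≠ chainFamily phi s := by
  intro h
  obtain ⟨ν, hν, rfl⟩ := exists_curvePt h0 (hrs.trans_le hs)
  have hae := ae_eq_of_convOfSymbol_eq (boundedSymbol_frameProjSymbol hphi (measurableSet_below _))
    (boundedSymbol_frameProjSymbol hphi (measurableSet_below _)) h
  have hν2 := ν.2.2.1
  have hb : (ν.2 : ℝ) < min (2 * Real.pi) (s - 2 * Real.pi * (ν.1 : ℕ)) := by
    refine lt_min hν ?_
    rw [CurvePt.pos] at hrs
    linarith
  have hpos := tau_argT_Ioo_pos hν2 hb (min_le_left _ _)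
  refine hpos.ne' (measure_mono_null ?_ (ae_iff.1 hae))
  intro z hz heq
  have h1 := congrArg (fun T => T (phi ν.1 z)) heq
  have hz2 := lt_min_iff.1 hz.2
  rw [frameProjSymbol_apply hphi, frameProjSymbol_apply hphi, if_neg, if_pos] at h1
  · exact (hphi.orthonormal z).ne_zero ν.1 h1.symm
  · rw [below, Set.mem_ofPred_eq]; linarith [hz2.2]
  · rw [below, Set.mem_ofPred_eq, CurvePt.pos]; linarith [hz.1]

/-! ### Maximality of the chain -/

lemma norm_frameProjSymbol_apply_le (hphi : IsFrame phi) (s : Fin d → Set Torus) (z : Torus)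
    (v : Cd d) : ‖frameProjSymbol phi s z v‖ ≤ ‖v‖ := by
  have hsa : IsSelfAdjoint (frameProjSymbol phi s z) :=
    isSelfAdjoint_diagSymbol fun k => by by_cases hz : z ∈ s k <;> simp [hz]
  have hsq : frameProjSymbol phi s z (frameProjSymbol phi s z v) = frameProjSymbol phi s z v := by
    rw [← mul_apply_eq_comp, frameProjSymbol_mul hphi]
    simp only [Set.inter_self]
  have h1 : ‖frameProjSymbol phi s z v‖ ^ 2 ≤ ‖frameProjSymbol phi s z v‖ * ‖v‖ := by
    have h2 := (ContinuousLinearMap.isSelfAdjoint_iff_isSymmetric.1 hsa)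
      (frameProjSymbol phi s z v) v
    simp only [ContinuousLinearMap.coe_coe] at h2
    rw [hsq] at h2
    have h3 := norm_inner_le_norm (𝕜 := ℂ) (frameProjSymbol phi s z v) v
    rw [h2, inner_self_eq_norm_sq_to_K] at h3
    simpa using h3
  by_contra! hlt
  nlinarith [norm_nonneg v]

/-- By dominated convergence in $L_2$: as $r\to r_0$ the cut-off at $z$ changes in the limit only if
$\arg z=r_0-2\pi l$ for some $l$, and these $z$ form a finite set, hence a null set. -/
lemma continuous_chainFamily_apply (hphi : IsFrame phi) (v : l2Z d) :
    Continuous fun r => chainFamily phi r v := by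
  obtain ⟨u, rfl⟩ := (fourierOp d).surjective v
  simp only [chainFamily, frameProj, convOfSymbol_fourierOp]
  refine (fourierOp d).continuous.comp ?_
  rw [continuous_iff_continuousAt]
  intro r₀
  rw [ContinuousAt, tendsto_iff_norm_sub_tendsto_zero]
  set m : ℝ → L2T d := fun r => multOp (frameProjSymbol phi (below r)) u with hm
  have hb : ∀ r, BoundedSymbol (frameProjSymbol phi (below r)) :=
    fun r => boundedSymbol_frameProjSymbol hphi (measurableSet_below r)
  have hdiff : ∀ r, ‖m r - m r₀‖ ^ 2 = ∫ z, ‖frameProjSymbol phi (below r) z (u z) -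
      frameProjSymbol phi (below r₀) z (u z)‖ ^ 2 ∂tau := by
    intro r
    rw [norm_sq_eq_integral]
    refine integral_congr_ae ?_
    filter_upwards [Lp.coeFn_sub (m r) (m r₀), multOp_apply (hb r).memLp u,
      multOp_apply (hb r₀).memLp u] with z h1 h2 h3
    rw [h1, Pi.sub_apply, h2, h3]
  have hlim : Filter.Tendsto (fun r => ‖m r - m r₀‖ ^ 2) (nhds r₀) (nhds 0) := by
    simp only [hdiff]
    have h0 : (0 : ℝ) = ∫ _ : Torus, (0 : ℝ) ∂tau := by simp
    rw [h0]
    -- Both cut-offs are contractions, so the difference has norm at most $2\|u(z)\|$.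
    refine tendsto_integral_filter_of_dominated_convergence (fun z => 4 * ‖u z‖ ^ 2) ?_ ?_ ?_ ?_
    · refine .of_forall fun r => ?_
      have h1 : ∀ r, AEStronglyMeasurable (fun z => frameProjSymbol phi (below r) z (u z)) tau :=
        fun r => (Lp.aestronglyMeasurable (m r)).congr (multOp_apply (hb r).memLp u)
      exact ((h1 r).sub (h1 r₀)).norm.pow 2
    · refine .of_forall fun r => .of_forall fun z => ?_
      have h1 := norm_frameProjSymbol_apply_le hphi (below r) z (u z)
      have h2 := norm_frameProjSymbol_apply_le hphi (below r₀) z (u z)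
      have h3 := norm_sub_le (frameProjSymbol phi (below r) z (u z))
        (frameProjSymbol phi (below r₀) z (u z))
      rw [Real.norm_of_nonneg (by positivity)]
      calc _ ≤ (2 * ‖u z‖) ^ 2 := by gcongr; linarith
        _ = _ := by ring
    · exact ((Lp.memLp u).integrable_norm_pow (by norm_num)).const_mul 4
    · have hex : ∀ᵐ z ∂tau, ∀ l : Fin d, z ≠ ((r₀ - 2 * Real.pi * l : ℝ) : Torus) := by
        rw [ae_all_iff]
        intro l
        rw [ae_iff]
        simpa using tau_singleton (((r₀ - 2 * Real.pi * l : ℝ)) : Torus)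
      filter_upwards [hex] with z hz
      refine tendsto_const_nhds.congr' ?_
      -- Off the exceptional points the cut-off is locally constant in $r$ near $r_0$.
      have hev : ∀ᶠ r in nhds r₀, ∀ l : Fin d, z ∈ below r l ↔ z ∈ below r₀ l := by
        rw [Filter.eventually_all]
        intro l
        have hne : argT z + 2 * Real.pi * l ≠ r₀ := by
          intro he
          refine hz l ?_
          rw [← he, add_sub_cancel_right, coe_argT]
        rcases hne.lt_or_gt with hlt | hgt
        · filter_upwards [eventually_gt_nhds hlt] with r hr
          exact iff_of_true hr hlt
        · filter_upwards [eventually_lt_nhds hgt] with r hr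
          exact iff_of_false (not_lt.2 (le_of_lt hr)) (not_lt.2 hgt.le)
      filter_upwards [hev] with r hr
      have : frameProjSymbol phi (below r) z = frameProjSymbol phi (below r₀) z := by
        classical
        refine clm_ext_orthonormal (hphi.orthonormal z) fun k => ?_
        rw [frameProjSymbol_apply hphi, frameProjSymbol_apply hphi]
        simp only [hr]
      rw [this, sub_self, norm_zero]
      norm_num
  have h5 := hlim.sqrt
  simpa only [Real.sqrt_sq (norm_nonneg _), Real.sqrt_zero] using h5

lemma isProjChain_chainOf (hd : 0 < d) (hphi : IsFrame phi) : IsProjChain (chainOf phi) where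
  idem P hP := by
    obtain ⟨r, -, rfl⟩ := exists_of_mem_chainOf hphi hP
    rw [chainFamily_mul hphi, min_self]
  zero_mem := chainFamily_of_nonpos hphi le_rfl ▸ chainFamily_mem hd hphi 0
  one_mem := chainFamily_of_le hphi le_rfl ▸ chainFamily_mem hd hphi _
  total P hP Q hQ := by
    obtain ⟨r, -, rfl⟩ := exists_of_mem_chainOf hphi hP
    obtain ⟨s, -, rfl⟩ := exists_of_mem_chainOf hphi hQ
    exact (le_total r s).imp (projLE_chainFamily hphi) (projLE_chainFamily hphi)

/-- A connectedness argument. For $Q$ in a larger chain, strong continuity makes both comparison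
sets closed, the total order makes them cover the line, and $E=O$ at 0 and $E=I$ at $2\pi d$ make
them nonempty. At a common point $Q=E(r)$. -/
lemma isMaximalProjChain_chainOf (hd : 0 < d) (hphi : IsFrame phi) :
    IsMaximalProjChain (chainOf phi) := by
  refine ⟨isProjChain_chainOf hd hphi, fun C' hC' hsub => (hsub.antisymm ?_).symm⟩
  intro Q hQ
  have hclosed : ∀ f g : (l2Z d →L[ℂ] l2Z d) → (l2Z d →L[ℂ] l2Z d),
      (∀ v, Continuous fun r => f (chainFamily phi r) v) →
      (∀ v, Continuous fun r => g (chainFamily phi r) v) →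
      IsClosed {r | f (chainFamily phi r) = g (chainFamily phi r)} := by
    intro f g hf hg
    have : {r | f (chainFamily phi r) = g (chainFamily phi r)} =
        ⋂ v, {r | f (chainFamily phi r) v = g (chainFamily phi r) v} := by
      ext r; simp [ContinuousLinearMap.ext_iff]
    rw [this]
    exact isClosed_iInter fun v => isClosed_eq (hf v) (hg v)
  have hE := continuous_chainFamily_apply hphi
  have hEQ : ∀ v, Continuous fun r => (chainFamily phi r * Q) v := fun v => hE (Q v)
  have hQE : ∀ v, Continuous fun r => (Q * chainFamily phi r) v :=
    fun v => Q.continuous.comp (hE v)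
  have h1 : IsClosed {r | ProjLE (chainFamily phi r) Q} :=
    (hclosed (· * Q) id hEQ hE).inter (hclosed (Q * ·) id hQE hE)
  have h2 : IsClosed {r | ProjLE Q (chainFamily phi r)} :=
    (hclosed (Q * ·) (fun _ => Q) hQE fun _ => continuous_const).inter
      (hclosed (· * Q) (fun _ => Q) hEQ fun _ => continuous_const)
  have hcov : Set.univ ⊆ {r | ProjLE (chainFamily phi r) Q} ∪ {r | ProjLE Q (chainFamily phi r)} :=
    fun r _ => hC'.total _ (hsub (chainFamily_mem hd hphi r)) _ hQ
  obtain ⟨r, -, hr1, hr2⟩ := isPreconnected_closed_iff.1 isPreconnected_univ _ _ h1 h2 hcov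
    ⟨0, trivial, by simp [ProjLE, chainFamily_of_nonpos hphi le_rfl]⟩
    ⟨2 * Real.pi * d, trivial, by simp [ProjLE, chainFamily_of_le hphi le_rfl]⟩
  rw [show Q = chainFamily phi r from hr2.1.symm.trans hr1.2]
  exact chainFamily_mem hd hphi r

end BlockConv

namespace BlockConv

variable {d : ℕ} {phi : Fin d → Torus → Cd d} {lam : Fin d → Torus → ℂ}
  {M T : Torus → (Cd d →L[ℂ] Cd d)} {A : ℤ → Matrix (Fin d) (Fin d) ℂ}

/-! ### Invariance of the chain -/

lemma below_antitone {r : ℝ} {l k : Fin d} (h : l ≤ k) : below r k ⊆ below r l := by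
  intro z hz
  rw [below, Set.mem_ofPred_eq] at hz ⊢
  have h1 : ((l : ℕ) : ℝ) ≤ (k : ℕ) := by exact_mod_cast h
  have := mul_le_mul_of_nonneg_left h1 Real.two_pi_pos.le
  linarith

lemma frameProjSymbol_below_sum (hphi : IsFrame phi) {r : ℝ} {k : Fin d} {z : Torus}
    (hz : ∀ l < k, z ∈ below r l) (mu : Fin d → ℂ) :
    frameProjSymbol phi (below r) z (∑ l ∈ Finset.Iio k, mu l • phi l z) =
      ∑ l ∈ Finset.Iio k, mu l • phi l z := by
  classical
  rw [map_sum]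
  refine Finset.sum_congr rfl fun l hl => ?_
  rw [map_smul, frameProjSymbol_apply hphi, if_pos (hz l (Finset.mem_Iio.1 hl))]

lemma IsTriangularSymbol.upper (h : IsTriangularSymbol M lam phi) :
    IsTriangularSymbol (fun z => M z - diagSymbol lam phi z) 0 phi := by
  refine ⟨h.toIsFrame, h.bounded.sub h.boundedSymbol_diag, fun z k => ?_⟩
  simpa using h.sub_diag_apply z k

lemma boundedSymbol_below (hphi : IsFrame phi) (r : ℝ) :
    BoundedSymbol (frameProjSymbol phi (below r)) :=
  boundedSymbol_frameProjSymbol hphi (measurableSet_below r)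

/-- If the cut-off keeps $\varphi_k$, it keeps every $\varphi_l$ with $l<k$ (`below_antitone`), so
its range at $z$ belongs to the flag that $M(z)$ leaves invariant. -/
lemma IsTriangularSymbol.isInvariantChain (h : IsTriangularSymbol M lam phi) :
    IsInvariantChain (chainOf phi) (convOfSymbol M) := by
  classical
  intro P hP
  obtain ⟨r, -, rfl⟩ := exists_of_mem_chainOf h.toIsFrame hP
  have hE := boundedSymbol_below h.toIsFrame r
  rw [chainFamily, frameProj, ← convOfSymbol_mul hE h.bounded,
    ← convOfSymbol_mul (hE.mul h.bounded) hE, ← convOfSymbol_mul h.bounded hE]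
  congr 1
  funext z
  refine clm_ext_orthonormal (h.orthonormal z) fun k => ?_
  simp only [mul_apply_eq_comp]
  rw [frameProjSymbol_apply h.toIsFrame]
  split_ifs with hz
  · obtain ⟨mu, hmu⟩ := h.triangular z k
    rw [hmu, map_add, map_smul, frameProjSymbol_apply h.toIsFrame, if_pos hz,
      frameProjSymbol_below_sum h.toIsFrame fun l hl => below_antitone hl.le hz]
  · simp

lemma IsTriangularSymbol.isReducingChain_diag (h : IsTriangularSymbol M lam phi) :
    IsReducingChain (chainOf phi) (convOfSymbol (diagSymbol lam phi)) := by
  intro P hP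
  obtain ⟨r, -, rfl⟩ := exists_of_mem_chainOf h.toIsFrame hP
  have hE := boundedSymbol_below h.toIsFrame r
  rw [chainFamily, frameProj, ← convOfSymbol_mul hE h.boundedSymbol_diag,
    ← convOfSymbol_mul h.boundedSymbol_diag hE]
  congr 1
  funext z
  rw [frameProjSymbol, diagSymbol_mul h.toIsFrame, diagSymbol_mul h.toIsFrame]
  simp only [mul_comm]

/-! ### Triangular integrals -/

/-! ### Increments of the chain along one curve. -/

section Increment

variable {k : ℕ} {r s : ℝ}

open Classical in
-- For $r,s$ in the $k$-th parameter interval, vectors of smaller index are kept by both cut-offs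
-- and vectors of larger index by neither. Only $\varphi_k$ is left. The number $k$ is a natural
-- number, so that $k=d$ is allowed and gives a zero increment.
lemma frameProjSymbol_sub_apply (hphi : IsFrame phi) (hr : 2 * Real.pi * k ≤ r) (hrs : r ≤ s)
    (hs : s ≤ 2 * Real.pi * k + 2 * Real.pi) (j : Fin d) (z : Torus) :
    (frameProjSymbol phi (below s) z - frameProjSymbol phi (below r) z) (phi j z) =
      if (j : ℕ) = k ∧ z ∉ below r j ∧ z ∈ below s j then phi j z else 0 := by
  have hz := argT_mem z
  rw [sub_apply, frameProjSymbol_apply hphi, frameProjSymbol_apply hphi]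
  rcases lt_trichotomy (j : ℕ) k with hj | hj | hj
  · have := two_pi_mul_succ_le hj
    have h1 : z ∈ below r j := by rw [below, Set.mem_ofPred_eq]; linarith [hz.2]
    have h2 : z ∈ below s j := lt_of_lt_of_le h1 hrs
    simp [h1, h2]
  · by_cases h1 : z ∈ below r j
    · have h2 : z ∈ below s j := lt_of_lt_of_le h1 hrs
      simp [h1, h2]
    · simp [h1, hj]
  · have := two_pi_mul_succ_le hj
    have h2 : z ∉ below s j := by rw [below, Set.mem_ofPred_eq]; linarith [hz.1]
    have h1 : z ∉ below r j := fun h => h2 (lt_of_lt_of_le h hrs)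
    simp [h1, h2]

lemma mem_below_of_lt (hr : 2 * Real.pi * k ≤ r) {l : Fin d} (hl : (l : ℕ) < k) (z : Torus) :
    z ∈ below r l := by
  have := two_pi_mul_succ_le hl
  rw [below, Set.mem_ofPred_eq]
  linarith [(argT_mem z).2]

lemma chainFamily_sub (hphi : IsFrame phi) (r s : ℝ) :
    chainFamily phi s - chainFamily phi r =
      convOfSymbol (fun z => frameProjSymbol phi (below s) z - frameProjSymbol phi (below r) z) :=
  (convOfSymbol_sub (boundedSymbol_below hphi s) (boundedSymbol_below hphi r)).symm

/-- The increment sees one frame vector at each point, and compressing a triangular matrix to one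
frame vector leaves its diagonal entry. -/
lemma IsTriangularSymbol.increment_mul_increment (h : IsTriangularSymbol M lam phi)
    (hr : 2 * Real.pi * k ≤ r) (hrs : r ≤ s) (hs : s ≤ 2 * Real.pi * k + 2 * Real.pi) :
    (chainFamily phi s - chainFamily phi r) * convOfSymbol M *
      (chainFamily phi s - chainFamily phi r) =
    convOfSymbol (diagSymbol lam phi) * (chainFamily phi s - chainFamily phi r) := by
  classical
  have hE := (boundedSymbol_below h.toIsFrame s).sub (boundedSymbol_below h.toIsFrame r)
  rw [chainFamily_sub h.toIsFrame, ← convOfSymbol_mul hE h.bounded,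
    ← convOfSymbol_mul (hE.mul h.bounded) hE, ← convOfSymbol_mul h.boundedSymbol_diag hE]
  congr 1
  funext z
  refine clm_ext_orthonormal (h.orthonormal z) fun j => ?_
  simp only [mul_apply_eq_comp]
  rw [frameProjSymbol_sub_apply h.toIsFrame hr hrs hs]
  split_ifs with hj
  · obtain ⟨mu, hmu⟩ := h.triangular z j
    rw [hmu, map_add, map_smul, frameProjSymbol_sub_apply h.toIsFrame hr hrs hs, if_pos hj,
      diagSymbol_apply h.toIsFrame, map_sum, Finset.sum_eq_zero, add_zero]
    intro l hl
    have hlj : l < j := Finset.mem_Iio.1 hl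
    rw [map_smul, frameProjSymbol_sub_apply h.toIsFrame hr hrs hs, if_neg, smul_zero]
    rintro ⟨hlk, -⟩
    rw [Fin.lt_def] at hlj
    omega
  · simp

/-- Where the increment is nonzero, $E(r)$ kills $\varphi_k$ and keeps all preceding vectors, so it
removes exactly the diagonal term of $M\varphi_k$. -/
lemma IsTriangularSymbol.mul_increment (h : IsTriangularSymbol M lam phi)
    (hr : 2 * Real.pi * k ≤ r) (hrs : r ≤ s) (hs : s ≤ 2 * Real.pi * k + 2 * Real.pi) :
    chainFamily phi r * convOfSymbol M * (chainFamily phi s - chainFamily phi r) =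
    convOfSymbol (fun z => M z - diagSymbol lam phi z) *
      (chainFamily phi s - chainFamily phi r) := by
  classical
  have hE := (boundedSymbol_below h.toIsFrame s).sub (boundedSymbol_below h.toIsFrame r)
  have hR := boundedSymbol_below h.toIsFrame r
  rw [chainFamily_sub h.toIsFrame, chainFamily, frameProj, ← convOfSymbol_mul hR h.bounded,
    ← convOfSymbol_mul (hR.mul h.bounded) hE, ← convOfSymbol_mul h.upper.bounded hE]
  congr 1
  funext z
  refine clm_ext_orthonormal (h.orthonormal z) fun j => ?_
  simp only [mul_apply_eq_comp]
  rw [frameProjSymbol_sub_apply h.toIsFrame hr hrs hs]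
  split_ifs with hj
  · obtain ⟨mu, hmu⟩ := h.triangular z j
    rw [sub_apply, hmu, map_add, map_smul, frameProjSymbol_apply h.toIsFrame, if_neg hj.2.1,
      diagSymbol_apply h.toIsFrame, smul_zero, zero_add, add_sub_cancel_left,
      frameProjSymbol_below_sum h.toIsFrame]
    intro l hl
    rw [Fin.lt_def, hj.1] at hl
    exact mem_below_of_lt hr hl z
  · simp

end Increment

/-- The partition of the chain by the end points of the curves. -/
noncomputable def endPartition (hd : 0 < d) (hphi : IsFrame phi) :
    ChainPartition (chainOf phi) where
  n := d
  proj k := chainFamily phi (2 * Real.pi * k)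
  mem _ _ := chainFamily_mem hd hphi _
  first := chainFamily_of_nonpos hphi (by simp)
  last := chainFamily_of_le hphi le_rfl
  mono k _ := projLE_chainFamily hphi (by push_cast; linarith [Real.pi_pos])

/-- The increments of a refinement of `endPartition` live on a single curve. -/
lemma exists_increment (hd : 0 < d) (hphi : IsFrame phi) (π : ChainPartition (chainOf phi))
    (hπ : π.Refines (endPartition hd hphi)) {i : ℕ} (hi : i < π.n) :
    ∃ (k : ℕ) (r s : ℝ), 2 * Real.pi * k ≤ r ∧ r ≤ s ∧ s ≤ 2 * Real.pi * k + 2 * Real.pi ∧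
      π.proj i = chainFamily phi r ∧ π.proj (i + 1) = chainFamily phi s := by
  -- Injectivity of the parametrization recovers the order of the parameters from the order of the
  -- projections.
  have hinj : ∀ r ∈ Set.Icc 0 (2 * Real.pi * d), ∀ s ∈ Set.Icc 0 (2 * Real.pi * d),
      ProjLE (chainFamily phi r) (chainFamily phi s) → r ≤ s := by
    intro r hr s hs hle
    by_contra! hlt
    refine chainFamily_ne hphi hs.1 hlt hr.2 ?_
    rw [← hle.1, chainFamily_mul hphi, min_eq_right hlt.le]
  choose! ρ hρ hρ' using fun i (hi : i ≤ π.n) => exists_of_mem_chainOf hphi (π.mem i hi)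
  have hstep : ∀ j < π.n, ρ j ≤ ρ (j + 1) := by
    intro j hj
    refine hinj _ (hρ j hj.le) _ (hρ (j + 1) hj) ?_
    rw [hρ' j hj.le, hρ' (j + 1) hj]
    exact π.mono j hj
  have hmono : ∀ a b, a ≤ b → b ≤ π.n → ρ a ≤ ρ b := by
    intro a b hab
    induction b, hab using Nat.le_induction with
    | base => intro; exact le_rfl
    | succ b _ ih => intro hb; exact (ih (by omega)).trans (hstep b (by omega))
  have hnode : ∀ k : ℕ, k ≤ d → ∃ j ≤ π.n, ρ j = 2 * Real.pi * k := by
    intro k hk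
    obtain ⟨j, hj, hjk⟩ := hπ k hk
    have hmem : 2 * Real.pi * (k : ℝ) ∈ Set.Icc 0 (2 * Real.pi * d) := by
      have : (k : ℝ) ≤ d := by exact_mod_cast hk
      exact ⟨by positivity, mul_le_mul_of_nonneg_left this Real.two_pi_pos.le⟩
    have heq : chainFamily phi (ρ j) = chainFamily phi (2 * Real.pi * k) := (hρ' j hj).trans hjk
    refine ⟨j, hj, le_antisymm (hinj _ (hρ j hj) _ hmem ?_) (hinj _ hmem _ (hρ j hj) ?_)⟩
    · rw [heq]; exact projLE_chainFamily hphi le_rfl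
    · rw [heq]; exact projLE_chainFamily hphi le_rfl
  rcases (hρ i hi.le).2.lt_or_eq with hlt | heq
  · obtain ⟨ν, hν, hpos⟩ := exists_curvePt (hρ i hi.le).1 hlt
    refine ⟨ν.1, ρ i, ρ (i + 1), ?_, hstep i hi, ?_, (hρ' i hi.le).symm, (hρ' (i + 1) hi).symm⟩
    · rw [← hpos, CurvePt.pos]; linarith [ν.2.2.1]
    · obtain ⟨j, hj, hjk⟩ := hnode ((ν.1 : ℕ) + 1) ν.1.2
      push_cast at hjk
      rw [mul_add, mul_one] at hjk
      rw [← hjk]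
      refine hmono _ _ ?_ hj
      by_contra! hji
      have h1 := hmono j i (by omega) hi.le
      rw [hjk, ← hpos, CurvePt.pos] at h1
      linarith
  -- The partition has already reached $I$; the fictitious curve number $d$ serves for the remaining
  -- zero increments.
  · refine ⟨d, ρ i, ρ (i + 1), heq.ge, hstep i hi, ?_, (hρ' i hi.le).symm, (hρ' (i + 1) hi).symm⟩
    linarith [(hρ (i + 1) hi).2, Real.pi_pos]

lemma sum_increments {C : Set (l2Z d →L[ℂ] l2Z d)} (π : ChainPartition C) :
    ∑ i ∈ Finset.range π.n, (π.proj (i + 1) - π.proj i) = 1 := by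
  rw [Finset.sum_range_sub, π.first, π.last, sub_zero]

/-- The net is eventually constant: from `endPartition` on, every term is $\mathbf A_0$ times an
increment, and the increments add up to $I$. -/
lemma IsTriangularSymbol.isDiagIntegral (hd : 0 < d) (h : IsTriangularSymbol M lam phi) :
    IsDiagIntegral (chainOf phi) (convOfSymbol M) (convOfSymbol (diagSymbol lam phi)) := by
  intro ε hε
  refine ⟨endPartition hd h.toIsFrame, fun π hπ => ?_⟩
  suffices π.diagSum (convOfSymbol M) = convOfSymbol (diagSymbol lam phi) by
    rwa [this, sub_self, norm_zero]
  rw [← mul_one (convOfSymbol (diagSymbol lam phi)), ← sum_increments π, Finset.mul_sum]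
  refine Finset.sum_congr rfl fun i hi => ?_
  obtain ⟨k, r, s, h1, h2, h3, h4, h5⟩ :=
    exists_increment hd h.toIsFrame π hπ (Finset.mem_range.1 hi)
  rw [h4, h5, h.increment_mul_increment h1 h2 h3]

lemma IsTriangularSymbol.isUpperIntegral (hd : 0 < d) (h : IsTriangularSymbol M lam phi) :
    IsUpperIntegral (chainOf phi) (convOfSymbol M)
      (convOfSymbol (fun z => M z - diagSymbol lam phi z)) := by
  intro ε hε
  refine ⟨endPartition hd h.toIsFrame, fun π hπ => ?_⟩
  suffices π.upperSum (convOfSymbol M) = convOfSymbol (fun z => M z - diagSymbol lam phi z) by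
    rwa [this, sub_self, norm_zero]
  rw [← mul_one (convOfSymbol (fun z => M z - diagSymbol lam phi z)), ← sum_increments π,
    Finset.mul_sum]
  refine Finset.sum_congr rfl fun i hi => ?_
  obtain ⟨k, r, s, h1, h2, h3, h4, h5⟩ :=
    exists_increment hd h.toIsFrame π hπ (Finset.mem_range.1 hi)
  rw [h4, h5, h.mul_increment h1 h2 h3]

lemma IsTriangularSymbol.upper_pow_eq_zero (h : IsTriangularSymbol M lam phi) :
    convOfSymbol (fun z => M z - diagSymbol lam phi z) ^ d = 0 := by
  rw [← convOfSymbol_pow h.upper.bounded, ← convOfSymbol_zero]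
  congr 1
  funext z
  exact pow_eq_zero_of_strictly_triangular (h.orthonormal z) (h.sub_diag_apply z)

end BlockConv

namespace BlockConv

/-! ### Spectra of parts of operators -/

section Part

variable {X : Type*} [NormedAddCommGroup X] [NormedSpace ℂ X]

lemma apply_range_of_idem {P : X →L[ℂ] X} (hP : P * P = P) (x : P.range) : P x = x := by
  obtain ⟨_, y, rfl⟩ := x
  exact congrArg (fun T : X →L[ℂ] X => T y) hP

/-- Replaces an inverse on the range of $P$ by an operator $C=PCP$ on the whole space, so that
resolvents of parts can be handled in the algebra of all operators. -/
lemma notMem_spectrumOn_iff {P : X →L[ℂ] X} (hP : P * P = P) (B : X →L[ℂ] X) (w : ℂ) :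
    w ∉ spectrumOn P B ↔ ∃ C : X →L[ℂ] X, P * C = C ∧ C * P = C ∧
      C * (B - w • 1) * P = P ∧ P * (B - w • 1) * C = P := by
  have happ : ∀ {S T : X →L[ℂ] X}, S = T → ∀ x, S x = T x := fun h x => by rw [h]
  have hPP : ∀ x, P (P x) = P x := happ hP
  have halg : ∀ x : P.range, ((algebraMap ℂ (P.range →L[ℂ] P.range) w - partOn P B) x : X) =
      w • (x : X) - P (B x) := fun x => by
    rw [Algebra.algebraMap_eq_smul_one]; rfl
  rw [spectrumOn, spectrum.notMem_iff]
  constructor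
  · rintro ⟨u, hu⟩
    let V : P.range →L[ℂ] P.range := ↑u⁻¹
    let Q : X →L[ℂ] P.range := P.codRestrict P.range fun x => ⟨x, rfl⟩
    have hVu : ∀ x : P.range, V ((algebraMap ℂ _ w - partOn P B) x) = x := fun x => by
      have h := u.inv_mul
      rw [hu] at h
      exact congrArg (fun T : P.range →L[ℂ] P.range => T x) h
    have huV : ∀ x : P.range, (algebraMap ℂ _ w - partOn P B) (V x) = x := fun x => by
      have h := u.mul_inv
      rw [hu] at h
      exact congrArg (fun T : P.range →L[ℂ] P.range => T x) h
    -- The sign appears because the spectrum is defined by $w-PB$, while $C$ inverts $B-w$.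
    refine ⟨-(P.range.subtypeL ∘L V ∘L Q), ?_, ?_, ?_, ?_⟩
    · ext x
      change P (-(V (Q x) : X)) = -(V (Q x) : X)
      rw [map_neg, apply_range_of_idem hP]
    · ext x
      change -(V (Q (P x)) : X) = -(V (Q x) : X)
      rw [show Q (P x) = Q x from Subtype.ext (hPP x)]
    · ext x
      change -(V (Q (B (P x) - w • P x)) : X) = P x
      have h1 : Q (B (P x) - w • P x) = -((algebraMap ℂ _ w - partOn P B) (Q x)) := by
        apply Subtype.ext
        rw [Submodule.coe_neg, halg]
        change P (B (P x) - w • P x) = -(w • P x - P (B (P x)))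
        rw [map_sub, map_smul, hPP]
        abel
      rw [h1, map_neg, hVu, Submodule.coe_neg, neg_neg]
      rfl
    · ext x
      change P (B (-(V (Q x) : X)) - w • (-(V (Q x) : X))) = P x
      have h1 := congrArg (Subtype.val) (huV (Q x))
      rw [halg] at h1
      rw [map_neg, smul_neg, map_sub, map_neg, map_neg, map_smul, apply_range_of_idem hP]
      rw [sub_neg_eq_add, neg_add_eq_sub, h1]
      rfl
  · rintro ⟨C, hPC, hCP, h1, h2⟩
    let V : P.range →L[ℂ] P.range :=
      (-(C ∘L P.range.subtypeL)).codRestrict P.range fun x =>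
        ⟨-C x, by
          change P (-C x) = -C x
          rw [map_neg]; exact congrArg Neg.neg (happ hPC x)⟩
    have hV : ∀ x : P.range, (V x : X) = -C x := fun _ => rfl
    refine ⟨⟨_, V, ?_, ?_⟩, rfl⟩
    · ext x
      change (((algebraMap ℂ _ w - partOn P B) (V x) : P.range) : X) = x
      have h3 : P (B (C x) - w • C x) = x := (happ h2 x).trans (apply_range_of_idem hP x)
      have h4 : P (C x) = C x := happ hPC x
      rw [halg, hV, map_neg, map_neg, smul_neg, sub_neg_eq_add, neg_add_eq_sub]
      rwa [map_sub, map_smul, h4] at h3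
    · ext x
      change (V ((algebraMap ℂ _ w - partOn P B) x) : X) = x
      have hx := apply_range_of_idem hP x
      have h3 : C (B (P x) - w • P x) = P x := happ h1 x
      have h5 : C (P (B x)) = C (B x) := happ hCP _
      rw [hV, halg, map_sub, h5]
      rw [hx, map_sub] at h3
      rw [neg_sub, h3]

end Part

/-! ### Inverses of triangular operators -/

variable {d : ℕ} {phi : Fin d → Torus → Cd d} {lam : Fin d → Torus → ℂ}
  {M X Y : Torus → (Cd d →L[ℂ] Cd d)}

lemma convOfSymbol_diagSymbol_mul (hphi : IsFrame phi) {f g h : Fin d → Torus → ℂ}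
    (hf : BoundedSymbol (diagSymbol f phi)) (hg : BoundedSymbol (diagSymbol g phi))
    (hfg : ∀ l z, f l z * g l z = h l z) :
    convOfSymbol (diagSymbol f phi) * convOfSymbol (diagSymbol g phi) =
      convOfSymbol (diagSymbol h phi) := by
  rw [← convOfSymbol_mul hf hg]
  congr 1
  funext z
  rw [diagSymbol_mul hphi]
  simp only [hfg]

lemma IsTriangularSymbol.convOfSymbol_sub_smul_one (h : IsTriangularSymbol M lam phi) (w : ℂ) :
    convOfSymbol M - w • 1 = convOfSymbol (diagSymbol (fun l z => lam l z - w) phi) +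
      convOfSymbol (fun z => M z - diagSymbol lam phi z) := by
  have hb : BoundedSymbol (diagSymbol (fun l z => lam l z - w) phi) := by
    refine boundedSymbol_diagSymbol h.toIsFrame (fun k => (h.measurable_lam k).sub_const w)
      fun k => ?_
    obtain ⟨C, hC⟩ := h.bound_lam k
    exact ⟨C + ‖w‖, fun z => (norm_sub_le _ _).trans (add_le_add_left (hC z) _)⟩
  rw [← convOfSymbol_const_smul_one, ← convOfSymbol_sub h.bounded (.const _),
    ← convOfSymbol_add hb h.upper.bounded]
  congr 1
  funext z
  refine clm_ext_orthonormal (h.orthonormal z) fun k => ?_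
  rw [sub_apply, add_apply, sub_apply, diagSymbol_apply h.toIsFrame, diagSymbol_apply h.toIsFrame,
    sub_smul]
  change _ - w • phi k z = _
  abel

/-- Let $R$ be the coordinate projection, $a$ and $U$ the diagonal and strictly upper part of $M-w$,
and $D$ the bounded inverse of $a$ on the range of $R$. Then $R(a+U)R=aR(1+N)$ with $N=DUR$. Since
$D$ and $R$ are diagonal, $N$ is strictly triangular, hence nilpotent, and $(1+N)^{-1}D$ is the
inverse. Invariance of the range of $R$ plays no role. -/
lemma IsTriangularSymbol.exists_corner_inverse (h : IsTriangularSymbol M lam phi)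
    {s : Fin d → Set Torus} (hs : ∀ l, MeasurableSet (s l)) {w : ℂ} {δ : ℝ} (hδ : 0 < δ)
    (hw : ∀ l, ∀ z ∈ s l, δ ≤ ‖lam l z - w‖) :
    ∃ C : l2Z d →L[ℂ] l2Z d, frameProj phi s * C = C ∧ C * frameProj phi s = C ∧
      C * (convOfSymbol M - w • 1) * frameProj phi s = frameProj phi s ∧
      frameProj phi s * (convOfSymbol M - w • 1) * C = frameProj phi s := by
  classical
  have hphi := h.toIsFrame
  set g : Fin d → Torus → ℂ := fun l => (s l).indicator fun z => (lam l z - w)⁻¹ with hg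
  have hDb : BoundedSymbol (diagSymbol g phi) := by
    refine boundedSymbol_diagSymbol hphi
      (fun k => (((h.measurable_lam k).sub_const w).inv).indicator (hs k)) fun k => ⟨δ⁻¹, fun z => ?_⟩
    by_cases hz : z ∈ s k
    · simp only [hg, Set.indicator_of_mem hz, norm_inv]
      exact inv_anti₀ hδ (hw k z hz)
    · simp only [hg, Set.indicator_of_notMem hz, norm_zero]
      positivity
  have hRb := boundedSymbol_frameProjSymbol hphi hs
  have hab : BoundedSymbol (diagSymbol (fun l z => lam l z - w) phi) := by
    refine boundedSymbol_diagSymbol hphi (fun k => (h.measurable_lam k).sub_const w) fun k => ?_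
    obtain ⟨C, hC⟩ := h.bound_lam k
    exact ⟨C + ‖w‖, fun z => (norm_sub_le _ _).trans (add_le_add_left (hC z) _)⟩
  have hUb := h.upper.bounded
  set D := convOfSymbol (diagSymbol g phi) with hD
  set R := frameProj phi s with hR
  set a := convOfSymbol (diagSymbol (fun l z => lam l z - w) phi) with ha
  set U := convOfSymbol (fun z => M z - diagSymbol lam phi z) with hU
  have hRR : R * R = R := by rw [hR, frameProj_mul hphi hs hs]; simp only [Set.inter_self]
  have hne : ∀ l, ∀ z ∈ s l, lam l z - w ≠ 0 := fun l z hz =>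
    norm_pos_iff.1 (hδ.trans_le (hw l z hz))
  have hRD : R * D = D := convOfSymbol_diagSymbol_mul hphi hRb hDb fun l z => by
    by_cases hz : z ∈ s l <;> simp [hg, hz]
  have hDR : D * R = D := convOfSymbol_diagSymbol_mul hphi hDb hRb fun l z => by
    by_cases hz : z ∈ s l <;> simp [hg, hz]
  have hDa : D * a = R := convOfSymbol_diagSymbol_mul hphi hDb hab fun l z => by
    by_cases hz : z ∈ s l
    · simp only [hg, Set.indicator_of_mem hz, inv_mul_cancel₀ (hne l z hz), Pi.one_apply]
    · simp [hg, hz]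
  have haD : a * D = R := convOfSymbol_diagSymbol_mul hphi hab hDb fun l z => by
    by_cases hz : z ∈ s l
    · simp only [hg, Set.indicator_of_mem hz, mul_inv_cancel₀ (hne l z hz), Pi.one_apply]
    · simp [hg, hz]
  have hRa : R * a = a * R :=
    (convOfSymbol_diagSymbol_mul hphi hRb hab fun l z => mul_comm _ _).trans
      (convOfSymbol_diagSymbol_mul hphi hab hRb fun l z => rfl).symm
  set N := D * U * R with hN
  have hNd : N ^ d = 0 := by
    rw [hN, hD, hU, hR, frameProj, ← convOfSymbol_mul hDb hUb,
      ← convOfSymbol_mul (hDb.mul hUb) hRb, ← convOfSymbol_pow ((hDb.mul hUb).mul hRb),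
      ← convOfSymbol_zero]
    congr 1
    funext z
    refine pow_eq_zero_of_strictly_triangular (h.orthonormal z) fun k => ?_
    simp only [mul_apply_eq_comp]
    rw [frameProjSymbol_apply hphi]
    split_ifs with hz
    · obtain ⟨mu, hmu⟩ := h.sub_diag_apply z k
      refine ⟨fun l => mu l * g l z, ?_⟩
      rw [hmu, map_sum]
      refine Finset.sum_congr rfl fun l _ => ?_
      rw [map_smul, diagSymbol_apply hphi, smul_smul]
    · exact ⟨0, by simp⟩
  obtain ⟨u, hu⟩ := IsNilpotent.isUnit_one_add (⟨d, hNd⟩ : IsNilpotent N)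
  set V : l2Z d →L[ℂ] l2Z d := ↑u⁻¹ with hV
  have hV1 : V * (1 + N) = 1 := by rw [← hu]; exact u.inv_mul
  have hV2 : (1 + N) * V = 1 := by rw [← hu]; exact u.mul_inv
  have hRN : R * N = N := by rw [hN, ← mul_assoc, ← mul_assoc, hRD]
  have hNR : N * R = N := by rw [hN, mul_assoc, hRR]
  -- $R$ commutes with $1+N$, because $RN=N=NR$; hence it commutes with the inverse.
  have hRV : R * V = V * R := by
    calc R * V = V * (1 + N) * (R * V) := by rw [hV1, one_mul]
      _ = V * (R + N * R) * V := by noncomm_ring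
      _ = V * (R + R * N) * V := by rw [hNR, hRN]
      _ = V * R * ((1 + N) * V) := by noncomm_ring
      _ = V * R := by rw [hV2, mul_one]
  rw [h.convOfSymbol_sub_smul_one w]
  refine ⟨V * D, ?_, ?_, ?_, ?_⟩
  · rw [← mul_assoc, hRV, mul_assoc, hRD]
  · rw [mul_assoc, hDR]
  · calc V * D * (a + U) * R = V * (D * a * R + D * U * R) := by noncomm_ring
      _ = V * (1 + N) * R := by rw [hDa, hRR, ← hN, mul_assoc, add_mul, one_mul, hNR]
      _ = R := by rw [hV1, one_mul]
  · have h1 : R * U * R = a * N := by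
      rw [hN, ← mul_assoc, ← mul_assoc, haD]
    have h2 : R * a * R = a * R := by rw [hRa, mul_assoc, hRR]
    have h3 : a * N = a * R * N := by rw [mul_assoc, hRN]
    calc R * (a + U) * (V * D) = (R * a + R * U) * (V * (R * D)) := by rw [hRD]; noncomm_ring
      _ = (R * a + R * U) * (V * R * D) := by noncomm_ring
      _ = (R * a * R + R * U * R) * V * D := by rw [← hRV]; noncomm_ring
      _ = a * R * ((1 + N) * V) * D := by
        rw [h1, h2, h3]; noncomm_ring
      _ = R := by rw [hV2, mul_one, mul_assoc, hRD, haD]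

end BlockConv

namespace BlockConv

variable {d : ℕ} {phi : Fin d → Torus → Cd d} {lam : Fin d → Torus → ℂ}
  {M X Y : Torus → (Cd d →L[ℂ] Cd d)} {A : ℤ → Matrix (Fin d) (Fin d) ℂ}

/-! ### Lower bounds for multiplication operators -/

/-- Testing on $\chi_sv$ for all measurable $s$ localizes the inequality for a fixed $v$. A
countable dense set of vectors gives one common null set, and continuity in $v$ does the rest. -/
lemma ae_norm_le_of_multOp (hX : BoundedSymbol X) (hY : BoundedSymbol Y) {K : ℝ} (hK : 0 ≤ K)
    (h : ∀ u, ‖multOp X u‖ ≤ K * ‖multOp Y u‖) : ∀ᵐ z ∂tau, ∀ v, ‖X z v‖ ≤ K * ‖Y z v‖ := by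
  have hmeas : ∀ {Z : Torus → (Cd d →L[ℂ] Cd d)}, BoundedSymbol Z → ∀ v,
      Integrable (fun z => ‖Z z v‖ ^ 2) tau := by
    intro Z hZ v
    obtain ⟨C, hC⟩ := hZ.bound
    have hm : StronglyMeasurable (fun z => Z z v) := by
      have hc : Continuous fun T : Cd d →L[ℂ] Cd d => T v := by fun_prop
      exact hc.comp_stronglyMeasurable hZ.meas
    refine Integrable.of_bound (hm.norm.pow 2).aestronglyMeasurable ((C * ‖v‖) ^ 2)
      (.of_forall fun z => ?_)
    rw [Real.norm_of_nonneg (by positivity)]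
    gcongr
    exact (Z z).le_of_opNorm_le (hC z) v
  have hint : ∀ {Z : Torus → (Cd d →L[ℂ] Cd d)}, BoundedSymbol Z → ∀ v {s : Set Torus}
      (hs : MeasurableSet s), ‖multOp Z (indicatorConstLp 2 hs (measure_ne_top tau s) v)‖ ^ 2 =
        ∫ z in s, ‖Z z v‖ ^ 2 ∂tau := by
    intro Z hZ v s hs
    rw [norm_sq_eq_integral, ← integral_indicator hs]
    refine integral_congr_ae ?_
    filter_upwards [multOp_apply hZ.memLp (indicatorConstLp 2 hs (measure_ne_top tau s) v),
      indicatorConstLp_coeFn (p := 2) (hs := hs) (hμs := measure_ne_top tau s) (c := v)]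
      with z h1 h2
    rw [h1, h2]
    by_cases hz : z ∈ s <;> simp [hz]
  have hv : ∀ v, ∀ᵐ z ∂tau, ‖X z v‖ ≤ K * ‖Y z v‖ := by
    intro v
    have hle : (fun z => ‖X z v‖ ^ 2) ≤ᵐ[tau] fun z => K ^ 2 * ‖Y z v‖ ^ 2 := by
      refine ae_le_of_forall_setIntegral_le (hmeas hX v) ((hmeas hY v).const_mul _) ?_
      intro s hs _
      rw [integral_const_mul, ← hint hX v hs, ← hint hY v hs, ← mul_pow]
      gcongr
      exact h _
    filter_upwards [hle] with z hz
    rw [← mul_pow] at hz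
    exact (pow_le_pow_iff_left₀ (norm_nonneg _) (by positivity) two_ne_zero).1 hz
  have hdense := ae_all_iff.2 fun n => hv (TopologicalSpace.denseSeq (Cd d) n)
  filter_upwards [hdense] with z hz
  have hcl : IsClosed {v | ‖X z v‖ ≤ K * ‖Y z v‖} :=
    isClosed_le (by fun_prop) (by fun_prop)
  intro v
  have hsub : Set.range (TopologicalSpace.denseSeq (Cd d)) ⊆ {v | ‖X z v‖ ≤ K * ‖Y z v‖} := by
    rintro _ ⟨n, rfl⟩
    exact hz n
  exact hcl.closure_subset_iff.2 hsub (TopologicalSpace.denseRange_denseSeq (Cd d) v)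

/-- A compression of a triangular operator to a coordinate subspace has the diagonal entries as
eigenvalues. -/
lemma exists_eigenvector_compression {e : Fin d → Cd d} (he : Orthonormal ℂ e)
    {L P : Cd d →L[ℂ] Cd d} {c : Fin d → ℂ} {I : Set (Fin d)}
    (hL : ∀ k, ∃ mu : Fin d → ℂ, L (e k) = c k • e k + ∑ l ∈ Finset.Iio k, mu l • e l)
    (hP : ∀ k ∈ I, P (e k) = e k) (hP' : ∀ k ∉ I, P (e k) = 0) {l : Fin d} (hl : l ∈ I) :
    ∃ v, v ≠ 0 ∧ P v = v ∧ P (L v) = c l • v := by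
  -- On this space $PL-c_l$ takes values in $W\cap e_l^\perp$. It misses $e_l\in W$, so it is not
  -- surjective, and in finite dimension not injective; a kernel vector is the eigenvector.
  set W : Submodule ℂ (Cd d) := Submodule.span ℂ (e '' {j | j ∈ I ∧ j ≤ l}) with hW
  set f : Cd d →ₗ[ℂ] Cd d := ((P ∘L L - c l • 1 : Cd d →L[ℂ] Cd d) : Cd d →ₗ[ℂ] Cd d) with hf
  have hfe : ∀ j, f (e j) = P (L (e j)) - c l • e j := fun j => rfl
  have hPW : ∀ x ∈ W, P x = x := by
    intro x hx
    induction hx using Submodule.span_induction with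
    | mem x hx => obtain ⟨j, hj, rfl⟩ := hx; exact hP j hj.1
    | zero => exact map_zero _
    | add x y _ _ hx hy => rw [map_add, hx, hy]
    | smul a x _ hx => rw [map_smul, hx]
  have hsumW : ∀ (j : Fin d) (mu : Fin d → ℂ), j ≤ l →
      P (∑ i ∈ Finset.Iio j, mu i • e i) ∈ W ∧
        inner ℂ (e l) (P (∑ i ∈ Finset.Iio j, mu i • e i)) = 0 := by
    intro j mu hj
    rw [map_sum, inner_sum]
    have hmem : ∀ i ∈ Finset.Iio j, P (mu i • e i) ∈ W ∧ inner ℂ (e l) (P (mu i • e i)) = 0 := by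
      intro i hi
      have hil : i < l := (Finset.mem_Iio.1 hi).trans_le hj
      rw [map_smul]
      by_cases hiI : i ∈ I
      · rw [hP i hiI, inner_smul_right, he.2 hil.ne', mul_zero]
        exact ⟨W.smul_mem _ (Submodule.subset_span ⟨i, ⟨hiI, hil.le⟩, rfl⟩), rfl⟩
      · rw [hP' i hiI, smul_zero, inner_zero_right]
        exact ⟨W.zero_mem, rfl⟩
    exact ⟨W.sum_mem fun i hi => (hmem i hi).1, Finset.sum_eq_zero fun i hi => (hmem i hi).2⟩
  have hfW : ∀ x ∈ W, f x ∈ W ∧ inner ℂ (e l) (f x) = 0 := by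
    intro x hx
    induction hx using Submodule.span_induction with
    | mem x hx =>
      obtain ⟨j, hj, rfl⟩ := hx
      obtain ⟨mu, hmu⟩ := hL j
      obtain ⟨h1, h2⟩ := hsumW j mu hj.2
      have hej : e j ∈ W := Submodule.subset_span ⟨j, hj, rfl⟩
      rw [hfe, hmu, map_add, map_smul, hP j hj.1]
      refine ⟨W.sub_mem (W.add_mem (W.smul_mem _ hej) h1) (W.smul_mem _ hej), ?_⟩
      rw [inner_sub_right, inner_add_right, h2, inner_smul_right, inner_smul_right]
      rcases eq_or_ne j l with rfl | hne
      · ring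
      · rw [he.2 hne.symm]; ring
    | zero => rw [map_zero, inner_zero_right]; exact ⟨W.zero_mem, rfl⟩
    | add x y _ _ hx hy =>
      rw [map_add, inner_add_right, hx.2, hy.2, add_zero]
      exact ⟨W.add_mem hx.1 hy.1, rfl⟩
    | smul a x _ hx =>
      rw [map_smul, inner_smul_right, hx.2, mul_zero]
      exact ⟨W.smul_mem _ hx.1, rfl⟩
  let F : W →ₗ[ℂ] W := f.restrict fun x hx => (hfW x hx).1
  have hninj : ¬ Function.Injective F := by
    intro hinj
    obtain ⟨⟨x, hx⟩, hxe⟩ := (LinearMap.injective_iff_surjective.1 hinj)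
      ⟨e l, Submodule.subset_span ⟨l, ⟨hl, le_rfl⟩, rfl⟩⟩
    have h1 : f x = e l := congrArg Subtype.val hxe
    have h2 := (hfW x hx).2
    rw [h1, inner_self_eq_norm_sq_to_K, he.1 l] at h2
    norm_num at h2
  rw [← LinearMap.ker_eq_bot, Submodule.eq_bot_iff] at hninj
  push Not at hninj
  obtain ⟨⟨x, hx⟩, hxk, hx0⟩ := hninj
  refine ⟨x, fun h0 => hx0 (Subtype.ext h0), hPW x hx, ?_⟩
  have h1 : f x = 0 := congrArg Subtype.val hxk
  exact sub_eq_zero.1 h1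

/-- A left inverse $C$ bounds the compression of $\mathbf A-w$ from below, and this bound passes to
the matrices at almost every $z$. There it is applied to the eigenvector belonging to
$\lambda_l(z)-w$. -/
lemma IsTriangularSymbol.ae_one_le (h : IsTriangularSymbol M lam phi) {s : Fin d → Set Torus}
    (hs : ∀ l, MeasurableSet (s l)) {w : ℂ} {C : l2Z d →L[ℂ] l2Z d}
    (hCR : C * frameProj phi s = C)
    (hC : C * (convOfSymbol M - w • 1) * frameProj phi s = frameProj phi s) :
    ∀ᵐ z ∂tau, ∀ l, z ∈ s l → 1 ≤ ‖C‖ * ‖lam l z - w‖ := by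
  classical
  have hphi := h.toIsFrame
  have hRb := boundedSymbol_frameProjSymbol hphi hs
  have hMw := h.bounded.sub (BoundedSymbol.const (w • (1 : Cd d →L[ℂ] Cd d)))
  have hNb := (hRb.mul hMw).mul hRb
  have hN : convOfSymbol (fun z => frameProjSymbol phi s z * (M z - w • 1) *
      frameProjSymbol phi s z) =
      frameProj phi s * (convOfSymbol M - w • 1) * frameProj phi s := by
    rw [convOfSymbol_mul (hRb.mul hMw) hRb, convOfSymbol_mul hRb hMw,
      convOfSymbol_sub h.bounded (.const _), convOfSymbol_const_smul_one]
    rfl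
  have hle : ∀ u, ‖multOp (frameProjSymbol phi s) u‖ ≤ ‖C‖ *
      ‖multOp (fun z => frameProjSymbol phi s z * (M z - w • 1) * frameProjSymbol phi s z) u‖ := by
    intro u
    rw [← (fourierOp d).norm_map, ← convOfSymbol_fourierOp,
      ← (fourierOp d).norm_map (multOp _ u), ← convOfSymbol_fourierOp, hN]
    have h1 : frameProj phi s = C * (frameProj phi s * (convOfSymbol M - w • 1) *
        frameProj phi s) := by
      rw [← mul_assoc, ← mul_assoc, hCR, hC]
    have h2 : convOfSymbol (frameProjSymbol phi s) (fourierOp d u) =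
        C ((frameProj phi s * (convOfSymbol M - w • 1) * frameProj phi s) (fourierOp d u)) :=
      congrArg (fun T : l2Z d →L[ℂ] l2Z d => T (fourierOp d u)) h1
    rw [h2]
    exact C.le_opNorm _
  filter_upwards [ae_norm_le_of_multOp hRb hNb (norm_nonneg C) hle] with z hz l hl
  obtain ⟨v, hv0, hv1, hv2⟩ := exists_eigenvector_compression (h.orthonormal z)
    (P := frameProjSymbol phi s z) (I := {k | z ∈ s k}) (h.triangular z)
    (fun k hk => by rw [frameProjSymbol_apply hphi]; exact if_pos hk)
    (fun k hk => by rw [frameProjSymbol_apply hphi]; exact if_neg hk) hl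
  have h1 := hz v
  have h2 : (frameProjSymbol phi s z * (M z - w • 1) * frameProjSymbol phi s z) v =
      (lam l z - w) • v := by
    change frameProjSymbol phi s z (M z (frameProjSymbol phi s z v) -
      w • frameProjSymbol phi s z v) = _
    rw [hv1, map_sub, map_smul, hv1, hv2, sub_smul]
  rw [h2, hv1, norm_smul, ← mul_assoc] at h1
  exact le_of_mul_le_mul_right (by rwa [one_mul]) (norm_pos_iff.2 hv0)

/-- The set `s` of points of the circle contains with each point a right neighbourhood. -/
def IsRightOpen (s : Set Torus) : Prop :=
  ∀ z ∈ s, ∃ b > argT z, ∀ y, argT y ∈ Set.Ico (argT z) b → y ∈ s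

/-- The spectrum of the compression of a triangular operator to a coordinate subspace. -/
theorem IsTriangularSymbol.notMem_closure_iff (h : IsTriangularSymbol M lam phi)
    (hc : ∀ k, ContinuousOn (fun t : ℝ => lam k (t : Torus)) (Set.Ico 0 (2 * Real.pi)))
    {s : Fin d → Set Torus} (hs : ∀ l, MeasurableSet (s l)) (hr : ∀ l, IsRightOpen (s l)) (w : ℂ) :
    w ∉ closure {w | ∃ l, ∃ z ∈ s l, w = lam l z} ↔
      ∃ C : l2Z d →L[ℂ] l2Z d, frameProj phi s * C = C ∧ C * frameProj phi s = C ∧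
      C * (convOfSymbol M - w • 1) * frameProj phi s = frameProj phi s ∧
      frameProj phi s * (convOfSymbol M - w • 1) * C = frameProj phi s := by
  rw [Metric.mem_closure_iff]
  constructor
  · intro hw
    push Not at hw
    obtain ⟨δ, hδ, hw⟩ := hw
    refine h.exists_corner_inverse hs hδ fun l z hz => ?_
    rw [← dist_eq_norm, dist_comm]
    exact hw _ ⟨l, z, hz, rfl⟩
  · rintro ⟨C, -, hCR, hC, -⟩ hw
    have hae := h.ae_one_le hs hCR hC
    -- This radius makes $\|C\|\,|\lambda_l(z)-w|<1$ also when $C=0$. By continuity the inequality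
    -- persists on an arc to the right of $z$ inside $s_l$, which has positive measure and
    -- contradicts the almost everywhere bound.
    obtain ⟨_, ⟨l, z, hz, rfl⟩, hdist⟩ := hw (‖C‖ + 1)⁻¹ (by positivity)
    rw [dist_comm, dist_eq_norm] at hdist
    have hlt : ‖C‖ * ‖lam l z - w‖ < 1 := by
      have h0 : 0 < ‖C‖ + 1 := by positivity
      have h1 : (‖C‖ + 1) * ‖lam l z - w‖ < 1 := by
        rwa [← one_div, lt_div_iff₀ h0, mul_comm] at hdist
      nlinarith [norm_nonneg (lam l z - w)]
    have hcz := hc l (argT z) (argT_mem z)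
    have hev : ∀ᶠ t : ℝ in nhdsWithin (argT z) (Set.Ico 0 (2 * Real.pi)),
        ‖C‖ * ‖lam l (t : Torus) - w‖ < 1 := by
      have ht : Filter.Tendsto (fun t : ℝ => ‖C‖ * ‖lam l (t : Torus) - w‖)
          (nhdsWithin (argT z) (Set.Ico 0 (2 * Real.pi)))
          (nhds (‖C‖ * ‖lam l ((argT z : ℝ) : Torus) - w‖)) :=
        ((hcz.sub continuousWithinAt_const).norm).const_mul _
      rw [coe_argT] at ht
      exact ht.eventually_lt_const hlt
    obtain ⟨ε, hε, hball⟩ := Metric.mem_nhdsWithin_iff.1 hev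
    obtain ⟨b, hb, hbs⟩ := hr l z hz
    set b' := min (min b (argT z + ε)) (2 * Real.pi) with hb'
    have hlt' : argT z < b' := by
      rw [hb', lt_min_iff, lt_min_iff]
      exact ⟨⟨hb, by linarith⟩, (argT_mem z).2⟩
    have hpos := tau_argT_Ioo_pos (argT_mem z).1 hlt' (min_le_right _ _)
    refine hpos.ne' (measure_mono_null ?_ (ae_iff.1 hae))
    intro y hy hy'
    have hyb := lt_min_iff.1 (lt_min_iff.1 hy.2).1
    have h1 := hy' l (hbs y ⟨hy.1.le, hyb.1⟩)
    have h2 : ‖C‖ * ‖lam l ((argT y : ℝ) : Torus) - w‖ < 1 := by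
      refine hball ⟨?_, argT_mem y⟩
      rw [Metric.mem_ball, Real.dist_eq, abs_lt]
      constructor <;> linarith [hy.1, hyb.2]
    rw [coe_argT] at h2
    linarith

theorem IsTriangularSymbol.spectrumOn_frameProj (h : IsTriangularSymbol M lam phi)
    (hc : ∀ k, ContinuousOn (fun t : ℝ => lam k (t : Torus)) (Set.Ico 0 (2 * Real.pi)))
    {s : Fin d → Set Torus} (hs : ∀ l, MeasurableSet (s l)) (hr : ∀ l, IsRightOpen (s l)) :
    spectrumOn (frameProj phi s) (convOfSymbol M) =
      closure {w | ∃ l, ∃ z ∈ s l, w = lam l z} := by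
  have hP : frameProj phi s * frameProj phi s = frameProj phi s := by
    rw [frameProj_mul h.toIsFrame hs hs]; simp only [Set.inter_self]
  ext w
  rw [← not_iff_not, notMem_spectrumOn_iff hP, h.notMem_closure_iff hc hs hr]

theorem IsTriangularSymbol.spectrum_eq (h : IsTriangularSymbol M lam phi)
    (hc : ∀ k, ContinuousOn (fun t : ℝ => lam k (t : Torus)) (Set.Ico 0 (2 * Real.pi))) :
    spectrum ℂ (convOfSymbol M) = ⋃ k : Fin d, closure (Set.range (lam k)) := by
  have hset : {w | ∃ l, ∃ z ∈ (Set.univ : Set Torus), w = lam l z} =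
      ⋃ k : Fin d, Set.range (lam k) := by
    ext w; simp [eq_comm]
  rw [← closure_iUnion_of_finite, ← hset]
  ext w
  rw [← not_iff_not, h.notMem_closure_iff hc (s := fun _ => Set.univ) (fun _ => .univ)
    (fun _ z _ => ⟨argT z + 1, by linarith, fun _ _ => trivial⟩), spectrum.notMem_iff,
    frameProj_univ h.toIsFrame, Algebra.algebraMap_eq_smul_one, ← IsUnit.neg_iff, neg_sub]
  simp only [one_mul, mul_one, true_and]
  constructor
  · rintro ⟨u, hu⟩
    exact ⟨↑u⁻¹, by rw [← hu]; exact u.inv_mul, by rw [← hu]; exact u.mul_inv⟩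
  · rintro ⟨C, h1, h2⟩
    exact ⟨⟨_, C, h2, h1⟩, rfl⟩

/-! ### The parts cut off by the chain -/

lemma isRightOpen_below (r : ℝ) (l : Fin d) : IsRightOpen (below r l) := by
  intro z hz
  refine ⟨r - 2 * Real.pi * l, ?_, fun y hy => ?_⟩
  · rw [below, Set.mem_ofPred_eq] at hz; linarith
  · rw [below, Set.mem_ofPred_eq]; linarith [hy.2]

lemma isRightOpen_compl_below (r : ℝ) (l : Fin d) : IsRightOpen (below r l)ᶜ := by
  intro z hz
  refine ⟨argT z + 1, by linarith, fun y hy hy' => hz ?_⟩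
  rw [below, Set.mem_ofPred_eq] at hy' ⊢
  linarith [hy.1]

lemma setOf_prec_eq (lam : Fin d → Torus → ℂ) (ν : CurvePt d) :
    {w : ℂ | ∃ μ : CurvePt d, (μ.2 : ℝ) < 2 * Real.pi ∧ μ.Prec ν ∧
      w = lam μ.1 ((μ.2 : ℝ) : Torus)} = {w | ∃ l, ∃ z ∈ below ν.pos l, w = lam l z} := by
  ext w
  constructor
  · rintro ⟨μ, h1, h2, rfl⟩
    refine ⟨μ.1, ((μ.2 : ℝ) : Torus), ?_, rfl⟩
    rw [mem_below_pos, argT_coe ⟨μ.2.2.1, h1⟩]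
    exact h2
  · rintro ⟨l, z, hz, rfl⟩
    refine ⟨(l, ⟨argT z, (argT_mem z).1, (argT_mem z).2.le⟩), (argT_mem z).2,
      (mem_below_pos _ _ _).1 hz, ?_⟩
    simp only [coe_argT]

/-- The complement of `below` contains the point $\nu$ itself when it is not an end point, whereas
the strict order excludes it. The missing value is a limit of values at later parameters, so the
closures agree. -/
lemma closure_setOf_succ_eq
    (hc : ∀ k, ContinuousOn (fun t : ℝ => lam k (t : Torus)) (Set.Ico 0 (2 * Real.pi)))
    (ν : CurvePt d) :
    closure {w : ℂ | ∃ μ : CurvePt d, (μ.2 : ℝ) < 2 * Real.pi ∧ ν.Prec μ ∧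
      w = lam μ.1 ((μ.2 : ℝ) : Torus)} =
    closure {w | ∃ l, ∃ z ∈ (below ν.pos l)ᶜ, w = lam l z} := by
  apply le_antisymm
  · refine closure_mono ?_
    rintro _ ⟨μ, h1, h2, rfl⟩
    refine ⟨μ.1, ((μ.2 : ℝ) : Torus), ?_, rfl⟩
    rw [Set.mem_compl_iff, mem_below_pos, argT_coe ⟨μ.2.2.1, h1⟩]
    rintro (h3 | ⟨h3, h4⟩)
    · rcases h2 with h2 | ⟨h2, -⟩
      · exact lt_asymm h2 h3
      · exact h3.ne h2.symm
    · rcases h2 with h2 | ⟨-, h2⟩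
      · exact h2.ne h3.symm
      · exact lt_asymm h2 h4
  · refine closure_minimal ?_ isClosed_closure
    rintro _ ⟨l, z, hz, rfl⟩
    have hcz := hc l (argT z) (argT_mem z)
    have hcz' : Filter.Tendsto (fun t : ℝ => lam l (t : Torus))
        (nhdsWithin (argT z) (Set.Ioo (argT z) (2 * Real.pi))) (nhds (lam l z)) := by
      have hsub : Set.Ioo (argT z) (2 * Real.pi) ⊆ Set.Ico 0 (2 * Real.pi) :=
        fun t ht => ⟨(argT_mem z).1.trans ht.1.le, ht.2⟩
      have h1 := hcz.mono hsub
      have h2 : Filter.Tendsto (fun t : ℝ => lam l (t : Torus)) _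
        (nhds (lam l ((argT z : ℝ) : Torus))) := h1
      rwa [coe_argT] at h2
    have hne : (nhdsWithin (argT z) (Set.Ioo (argT z) (2 * Real.pi))).NeBot :=
      left_nhdsWithin_Ioo_neBot (argT_mem z).2
    refine mem_closure_of_tendsto hcz' ?_
    filter_upwards [self_mem_nhdsWithin] with t ht
    have ht0 : 0 ≤ t := (argT_mem z).1.trans ht.1.le
    refine ⟨(l, ⟨t, ht0, ht.2.le⟩), ht.2, ?_, rfl⟩
    rw [Set.mem_compl_iff, mem_below_pos] at hz
    push Not at hz
    rcases hz.1.lt_or_eq with h1 | h1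
    · exact Or.inl h1
    · exact Or.inr ⟨h1, (hz.2 h1.symm).trans_lt ht.1⟩

end BlockConv

namespace BlockConv

/-! ### Continuous enumeration of unordered tuples -/

section ContinuousSelection

open Filter Topology

lemma exists_tendsto_ultrafilter {α X : Type*} [TopologicalSpace X] {K : Set X} (hK : IsCompact K)
    (U : Ultrafilter α) {f : α → X} (hf : ∀ n, f n ∈ K) : ∃ x ∈ K, Tendsto f U (𝓝 x) := by
  obtain ⟨x, hx, h⟩ := isCompact_iff_ultrafilter_le_nhds.1 hK (U.map f)
    (le_principal_iff.2 (mem_map.2 (univ_mem' hf)))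
  exact ⟨x, hx, h⟩

/-- A continuous family of unordered tuples, given by the sets of their enumerations. -/
structure IsTupleFamily {ι : Type*} [Fintype ι] (S : ℝ → Set (ι → ℂ)) : Prop where
  nonempty : ∀ t, (S t).Nonempty
  comp_mem : ∀ t, ∀ a ∈ S t, ∀ σ : Equiv.Perm ι, a ∘ σ ∈ S t
  eq_comp : ∀ t, ∀ a ∈ S t, ∀ b ∈ S t, ∃ σ : Equiv.Perm ι, a = b ∘ σ
  bounded : ∃ C : ℝ, ∀ t, ∀ a ∈ S t, ‖a‖ ≤ C
  closed : IsClosed {p : ℝ × (ι → ℂ) | p.2 ∈ S p.1}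

namespace IsTupleFamily

variable {ι : Type*} [Fintype ι] {S : ℝ → Set (ι → ℂ)}

lemma mem_of_tendsto (hS : IsTupleFamily S) {α : Type*} {l : Filter α} [l.NeBot] {t : α → ℝ}
    {a : α → ι → ℂ} {t₀ : ℝ} {a₀ : ι → ℂ} (ht : Tendsto t l (𝓝 t₀)) (ha : Tendsto a l (𝓝 a₀))
    (h : ∀ n, a n ∈ S (t n)) : a₀ ∈ S t₀ :=
  hS.closed.mem_of_tendsto (ht.prodMk_nhds ha) (Eventually.of_forall h)

lemma exists_tendsto (hS : IsTupleFamily S) {α : Type*} (U : Ultrafilter α) {t : α → ℝ}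
    {a : α → ι → ℂ} (h : ∀ n, a n ∈ S (t n)) : ∃ a₀, Tendsto a U (𝓝 a₀) := by
  obtain ⟨C, hC⟩ := hS.bounded
  obtain ⟨x, -, hx⟩ := exists_tendsto_ultrafilter (isCompact_closedBall (0 : ι → ℂ) C) U
    (f := a) fun n => by simpa using hC _ _ (h n)
  exact ⟨x, hx⟩

/-- Uniform continuity of the family, in terms of enumerations. -/
lemma exists_close (hS : IsTupleFamily S) (T : ℝ) {ε : ℝ} (hε : 0 < ε) :
    ∃ η > 0, ∀ s ∈ Set.Icc 0 T, ∀ t ∈ Set.Icc 0 T, |s - t| < η → ∀ a ∈ S s, ∃ b ∈ S t,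
      ‖a - b‖ < ε := by
  by_contra! hcon
  -- Counterexamples for shrinking $\eta$ have parameters with a common ultrafilter limit. The limit
  -- enumerations differ by a permutation $\sigma$, and rearranging by $\sigma$ contradicts the
  -- lower bound $\varepsilon$.
  choose s hs t ht hst a ha hab using fun n : ℕ => hcon (1 / ((n : ℝ) + 1)) (by positivity)
  set U : Ultrafilter ℕ := hyperfilter ℕ
  have hU : (U : Filter ℕ) ≤ atTop := Nat.hyperfilter_le_atTop
  obtain ⟨s₀, -, hs₀⟩ := exists_tendsto_ultrafilter isCompact_Icc U hs
  obtain ⟨a₀, ha₀⟩ := hS.exists_tendsto U ha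
  choose b hb using fun n => hS.nonempty (t n)
  obtain ⟨b₀, hb₀⟩ := hS.exists_tendsto U hb
  have ht₀ : Tendsto t U (𝓝 s₀) := by
    have h0 : Tendsto (fun n => s n - t n) U (𝓝 0) :=
      squeeze_zero_norm (fun n => (hst n).le) (tendsto_one_div_add_atTop_nhds_zero_nat.mono_left hU)
    simpa using hs₀.sub h0
  obtain ⟨σ, hσ⟩ := hS.eq_comp _ _ (hS.mem_of_tendsto hs₀ ha₀ ha) _ (hS.mem_of_tendsto ht₀ hb₀ hb)
  have hlim : Tendsto (fun n => ‖a n - b n ∘ σ‖) U (𝓝 0) := by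
    have h1 : Tendsto (fun n => b n ∘ σ) U (𝓝 (b₀ ∘ σ)) :=
      tendsto_pi_nhds.2 fun i => (tendsto_pi_nhds.1 hb₀) (σ i)
    simpa [hσ] using (ha₀.sub h1).norm
  have hge : ε ≤ 0 := ge_of_tendsto hlim (Eventually.of_forall fun n =>
    hab n _ (hS.comp_mem _ _ (hb n) σ))
  exact absurd hε (not_lt.2 hge)

end IsTupleFamily

/-- A chain of points with small steps near a finite set does not move far. -/
lemma norm_sub_lt_of_chain {ι : Type*} {z : ι → ℂ} {c δ : ℝ}
    (hc : ∀ i j, 3 * δ < |‖z i - z j‖ - c|) (hc0 : 0 < c) {x : ℕ → ℂ} {m n : ℕ} (hmn : m ≤ n)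
    (hnear : ∀ i, m ≤ i → i ≤ n → ∃ j, ‖x i - z j‖ < δ)
    (hstep : ∀ i, m ≤ i → i < n → ‖x (i + 1) - x i‖ < δ) : ‖x n - x m‖ < c + δ := by
  obtain ⟨j₀, hj₀⟩ := hnear m le_rfl hmn
  have h0 := hc j₀ j₀
  rw [sub_self, norm_zero, zero_sub, abs_neg, abs_of_pos hc0] at h0
  have hδ : 0 < δ := (norm_nonneg _).trans_lt hj₀
  -- One step leads to distance less than $c+\delta$, so the new nearby $z_j$ has distance less than
  -- $c+2\delta$ from $z_{j_0}$. No distance lies within $3\delta$ of $c$, hence it is below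
  -- $c-3\delta$, and the new point is again closer than $c$.
  have key : ∀ i, m ≤ i → i ≤ n → ‖x i - z j₀‖ < c := by
    intro i hi
    induction i, hi using Nat.le_induction with
    | base => intro _; linarith
    | succ i hi ih =>
      intro hin
      have h1 := ih (by omega)
      have h2 := hstep i hi (by omega)
      obtain ⟨j, hj⟩ := hnear (i + 1) (by omega) hin
      have h3 := hc j j₀
      have h4 : ‖x (i + 1) - z j₀‖ ≤ ‖x (i + 1) - x i‖ + ‖x i - z j₀‖ := norm_sub_le_norm_sub_add_norm_sub _ _ _
      have h5 : ‖z j - z j₀‖ ≤ ‖z j - x (i + 1)‖ + ‖x (i + 1) - z j₀‖ := norm_sub_le_norm_sub_add_norm_sub _ _ _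
      have h6 : ‖x (i + 1) - z j₀‖ ≤ ‖x (i + 1) - z j‖ + ‖z j - z j₀‖ := norm_sub_le_norm_sub_add_norm_sub _ _ _
      rw [norm_sub_rev (z j) (x (i + 1))] at h5
      rcases lt_abs.1 h3 with h7 | h7 <;> linarith
  have h1 := key n hmn le_rfl
  have h2 : ‖x n - x m‖ ≤ ‖x n - z j₀‖ + ‖z j₀ - x m‖ := norm_sub_le_norm_sub_add_norm_sub _ _ _
  rw [norm_sub_rev (z j₀)] at h2
  linarith

lemma exists_seq_of_step {α : Type*} {P : ℕ → α → Prop} {R : ℕ → α → α → Prop}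
    (h0 : ∃ a, P 0 a) (hstep : ∀ i a, P i a → ∃ b, P (i + 1) b ∧ R i a b) :
    ∃ f : ℕ → α, (∀ i, P i (f i)) ∧ ∀ i, R i (f i) (f (i + 1)) := by
  obtain ⟨a, ha⟩ := h0
  choose g hg hR using hstep
  let F : ∀ i, {a // P i a} := fun i =>
    Nat.rec ⟨a, ha⟩ (fun i p => ⟨g i p.1 p.2, hg i p.1 p.2⟩) i
  exact ⟨fun i => (F i).1, fun i => (F i).2, fun i => hR i (F i).1 (F i).2⟩

namespace IsTupleFamily

variable {ι : Type*} [Fintype ι] {S : ℝ → Set (ι → ℂ)}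

/-- The enumerations at $t$ form one orbit of the finite permutation group, so the minimum is
attained. -/
lemma exists_nearest (hS : IsTupleFamily S) (a : ι → ℂ) (t : ℝ) :
    ∃ b ∈ S t, ∀ b' ∈ S t, ‖a - b‖ ≤ ‖a - b'‖ := by
  classical
  obtain ⟨b₀, hb₀⟩ := hS.nonempty t
  obtain ⟨σ, -, hσ⟩ := Finset.exists_min_image (Finset.univ : Finset (Equiv.Perm ι))
    (fun σ => ‖a - b₀ ∘ σ‖) ⟨1, Finset.mem_univ _⟩
  refine ⟨b₀ ∘ σ, hS.comp_mem t _ hb₀ σ, fun b' hb' => ?_⟩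
  obtain ⟨τ, rfl⟩ := hS.eq_comp t b' hb' b₀ hb₀
  exact hσ τ (Finset.mem_univ _)

/-- There are finitely many distances $|z_i-z_j|$; $c$ is chosen off them and $\delta$ small
afterwards. -/
lemma exists_gap (z : ι → ℂ) {ε : ℝ} (hε : 0 < ε) :
    ∃ c δ : ℝ, 0 < c ∧ c < ε ∧ 0 < δ ∧ δ < ε ∧ ∀ i j, 3 * δ < |‖z i - z j‖ - c| := by
  have hfin : (Set.range fun p : ι × ι => ‖z p.1 - z p.2‖).Finite := Set.finite_range _
  obtain ⟨c, hc, hcn⟩ := ((Set.Ioo_infinite hε).sdiff hfin).nonempty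
  have hev : ∀ᶠ δ in 𝓝[>] (0 : ℝ), ∀ i j, 3 * δ < |‖z i - z j‖ - c| := by
    simp only [eventually_all]
    intro i j
    have hpos : 0 < |‖z i - z j‖ - c| :=
      abs_pos.2 (sub_ne_zero.2 fun h => hcn ⟨(i, j), h⟩)
    have ht : Tendsto (fun δ : ℝ => 3 * δ) (𝓝[>] 0) (𝓝 (3 * 0)) :=
      (tendsto_id.mono_left nhdsWithin_le_nhds).const_mul 3
    rw [mul_zero] at ht
    exact ht.eventually_lt_const hpos
  obtain ⟨δ, h1, h2⟩ := (hev.and (Ioo_mem_nhdsGT hε)).exists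
  exact ⟨c, δ, hc.1, hc.2, h2.1, h2.2, h1⟩

/-- A continuous family of unordered tuples over a compact interval has a continuous
enumeration. -/
theorem exists_continuousOn (hS : IsTupleFamily S) (T : ℝ) :
    ∃ f : ℝ → ι → ℂ, ContinuousOn f (Set.Icc 0 T) ∧ ∀ t ∈ Set.Icc 0 T, f t ∈ S t := by
  -- On the grid of mesh $1/(n+1)$, each enumeration is followed by a nearest one at the next grid
  -- point.
  have hseq : ∀ n : ℕ, ∃ g : ℕ → ι → ℂ, (∀ i : ℕ, g i ∈ S (i / ((n : ℝ) + 1))) ∧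
      ∀ i : ℕ, ∀ b ∈ S ((i + 1 : ℕ) / ((n : ℝ) + 1)), ‖g i - g (i + 1)‖ ≤ ‖g i - b‖ := by
    intro n
    refine exists_seq_of_step (P := fun i a => a ∈ S (i / ((n : ℝ) + 1)))
      (R := fun i a a' => ∀ b ∈ S ((i + 1 : ℕ) / ((n : ℝ) + 1)), ‖a - a'‖ ≤ ‖a - b‖)
      (hS.nonempty _) fun i a _ => hS.exists_nearest a _
  choose g hg hgstep using hseq
  set U : Ultrafilter ℕ := hyperfilter ℕ
  have hU : (U : Filter ℕ) ≤ atTop := Nat.hyperfilter_le_atTop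
  let N : ℕ → ℝ → ℕ := fun n t => ⌊t * ((n : ℝ) + 1)⌋₊
  have hN : ∀ n t, 0 ≤ t → (N n t : ℝ) / (n + 1) ≤ t ∧ t < N n t / (n + 1) + 1 / ((n : ℝ) + 1) := by
    intro n t ht
    have h0 : (0 : ℝ) < n + 1 := by positivity
    rw [div_le_iff₀ h0, ← add_div, lt_div_iff₀ h0]
    exact ⟨Nat.floor_le (by positivity), Nat.lt_floor_add_one _⟩
  -- An ultrafilter yields the limit for all $t$ at once; no subsequence has to be extracted.
  choose f hf using fun t => hS.exists_tendsto U (t := fun n => (N n t : ℝ) / (n + 1))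
    (a := fun n => g n (N n t)) fun n => hg n (N n t)
  have hinv : Tendsto (fun n : ℕ => 1 / ((n : ℝ) + 1)) U (𝓝 0) :=
    tendsto_one_div_add_atTop_nhds_zero_nat.mono_left hU
  refine ⟨f, fun t₀ ht₀ => ?_, fun t ht => ?_⟩
  · rw [Metric.continuousWithinAt_iff]
    intro ε hε
    obtain ⟨z, hz⟩ := hS.nonempty t₀
    -- The grid functions will move by at most $c+\delta<\varepsilon/2$ near $t_0$, which leaves
    -- room for the strict inequality in the limit.
    obtain ⟨c, δ, hc0, hcε, hδ0, hδε, hgap⟩ := exists_gap z (ε := ε / 4) (by positivity)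
    obtain ⟨η, hη, hclose⟩ := hS.exists_close T hδ0
    refine ⟨η / 2, by positivity, fun t ht hdist => ?_⟩
    rw [Real.dist_eq] at hdist
    have hev : ∀ᶠ n : ℕ in U, 1 / ((n : ℝ) + 1) < η / 2 :=
      hinv.eventually_lt_const (by positivity)
    have hbound : ∀ᶠ n : ℕ in U, ‖g n (N n t) - g n (N n t₀)‖ ≤ c + δ := by
      filter_upwards [hev] with n hn
      have h0 : (0 : ℝ) < n + 1 := by positivity
      have hchain : ∀ u v : ℝ, u ∈ Set.Icc 0 T → v ∈ Set.Icc 0 T → |u - t₀| < η / 2 →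
          |v - t₀| < η / 2 → u ≤ v → ‖g n (N n v) - g n (N n u)‖ ≤ c + δ := by
        intro u v hu hv hut hvt huv
        have huN := hN n u hu.1
        have hvN := hN n v hv.1
        have hle : N n u ≤ N n v := Nat.floor_mono (by gcongr)
        -- Rounding down moves a parameter by less than $1/(n+1)<\eta/2$, so the grid points stay
        -- within $\eta$ of $t_0$.
        have hgrid : ∀ i, N n u ≤ i → i ≤ N n v →
            (i : ℝ) / (n + 1) ∈ Set.Icc 0 T ∧ |(i : ℝ) / (n + 1) - t₀| < η := by
          intro i hi1 hi2
          have h1 : (N n u : ℝ) / (n + 1) ≤ i / (n + 1) := by gcongr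
          have h2 : (i : ℝ) / (n + 1) ≤ N n v / (n + 1) := by gcongr
          rw [abs_lt] at hut hvt
          refine ⟨⟨by positivity, by linarith [hv.2]⟩, abs_lt.2 ⟨by linarith, by linarith⟩⟩
        refine (pi_norm_le_iff_of_nonneg (by positivity)).2 fun k => ?_
        refine (norm_sub_lt_of_chain (x := fun i => g n i k) hgap hc0 hle ?_ ?_).le
        · intro i hi1 hi2
          obtain ⟨h1, h2⟩ := hgrid i hi1 hi2
          obtain ⟨b, hb, hab⟩ := hclose _ h1 t₀ ht₀ h2 _ (hg n i)
          obtain ⟨σ, rfl⟩ := hS.eq_comp t₀ b hb z hz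
          exact ⟨σ k, (norm_le_pi_norm (g n i - z ∘ σ) k).trans_lt hab⟩
        · intro i hi1 hi2
          obtain ⟨h1, -⟩ := hgrid i hi1 hi2.le
          obtain ⟨h2, -⟩ := hgrid (i + 1) (by omega) hi2
          have h3 : |(i : ℝ) / (n + 1) - ((i + 1 : ℕ) : ℝ) / (n + 1)| < η := by
            have : (i : ℝ) / (n + 1) - ((i + 1 : ℕ) : ℝ) / (n + 1) = -(1 / ((n : ℝ) + 1)) := by
              push_cast; ring
            rw [this, abs_neg, abs_of_pos (by positivity)]
            linarith
          -- Some enumeration at the next grid point is $\delta$-close, and the nearest one is no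
          -- worse.
          obtain ⟨b, hb, hab⟩ := hclose _ h1 _ h2 h3 _ (hg n i)
          have h4 := (hgstep n i b hb).trans_lt hab
          rw [norm_sub_rev] at h4
          exact (norm_le_pi_norm (g n (i + 1) - g n i) k).trans_lt h4
      have hself : |t₀ - t₀| < η / 2 := by rw [sub_self, abs_zero]; positivity
      rcases le_total t₀ t with hle | hle
      · exact hchain t₀ t ht₀ ht hself hdist hle
      · rw [norm_sub_rev]
        exact hchain t t₀ ht ht₀ hdist hself hle
    have hlim : Tendsto (fun n => ‖g n (N n t) - g n (N n t₀)‖) U (𝓝 ‖f t - f t₀‖) :=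
      ((hf t).sub (hf t₀)).norm
    rw [dist_eq_norm]
    have := le_of_tendsto hlim hbound
    linarith
  · refine hS.mem_of_tendsto (l := (U : Filter ℕ)) ?_ (hf t) fun n => hg n (N n t)
    have h0 : Tendsto (fun n : ℕ => t - (N n t : ℝ) / (n + 1)) U (𝓝 0) := by
      refine squeeze_zero (fun n => ?_) (fun n => ?_) hinv
      · linarith [(hN n t ht.1).1]
      · linarith [(hN n t ht.1).2]
    simpa using (tendsto_const_nhds (x := t)).sub h0

end IsTupleFamily

end ContinuousSelection

/-! ### Continuous eigenvalues -/

/-- Equal polynomials have equal root multisets, so $a$ and $b$ take each value equally often;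
bijections between their fibres fit together to a permutation. -/
lemma exists_perm_of_prod_eq {d : ℕ} {a b : Fin d → ℂ}
    (h : ∀ x, ∏ i, (x - a i) = ∏ i, (x - b i)) : ∃ σ : Equiv.Perm (Fin d), a = b ∘ σ := by
  classical
  have hpoly : ((Finset.univ.val.map a).map (fun c => Polynomial.X - Polynomial.C c)).prod =
      ((Finset.univ.val.map b).map (fun c => Polynomial.X - Polynomial.C c)).prod := by
    refine Polynomial.funext fun x => ?_
    have h1 : ∀ c : Fin d → ℂ,
        ((Finset.univ.val.map c).map (fun c => Polynomial.X - Polynomial.C c)).prod =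
          ∏ i, (Polynomial.X - Polynomial.C (c i)) := fun c => by
      rw [Multiset.map_map]; rfl
    rw [h1, h1, Polynomial.eval_prod, Polynomial.eval_prod]
    simpa using h x
  have hroots := congrArg Polynomial.roots hpoly
  rw [Polynomial.roots_multiset_prod_X_sub_C, Polynomial.roots_multiset_prod_X_sub_C] at hroots
  have hcard : ∀ c, Fintype.card {i // a i = c} = Fintype.card {i // b i = c} := by
    intro c
    have h1 := congrArg (Multiset.count c) hroots
    rw [Multiset.count_map, Multiset.count_map] at h1
    rw [Fintype.card_subtype, Fintype.card_subtype]
    simpa only [Finset.card_def, Finset.filter_val, eq_comm] using h1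
  refine ⟨Equiv.ofFiberEquiv (f := a) (g := b) fun c => Fintype.equivOfCardEq (hcard c), ?_⟩
  funext i
  exact (Equiv.ofFiberEquiv_map _ i).symm

lemma exists_eq_prod_of_monic {d : ℕ} {p : Polynomial ℂ} (hp : p.Monic) (hd : p.natDegree = d) :
    ∃ a : Fin d → ℂ, ∀ x, p.eval x = ∏ i, (x - a i) := by
  have hsplit := IsAlgClosed.splits p
  have hcard : p.roots.toList.length = d := by
    rw [Multiset.length_toList, ← hd, hsplit.natDegree_eq_card_roots]
  have hprod := hsplit.eq_prod_roots_of_monic hp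
  subst hcard
  refine ⟨fun i => p.roots.toList[i], fun x => ?_⟩
  conv_lhs => rw [hprod]
  rw [Polynomial.eval_multiset_prod, Multiset.map_map]
  conv_lhs => rw [← Multiset.coe_toList p.roots]
  rw [Multiset.map_coe, Multiset.prod_coe, ← List.prod_ofFn]
  congr 1
  apply List.ext_getElem <;> simp

/-- The enumerations of the eigenvalues of an operator. -/
def eigenTuples {d : ℕ} (T : Cd d →L[ℂ] Cd d) : Set (Fin d → ℂ) :=
  {a | ∀ x : ℂ, (x • (1 : Cd d →L[ℂ] Cd d) - T).det = ∏ i, (x - a i)}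

lemma eigenTuples_nonempty {d : ℕ} (T : Cd d →L[ℂ] Cd d) : (eigenTuples T).Nonempty := by
  obtain ⟨a, ha⟩ := exists_eq_prod_of_monic (d := d)
    (T : Cd d →ₗ[ℂ] Cd d).charpoly_monic (by simp [LinearMap.charpoly_natDegree])
  refine ⟨a, fun x => ?_⟩
  rw [← ha, LinearMap.eval_charpoly, ContinuousLinearMap.det]
  congr 1

lemma norm_le_of_mem_eigenTuples {d : ℕ} {T : Cd d →L[ℂ] Cd d} {a : Fin d → ℂ}
    (ha : a ∈ eigenTuples T) : ‖a‖ ≤ ‖T‖ := by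
  refine (pi_norm_le_iff_of_nonneg (norm_nonneg _)).2 fun i => ?_
  have h0 : (a i • (1 : Cd d →L[ℂ] Cd d) - T).det = 0 := by
    rw [ha, Finset.prod_eq_zero (Finset.mem_univ i) (sub_self _)]
  obtain ⟨v, hv, hv0⟩ := (Submodule.ne_bot_iff _).1 (LinearMap.bot_lt_ker_of_det_eq_zero h0).ne'
  have h1 : a i • v = T v := sub_eq_zero.1 hv
  have h2 := T.le_opNorm v
  rw [← h1, norm_smul] at h2
  exact le_of_mul_le_mul_right h2 (norm_pos_iff.2 hv0)

lemma isTupleFamily_eigenTuples {d : ℕ} {T : ℝ → (Cd d →L[ℂ] Cd d)} (hT : Continuous T)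
    {K : ℝ} (hK : ∀ t, ‖T t‖ ≤ K) : IsTupleFamily fun t => eigenTuples (T t) where
  nonempty t := eigenTuples_nonempty (T t)
  comp_mem t a ha σ x := by rw [ha x, ← Equiv.prod_comp σ]; rfl
  eq_comp t a ha b hb := exists_perm_of_prod_eq fun x => (ha x).symm.trans (hb x)
  bounded := ⟨K, fun t _ ha => (norm_le_of_mem_eigenTuples ha).trans (hK t)⟩
  closed := by
    have hset : {p : ℝ × (Fin d → ℂ) | p.2 ∈ eigenTuples (T p.1)} =
        ⋂ x : ℂ, {p | (x • (1 : Cd d →L[ℂ] Cd d) - T p.1).det = ∏ i, (x - p.2 i)} := by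
      ext p; simp [eigenTuples]
    rw [hset]
    refine isClosed_iInter fun x => isClosed_eq ?_ ?_
    · exact ContinuousLinearMap.continuous_det.comp
        (continuous_const.sub (hT.comp continuous_fst))
    · fun_prop

end BlockConv

namespace BlockConv

/-! ### Measurable selection of kernel vectors -/

section Kernel

open Filter Topology

variable {d : ℕ}

/-- The iteration `(1 - c B* B)^n`, `c = (1 + ‖B‖²)⁻¹`, which converges to the projection onto the
kernel of `B`. -/
noncomputable def kernelIter (B : Cd d →L[ℂ] Cd d) (n : ℕ) : Cd d →L[ℂ] Cd d :=
  (1 - (((1 + ‖B‖ ^ 2)⁻¹ : ℝ) : ℂ) • (B.adjoint * B)) ^ n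

/-- In an eigenbasis of $B^*B$ with eigenvalues $\mu_i=\|Be_i\|^2\le\|B\|^2$ one has $0\le
c\mu_i<1$. Thus $(1-c\mu_i)^n\to0$ unless $\mu_i=0$, that is $Be_i=0$. The iterates depend
measurably on $B$, which an eigenbasis need not do. -/
lemma exists_tendsto_kernelIter (B : Cd d →L[ℂ] Cd d) :
    ∃ P : Cd d →L[ℂ] Cd d, (∀ x, Tendsto (fun n => kernelIter B n x) atTop (𝓝 (P x))) ∧
      (∀ x, B (P x) = 0) ∧ ∀ x, B x = 0 → P x = x := by
  classical
  have hS : ((B.adjoint * B : Cd d →L[ℂ] Cd d) : Cd d →ₗ[ℂ] Cd d).IsSymmetric := by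
    intro x y
    change inner ℂ (B.adjoint (B x)) y = inner ℂ x (B.adjoint (B y))
    rw [ContinuousLinearMap.adjoint_inner_left, ContinuousLinearMap.adjoint_inner_right]
  have hn : Module.finrank ℂ (Cd d) = d := by simp
  set e := hS.eigenvectorBasis hn
  set μ := hS.eigenvalues hn
  have hSe : ∀ i, B.adjoint (B (e i)) = (μ i : ℂ) • e i := fun i => hS.apply_eigenvectorBasis hn i
  have hμ : ∀ i, μ i = ‖B (e i)‖ ^ 2 := by
    intro i
    have h1 : inner ℂ (e i) (B.adjoint (B (e i))) = inner ℂ (B (e i)) (B (e i)) :=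
      ContinuousLinearMap.adjoint_inner_right _ _ _
    rw [hSe, inner_smul_right, inner_self_eq_norm_sq_to_K, inner_self_eq_norm_sq_to_K,
      e.orthonormal.1 i] at h1
    have h2 : ((μ i : ℝ) : ℂ) = ((‖B (e i)‖ ^ 2 : ℝ) : ℂ) := by
      push_cast
      simpa using h1
    exact_mod_cast h2
  set c : ℝ := (1 + ‖B‖ ^ 2)⁻¹ with hc
  have hc0 : 0 < c := by positivity
  have hGe : ∀ n i, kernelIter B n (e i) = (((1 - c * μ i) ^ n : ℝ) : ℂ) • e i := by
    intro n i
    induction n with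
    | zero => simp [kernelIter]
    | succ n ih =>
      rw [kernelIter, pow_succ, mul_apply_eq_comp]
      have h1 : (1 - (c : ℂ) • (B.adjoint * B)) (e i) = ((1 - c * μ i : ℝ) : ℂ) • e i := by
        change e i - (c : ℂ) • B.adjoint (B (e i)) = _
        rw [hSe, smul_smul]
        push_cast
        rw [sub_smul, one_smul]
      rw [h1, map_smul]
      rw [kernelIter] at ih
      rw [ih, smul_smul, pow_succ]
      push_cast
      rw [mul_comm]
  have hlt : ∀ i, μ i ≠ 0 → |1 - c * μ i| < 1 := by
    intro i hi
    have h1 : 0 < μ i := lt_of_le_of_ne (by rw [hμ]; positivity) hi.symm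
    have h2 : μ i ≤ ‖B‖ ^ 2 := by
      rw [hμ]
      gcongr
      simpa [e.orthonormal.1 i] using B.le_opNorm (e i)
    have h3 : c * μ i < 1 := by
      rw [hc, inv_mul_lt_iff₀ (by positivity)]
      linarith
    rw [abs_lt]
    constructor <;> nlinarith [mul_pos hc0 h1]
  set P : Cd d →L[ℂ] Cd d :=
    ∑ i with μ i = 0, InnerProductSpace.rankOne ℂ (e i) (e i) with hP
  have hlim : ∀ x, Tendsto (fun n => kernelIter B n x) atTop (𝓝 (P x)) := by
    intro x
    have hx : ∀ n, kernelIter B n x =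
        ∑ i, (inner ℂ (e i) x * (((1 - c * μ i) ^ n : ℝ) : ℂ)) • e i := by
      intro n
      conv_lhs => rw [← e.sum_repr' x, map_sum]
      refine Finset.sum_congr rfl fun i _ => ?_
      rw [map_smul, hGe, smul_smul]
    have hPx : P x = ∑ i, (inner ℂ (e i) x * (if μ i = 0 then 1 else 0)) • e i := by
      rw [hP, sum_apply, Finset.sum_filter]
      refine Finset.sum_congr rfl fun i _ => ?_
      split_ifs <;> simp
    simp only [hx]
    rw [hPx]
    refine tendsto_finsetSum _ fun i _ => (Tendsto.const_mul _ ?_).smul_const _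
    split_ifs with hi
    · simp [hi]
    · have h1 := tendsto_pow_atTop_nhds_zero_of_abs_lt_one (hlt i hi)
      exact_mod_cast (Complex.continuous_ofReal.tendsto 0).comp h1
  refine ⟨P, hlim, fun x => ?_, fun x hx => ?_⟩
  · rw [hP, sum_apply, map_sum]
    refine Finset.sum_eq_zero fun i hi => ?_
    have h0 : B (e i) = 0 := by
      have := hμ i
      rw [(Finset.mem_filter.1 hi).2] at this
      simpa using this.symm
    rw [InnerProductSpace.rankOne_apply, map_smul, h0, smul_zero]
  · have hfix : ∀ n, kernelIter B n x = x := by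
      intro n
      induction n with
      | zero => simp [kernelIter]
      | succ n ih =>
        rw [kernelIter, pow_succ, mul_apply_eq_comp]
        have h1 : (1 - (c : ℂ) • (B.adjoint * B)) x = x := by
          change x - (c : ℂ) • B.adjoint (B x) = x
          rw [hx, map_zero, smul_zero, sub_zero]
        rw [h1]
        exact ih
    have h1 := hlim x
    simp only [hfix] at h1
    exact tendsto_nhds_unique h1 tendsto_const_nhds

lemma stronglyMeasurable_kernelIter {Ω : Type*} [MeasurableSpace Ω] {B : Ω → (Cd d →L[ℂ] Cd d)}
    (hB : StronglyMeasurable B) (n : ℕ) : StronglyMeasurable fun z => kernelIter (B z) n := by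
  have hadj : StronglyMeasurable fun z => (B z).adjoint :=
    (ContinuousLinearMap.adjoint (𝕜 := ℂ) (E := Cd d) (F := Cd d)).continuous.comp_stronglyMeasurable
      hB
  have hc : StronglyMeasurable fun z => (((1 + ‖B z‖ ^ 2)⁻¹ : ℝ) : ℂ) :=
    Complex.continuous_ofReal.comp_stronglyMeasurable
      (((hB.norm.pow 2).measurable.const_add 1).inv.stronglyMeasurable)
  have hbase : StronglyMeasurable fun z =>
      (1 : Cd d →L[ℂ] Cd d) - (((1 + ‖B z‖ ^ 2)⁻¹ : ℝ) : ℂ) • ((B z).adjoint * B z) :=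
    stronglyMeasurable_const.sub (hc.smul (hadj.mul hB))
  unfold kernelIter
  induction n with
  | zero => exact stronglyMeasurable_const
  | succ n ih => exact ih.mul hbase

/-- A measurable family of singular operators has a measurable family of unit kernel vectors. -/
lemma exists_measurable_kernel_vector {Ω : Type*} [MeasurableSpace Ω]
    {B : Ω → (Cd d →L[ℂ] Cd d)} (hB : StronglyMeasurable B) (hker : ∀ z, ∃ v, v ≠ 0 ∧ B z v = 0) :
    ∃ v : Ω → Cd d, Measurable v ∧ ∀ z, ‖v z‖ = 1 ∧ B z (v z) = 0 := by
  classical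
  choose P hlim hBP hPfix using fun z => exists_tendsto_kernelIter (B z)
  -- The standard basis, padded by zeros so that the first $j$ with $Pb_j\ne0$ can be found by
  -- `Nat.find`. This choice of $j$ is measurable.
  let b : ℕ → Cd d := fun j => if h : j < d then EuclideanSpace.single ⟨j, h⟩ 1 else 0
  have hmeas : ∀ j, Measurable fun z => P z (b j) := by
    intro j
    refine measurable_of_tendsto_metrizable (f := fun n z => kernelIter (B z) n (b j))
      (fun n => ?_) (tendsto_pi_nhds.2 fun z => hlim z (b j))
    have hc : Continuous fun T : Cd d →L[ℂ] Cd d => T (b j) := by fun_prop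
    exact (hc.comp_stronglyMeasurable (stronglyMeasurable_kernelIter hB n)).measurable
  have hex : ∀ z, ∃ j, P z (b j) ≠ 0 := by
    intro z
    by_contra! hcon
    obtain ⟨v, hv, hv0⟩ := hker z
    refine hv ?_
    rw [← hPfix z v hv0]
    have hP0 : P z = 0 := by
      refine clm_ext_orthonormal (EuclideanSpace.basisFun (Fin d) ℂ).orthonormal fun k => ?_
      have h1 := hcon k
      simp only [b, k.2, dif_pos] at h1
      simpa using h1
    rw [hP0]; rfl
  have hu : Measurable fun z => P z (b (Nat.find (hex z))) :=
    Measurable.find (f := fun j z => P z (b j)) (p := fun j z => P z (b j) ≠ 0) hmeas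
      (fun j => (hmeas j (measurableSet_singleton 0)).compl) hex
  refine ⟨fun z => ((‖P z (b (Nat.find (hex z)))‖⁻¹ : ℝ) : ℂ) • P z (b (Nat.find (hex z))), ?_,
    fun z => ⟨?_, ?_⟩⟩
  · exact (Complex.measurable_ofReal.comp hu.norm.inv).smul hu
  · have h0 : ‖P z (b (Nat.find (hex z)))‖ ≠ 0 := norm_ne_zero_iff.2 (Nat.find_spec (hex z))
    rw [norm_smul, Complex.norm_real, norm_inv, norm_norm, inv_mul_cancel₀ h0]
  · rw [map_smul, hBP, smul_zero]

end Kernel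

/-! ### Measurable Schur vectors -/

section Schur

variable {d : ℕ}

/-- The operator that is the identity on the range of the projection `Q` and `x - T` on the
complement. -/
noncomputable def deflated (Q T : Cd d →L[ℂ] Cd d) (x : ℂ) : Cd d →L[ℂ] Cd d :=
  Q + (1 - Q) * (x • 1 - T)

lemma continuous_deflated (Q T : Cd d →L[ℂ] Cd d) : Continuous (deflated Q T) := by
  unfold deflated
  exact continuous_const.add
    (continuous_const.mul ((continuous_id.smul continuous_const).sub continuous_const))

/-- The two summands of `deflated` take values in complementary subspaces, so both vanish. A kernel
vector is thus the next Schur vector: it is annihilated by $Q$ and is an eigenvector of $T$ modulo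
the range of $Q$. -/
lemma apply_eq_zero_of_deflated {Q T : Cd d →L[ℂ] Cd d} (hQ : Q * Q = Q) {x : ℂ} {v : Cd d}
    (hv : deflated Q T x v = 0) : Q v = 0 ∧ T v = x • v + Q (T v) := by
  have hQQ : ∀ y, Q (Q y) = Q y := fun y => congrArg (fun S : Cd d →L[ℂ] Cd d => S y) hQ
  have h1 : Q v + ((x • v - T v) - Q (x • v - T v)) = 0 := hv
  have h2 : Q v = 0 := by
    have h3 := congrArg Q h1
    rwa [map_add, map_sub, hQQ, hQQ, sub_self, add_zero, map_zero] at h3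
  refine ⟨h2, ?_⟩
  rw [map_sub, map_smul, h2, smul_zero, zero_sub, zero_add, sub_neg_eq_add] at h1
  have h3 : x • v + Q (T v) - T v = 0 := by rw [← h1]; abel
  exact (sub_eq_zero.1 h3).symm

lemma rankOne_self_mul_self {v : Cd d} (hv : ‖v‖ = 1) :
    (InnerProductSpace.rankOne ℂ v v : Cd d →L[ℂ] Cd d) * InnerProductSpace.rankOne ℂ v v =
      InnerProductSpace.rankOne ℂ v v := by
  ext1 y
  simp [mul_apply_eq_comp, inner_self_eq_norm_sq_to_K, hv]

/-- Write $B$ and $B'$ for the deflated elements of $Q$ and $Q+p$. Then $B=B'+p(B-1)$, and $B'p=p$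
because $Xp$ lies in the ranges of $p$ and $Q$, which $1-(Q+p)$ kills. Hence $B=B'(1+p(B-1))$. -/
lemma deflation_factorization {R : Type*} [Ring R] {Q p X s w : R} (hQ : Q * Q = Q)
    (hp : p * p = p) (hQp : Q * p = 0) (hpQ : p * Q = 0) (hX : X * p = p * s + Q * w) :
    Q + (1 - Q) * X = (Q + p + (1 - (Q + p)) * X) * (1 + p * (Q + (1 - Q) * X - 1)) := by
  have hBp : (Q + p + (1 - (Q + p)) * X) * p = p := by
    calc (Q + p + (1 - (Q + p)) * X) * p
        = Q * p + p * p + (1 - (Q + p)) * (X * p) := by noncomm_ring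
      _ = Q * p + p * p + (p * s - Q * p * s - p * p * s) + (Q * w - Q * Q * w - p * Q * w) := by
        rw [hX]; noncomm_ring
      _ = p := by rw [hQp, hp, hpQ, hQ]; noncomm_ring
  have hpB : p * (Q + (1 - Q) * X) = p * X := by
    calc p * (Q + (1 - Q) * X) = p * Q + p * X - p * Q * X := by noncomm_ring
      _ = p * X := by rw [hpQ]; noncomm_ring
  calc Q + (1 - Q) * X = (Q + p + (1 - (Q + p)) * X) + (p * X - p) := by noncomm_ring
    _ = (Q + p + (1 - (Q + p)) * X) + (Q + p + (1 - (Q + p)) * X) * p * (Q + (1 - Q) * X - 1) := by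
      rw [hBp, mul_sub, hpB, mul_one]
    _ = _ := by noncomm_ring

/-- The second factor in `deflation_factorization` is $y\mapsto y+f(y)v$ with determinant $1+f(v)$.
Here $v$ is an eigenvector of the deflated operator with eigenvalue $x-l$, so $1+f(v)=x-l$. -/
lemma det_deflated_add_rankOne {Q T : Cd d →L[ℂ] Cd d} (hQ : Q * Q = Q) (hsa : IsSelfAdjoint Q)
    {l : ℂ} {v : Cd d} (hv1 : ‖v‖ = 1) (hv : deflated Q T l v = 0) (x : ℂ) :
    (deflated Q T x).det =
      (deflated (Q + InnerProductSpace.rankOne ℂ v v) T x).det * (x - l) := by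
  obtain ⟨hQv, hTv⟩ := apply_eq_zero_of_deflated hQ hv
  set p : Cd d →L[ℂ] Cd d := InnerProductSpace.rankOne ℂ v v with hp
  have hsym := ContinuousLinearMap.isSelfAdjoint_iff_isSymmetric.1 hsa
  have hvQ : ∀ y, inner ℂ v (Q y) = 0 := fun y => by
    have := hsym v y
    simp only [ContinuousLinearMap.coe_coe] at this
    rw [← this, hQv, inner_zero_left]
  have hpp : p * p = p := rankOne_self_mul_self hv1
  have hQp : Q * p = 0 := by
    ext1 y
    change Q (inner ℂ v y • v) = 0
    rw [map_smul, hQv, smul_zero]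
  have hpQ : p * Q = 0 := by
    ext1 y
    change inner ℂ v (Q y) • v = 0
    rw [hvQ, zero_smul]
  have hTp : T * p = l • p + Q * T * p := by
    ext1 y
    change T (inner ℂ v y • v) = l • (inner ℂ v y • v) + Q (T (inner ℂ v y • v))
    rw [map_smul, map_smul]
    conv_lhs => rw [hTv]
    rw [smul_add, smul_comm]
  set f : Module.Dual ℂ (Cd d) :=
    ((innerSL ℂ v ∘L (deflated Q T x - 1) : Cd d →L[ℂ] ℂ) : Cd d →ₗ[ℂ] ℂ) with hf
  have hE : (LinearMap.transvection f v : Cd d →ₗ[ℂ] Cd d) =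
      ((1 + p * (deflated Q T x - 1) : Cd d →L[ℂ] Cd d) : Cd d →ₗ[ℂ] Cd d) := by
    ext1 y
    change y + inner ℂ v (deflated Q T x y - y) • v = y + inner ℂ v (deflated Q T x y - y) • v
    rfl
  have hdet : (1 + p * (deflated Q T x - 1) : Cd d →L[ℂ] Cd d).det = x - l := by
    rw [ContinuousLinearMap.det, ← hE, LinearMap.transvection.det]
    have hfv : f v = inner ℂ v (deflated Q T x v - v) := rfl
    have hdv : deflated Q T x v = (x - l) • v := by
      change Q v + ((x • v - T v) - Q (x • v - T v)) = _
      rw [map_sub, map_smul, hQv, smul_zero, zero_sub, zero_add, sub_neg_eq_add]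
      conv_lhs => rw [hTv]
      rw [map_add, map_smul, hQv, smul_zero, zero_add, ← mul_apply_eq_comp Q Q, hQ, sub_smul]
      abel
    rw [hfv, hdv, inner_sub_right, inner_smul_right, inner_self_eq_norm_sq_to_K, hv1]
    norm_num
  have hfac : deflated Q T x =
      deflated (Q + p) T x * (1 + p * (deflated Q T x - 1)) := by
    refine deflation_factorization (s := (x - l) • 1) (w := -(T * p)) hQ hpp hQp hpQ ?_
    ext1 y
    have h1 : T (p y) = l • p y + Q (T (p y)) :=
      congrArg (fun S : Cd d →L[ℂ] Cd d => S y) hTp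
    change x • p y - T (p y) = p ((x - l) • y) + Q (-(T (p y)))
    conv_lhs => rw [h1]
    rw [map_neg, map_smul, sub_smul]
    abel
  rw [← hdet]
  conv_lhs => rw [hfac]
  exact LinearMap.det_comp _ _

lemma add_rankOne_isProj {Q : Cd d →L[ℂ] Cd d} (hQ : Q * Q = Q) (hsa : IsSelfAdjoint Q) {v : Cd d}
    (hv1 : ‖v‖ = 1) (hQv : Q v = 0) :
    (Q + InnerProductSpace.rankOne ℂ v v) * (Q + InnerProductSpace.rankOne ℂ v v) =
      Q + InnerProductSpace.rankOne ℂ v v ∧ IsSelfAdjoint (Q + InnerProductSpace.rankOne ℂ v v) := by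
  have hsym := ContinuousLinearMap.isSelfAdjoint_iff_isSymmetric.1 hsa
  have hQp : Q * InnerProductSpace.rankOne ℂ v v = 0 := by
    ext1 y
    change Q (inner ℂ v y • v) = 0
    rw [map_smul, hQv, smul_zero]
  have hpQ : InnerProductSpace.rankOne ℂ v v * Q = 0 := by
    ext1 y
    have h1 : inner ℂ v (Q y) = 0 := by
      have h2 : inner ℂ (Q v) y = inner ℂ v (Q y) := hsym v y
      rw [← h2, hQv, inner_zero_left]
    change inner ℂ v (Q y) • v = 0
    rw [h1, zero_smul]
  constructor
  · rw [add_mul, mul_add, mul_add, hQ, hQp, hpQ, rankOne_self_mul_self hv1, add_zero, zero_add]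
  · have hp : IsSelfAdjoint (InnerProductSpace.rankOne ℂ v v : Cd d →L[ℂ] Cd d) := by
      rw [ContinuousLinearMap.isSelfAdjoint_iff_isSymmetric]
      intro x y
      simp [inner_smul_left, inner_smul_right]
      ring
    exact hsa.add hp

lemma eq_of_mul_sub_eq {f g : ℂ → ℂ} {l : ℂ} (hf : Continuous f) (hg : Continuous g)
    (h : ∀ x, f x * (x - l) = g x * (x - l)) (x : ℂ) : f x = g x := by
  have hd : Dense ({l}ᶜ : Set ℂ) := dense_compl_singleton l
  refine congrFun (Continuous.ext_on hd hf hg fun y hy => ?_) x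
  exact mul_right_cancel₀ (sub_ne_zero.2 hy) (h y)

/-- Pairing with $\varphi_i$ gives $\sum_j|\langle\varphi_j,\varphi_i\rangle|^2=0$, whence every
term vanishes. -/
lemma inner_eq_zero_of_sum_rankOne {φ : ℕ → Cd d} {i : ℕ}
    (h : (∑ j ∈ Finset.range i, InnerProductSpace.rankOne ℂ (φ j) (φ j) : Cd d →L[ℂ] Cd d) (φ i) = 0)
    {j : ℕ} (hj : j < i) : inner ℂ (φ j) (φ i) = 0 := by
  have h1 := congrArg (inner ℂ (φ i)) h
  rw [inner_zero_right, sum_apply, inner_sum] at h1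
  have h2 : ∀ k, inner ℂ (φ i) ((InnerProductSpace.rankOne ℂ (φ k) (φ k) : Cd d →L[ℂ] Cd d) (φ i)) =
      ((‖inner ℂ (φ k) (φ i)‖ ^ 2 : ℝ) : ℂ) := by
    intro k
    rw [InnerProductSpace.rankOne_apply, inner_smul_right, ← inner_conj_symm (φ i) (φ k),
      Complex.mul_conj, Complex.normSq_eq_norm_sq]
  simp only [h2] at h1
  rw [← Complex.ofReal_sum] at h1
  have h3 := (Finset.sum_eq_zero_iff_of_nonneg fun _ _ => by positivity).1
    (Complex.ofReal_eq_zero.1 h1) j (Finset.mem_range.2 hj)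
  simpa using h3

/-- Measurable Schur triangularization with a prescribed measurable enumeration of the
eigenvalues. -/
theorem exists_measurable_schur {Ω : Type*} [MeasurableSpace Ω] {T : Ω → (Cd d →L[ℂ] Cd d)}
    (hT : StronglyMeasurable T) {lam : Fin d → Ω → ℂ} (hlam : ∀ k, Measurable (lam k))
    (hdet : ∀ z, (fun k => lam k z) ∈ eigenTuples (T z)) :
    ∃ phi : Fin d → Ω → Cd d, (∀ k, Measurable (phi k)) ∧
      (∀ z, Orthonormal ℂ (fun k => phi k z)) ∧
      ∀ z k, ∃ mu : Fin d → ℂ,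
        T z (phi k z) = lam k z • phi k z + ∑ l ∈ Finset.Iio k, mu l • phi l z := by
  classical
  let lam' : ℕ → Ω → ℂ := fun i z => if h : i < d then lam ⟨i, h⟩ z else 0
  have hlam' : ∀ i, Measurable (lam' i) := by
    intro i
    by_cases h : i < d
    · simpa only [lam', dif_pos h] using hlam ⟨i, h⟩
    · simpa only [lam', dif_neg h] using measurable_const
  let Q : (ℕ → Ω → Cd d) → ℕ → Ω → (Cd d →L[ℂ] Cd d) := fun φ m z =>
    ∑ j ∈ Finset.range m, InnerProductSpace.rankOne ℂ (φ j z) (φ j z)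
  -- The determinant in the last clause drives the induction: it vanishes at the next prescribed
  -- eigenvalue, which supplies the next kernel vector.
  have main : ∀ n ≤ d, ∃ φ : ℕ → Ω → Cd d, (∀ i, Measurable (φ i)) ∧
      (∀ i < n, ∀ z, ‖φ i z‖ = 1 ∧ deflated (Q φ i z) (T z) (lam' i z) (φ i z) = 0) ∧
      (∀ m ≤ n, ∀ z, Q φ m z * Q φ m z = Q φ m z ∧ IsSelfAdjoint (Q φ m z)) ∧
      ∀ z x, (deflated (Q φ n z) (T z) x).det = ∏ i ∈ Finset.Ico n d, (x - lam' i z) := by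
    intro n
    induction n with
    | zero =>
      intro _
      refine ⟨fun _ _ => 0, fun _ => measurable_const, fun i hi => absurd hi (Nat.not_lt_zero i),
        fun m _ z => ?_, fun z x => ?_⟩
      · have h0 : Q (fun _ _ => 0) m z = 0 := by simp [Q]
        rw [h0]
        exact ⟨mul_zero _, ContinuousLinearMap.isSelfAdjoint_iff_isSymmetric.2 fun x y => by simp⟩
      · have h0 : deflated (Q (fun _ _ => 0) 0 z) (T z) x = x • 1 - T z := by
          simp [Q, deflated]
        rw [h0, hdet z x, ← Finset.range_eq_Ico, Finset.prod_range]
        refine Finset.prod_congr rfl fun i _ => ?_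
        simp [lam']
    | succ n ih =>
      intro hn
      obtain ⟨φ, hφm, hφ, hQ, hφd⟩ := ih (by omega)
      have hQm : StronglyMeasurable (Q φ n) :=
        Finset.stronglyMeasurable_fun_sum _ fun j _ =>
          continuous_rankOne_self.comp_stronglyMeasurable (hφm j).stronglyMeasurable
      have hB : StronglyMeasurable fun z => deflated (Q φ n z) (T z) (lam' n z) :=
        hQm.add ((stronglyMeasurable_const.sub hQm).mul
          (((hlam' n).stronglyMeasurable.smul stronglyMeasurable_const).sub hT))
      obtain ⟨v, hvm, hv⟩ := exists_measurable_kernel_vector hB fun z => by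
        have h0 : (deflated (Q φ n z) (T z) (lam' n z)).det = 0 := by
          rw [hφd, Finset.prod_eq_zero (Finset.mem_Ico.2 ⟨le_rfl, hn⟩) (sub_self _)]
        obtain ⟨v, hv, hv0⟩ :=
          (Submodule.ne_bot_iff _).1 (LinearMap.bot_lt_ker_of_det_eq_zero h0).ne'
        exact ⟨v, hv0, hv⟩
      have hupd : ∀ i < n, Function.update φ n v i = φ i := fun i hi =>
        Function.update_of_ne hi.ne _ _
      have hQupd : ∀ m ≤ n, ∀ z, Q (Function.update φ n v) m z = Q φ m z := by
        intro m hm z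
        refine Finset.sum_congr rfl fun j hj => ?_
        rw [hupd j ((Finset.mem_range.1 hj).trans_le hm)]
      have hQsucc : ∀ z, Q (Function.update φ n v) (n + 1) z =
          Q φ n z + InnerProductSpace.rankOne ℂ (v z) (v z) := by
        intro z
        rw [← hQupd n le_rfl z]
        simp only [Q, Finset.sum_range_succ, Function.update_self]
      refine ⟨Function.update φ n v, fun i => ?_, fun i hi z => ?_, fun m hm z => ?_,
        fun z x => ?_⟩
      · rcases eq_or_ne i n with rfl | h
        · rwa [Function.update_self]
        · rw [Function.update_of_ne h]; exact hφm i
      · rcases (Nat.lt_succ_iff.1 hi).lt_or_eq with h | rfl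
        · rw [hQupd i h.le, hupd i h]; exact hφ i h z
        · rw [hQupd i le_rfl, Function.update_self]; exact hv z
      · rcases hm.lt_or_eq with h | rfl
        · rw [hQupd m (by omega)]; exact hQ m (by omega) z
        · obtain ⟨hidem, hsa⟩ := hQ n le_rfl z
          obtain ⟨hQv, -⟩ := apply_eq_zero_of_deflated hidem (hv z).2
          rw [hQsucc]
          exact add_rankOne_isProj hidem hsa (hv z).1 hQv
      · obtain ⟨hidem, hsa⟩ := hQ n le_rfl z
        -- The factor $x-\lambda_n$ can be cancelled only for $x\ne\lambda_n$; continuity in $x$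
        -- covers the remaining point.
        refine eq_of_mul_sub_eq (l := lam' n z)
          (ContinuousLinearMap.continuous_det.comp (continuous_deflated _ _))
          (continuous_finsetProd _ fun i _ => continuous_id.sub continuous_const) ?_ x
        intro y
        have h1 := det_deflated_add_rankOne hidem hsa (hv z).1 (hv z).2 y
        rw [hφd, ← hQsucc, Finset.prod_eq_prod_Ico_succ_bot hn, mul_comm] at h1
        exact h1.symm
  obtain ⟨φ, hφm, hφ, hQ, -⟩ := main d le_rfl
  refine ⟨fun k => φ k, fun k => hφm k, fun z => ?_, fun z k => ?_⟩
  · have hlt : ∀ i j : Fin d, i < j → inner ℂ (φ i z) (φ j z) = 0 := fun i j hij =>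
      inner_eq_zero_of_sum_rankOne (φ := fun i => φ i z)
        (apply_eq_zero_of_deflated (hQ j j.2.le z).1 (hφ j j.2 z).2).1 hij
    refine ⟨fun k => (hφ k k.2 z).1, fun i j hij => ?_⟩
    rcases hij.lt_or_gt with h | h
    · exact hlt i j h
    · rw [← inner_conj_symm, hlt j i h, map_zero]
  · have h1 := (apply_eq_zero_of_deflated (hQ k k.2.le z).1 (hφ k k.2 z).2).2
    refine ⟨fun l => inner ℂ (φ l z) (T z (φ k z)), ?_⟩
    have h2 : lam' k z = lam k z := by simp [lam']
    have h3 : Q φ k z (T z (φ k z)) =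
        ∑ l ∈ Finset.Iio k, inner ℂ (φ l z) (T z (φ k z)) • φ l z := by
      simp only [Q, sum_apply, InnerProductSpace.rankOne_apply]
      rw [← Nat.Iio_eq_range, ← Fin.map_valEmbedding_Iio, Finset.sum_map]
      rfl
    rw [← h2, ← h3]
    exact h1

end Schur

end BlockConv

namespace BlockConv

/-! ### Existence of Schur systems -/

variable {d : ℕ}

/-- The eigenvalues are enumerated along $[0,2\pi]$ and carried to the circle by the argument. The
enumerations at 0 and $2\pi$ may differ by a permutation, which is why continuity is only asked on
$[0,2\pi)$. -/
theorem exists_isSchurSystem {A : ℤ → Matrix (Fin d) (Fin d) ℂ} (hA : Summable fun n => ‖A n‖) :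
    ∃ (lam : Fin d → Torus → ℂ) (phi : Fin d → Torus → Cd d), IsSchurSystem A lam phi := by
  have hcont : Continuous fun t : ℝ => symbol A (t : Torus) :=
    (continuous_symbol hA).comp (AddCircle.continuous_mk' _)
  obtain ⟨K, hK⟩ := (boundedSymbol_symbol hA).bound
  obtain ⟨f, hfc, hf⟩ := (isTupleFamily_eigenTuples hcont fun t => hK t).exists_continuousOn
    (2 * Real.pi)
  -- Only the restriction of $f$ to the interval is known to be continuous; a continuous extension
  -- makes the composition with `argT` measurable.
  have hext : Continuous (Set.IccExtend Real.two_pi_pos.le ((Set.Icc 0 (2 * Real.pi)).domRestrict f)) :=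
    hfc.domRestrict.Icc_extend'
  have heq : ∀ z, Set.IccExtend Real.two_pi_pos.le ((Set.Icc 0 (2 * Real.pi)).domRestrict f) (argT z) =
      f (argT z) := fun z =>
    Set.IccExtend_of_mem _ _ ⟨(argT_mem z).1, (argT_mem z).2.le⟩
  have hmeas : ∀ k, Measurable fun z => f (argT z) k := by
    intro k
    have h1 := (measurable_pi_apply k).comp (hext.measurable.comp measurable_argT)
    simpa only [Function.comp_def, heq] using h1
  obtain ⟨phi, hm, ho, ht⟩ := exists_measurable_schur (boundedSymbol_symbol hA).meas
    (lam := fun k z => f (argT z) k) hmeas fun z => by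
      have h1 := hf (argT z) ⟨(argT_mem z).1, (argT_mem z).2.le⟩
      rwa [coe_argT] at h1
  refine ⟨fun k z => f (argT z) k, phi, fun k => ?_, hm, ho, ht⟩
  have h1 : ContinuousOn (fun t => f t k) (Set.Ico 0 (2 * Real.pi)) :=
    ((continuous_apply k).comp_continuousOn hfc).mono Set.Ico_subset_Icc_self
  exact h1.congr fun t ht => by simp only [argT_coe ht]

/-- End points are excluded because the end point of a curve and the initial point of the next one
share a position. -/
lemma CurvePt.pos_lt_pos {ν μ : CurvePt d} (hν : (ν.2 : ℝ) < 2 * Real.pi) (h : ν.Prec μ) :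
    ν.pos < μ.pos := by
  rw [CurvePt.pos, CurvePt.pos]
  rcases h with h | ⟨h, h'⟩
  · have := two_pi_mul_succ_le (Fin.lt_def.1 h)
    linarith [μ.2.2.1]
  · rw [h]
    linarith

end BlockConv

/-! ### Assembly of the theorem. -/

open BlockConv in
theorem theorem4p1 (d : ℕ) (hd : 0 < d) (A : ℤ → Matrix (Fin d) (Fin d) ℂ)
    (hA : Summable fun n => ‖A n‖) :
    (∃ (lam : Fin d → Torus → ℂ) (phi : Fin d → Torus → Cd d), IsSchurSystem A lam phi) ∧
    ∀ (lam : Fin d → Torus → ℂ) (phi : Fin d → Torus → Cd d), IsSchurSystem A lam phi →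
      -- the projections are orthogonal and increase strictly along the curves from `O` to `I`
      ((∀ ν : CurvePt d, IsSelfAdjoint (chainProj phi ν)) ∧
        chainProj phi (⟨0, hd⟩, ⟨0, Set.left_mem_Icc.2 Real.two_pi_pos.le⟩) = 0 ∧
        chainProj phi (⟨d - 1, Nat.sub_lt hd one_pos⟩,
          ⟨2 * Real.pi, Set.right_mem_Icc.2 Real.two_pi_pos.le⟩) = 1 ∧
        ∀ ν μ : CurvePt d, (ν.2 : ℝ) < 2 * Real.pi → ν.Prec μ →
          ProjLE (chainProj phi ν) (chainProj phi μ) ∧ chainProj phi ν ≠ chainProj phi μ) ∧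
      -- (i)
      (IsMaximalProjChain (chainOf phi) ∧ IsInvariantChain (chainOf phi) (convOp A)) ∧
      -- (ii)
      (convOp A = convOfSymbol (diagSymbol lam phi) + convOfSymbol (upperSymbol A phi) ∧
        IsReducingChain (chainOf phi) (convOfSymbol (diagSymbol lam phi)) ∧
        IsInvariantChain (chainOf phi) (convOfSymbol (upperSymbol A phi)) ∧
        IsDiagIntegral (chainOf phi) (convOp A) (convOfSymbol (diagSymbol lam phi)) ∧
        IsUpperIntegral (chainOf phi) (convOp A) (convOfSymbol (upperSymbol A phi)) ∧
        IsNilpotent (convOfSymbol (upperSymbol A phi)) ∧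
        nilpotencyClass (convOfSymbol (upperSymbol A phi)) ≤ d) ∧
      -- (iii)
      ((∀ ν : CurvePt d,
          spectrumOn (chainProj phi ν) (convOp A) =
            closure {w : ℂ | ∃ μ : CurvePt d, (μ.2 : ℝ) < 2 * Real.pi ∧ μ.Prec ν ∧
              w = lam μ.1 ((μ.2 : ℝ) : Torus)} ∧
          spectrumOn (1 - chainProj phi ν) (convOp A) =
            closure {w : ℂ | ∃ μ : CurvePt d, (μ.2 : ℝ) < 2 * Real.pi ∧ ν.Prec μ ∧
              w = lam μ.1 ((μ.2 : ℝ) : Torus)}) ∧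
        spectrum ℂ (convOp A) = spectrum ℂ (convOfSymbol (diagSymbol lam phi)) ∧
        spectrum ℂ (convOfSymbol (diagSymbol lam phi)) =
          ⋃ k : Fin d, closure (Set.range (lam k))) := by
  refine ⟨exists_isSchurSystem hA, fun lam phi hS => ?_⟩
  have h := hS.isTriangularSymbol hA
  have hphi := h.toIsFrame
  have hconv := convOp_eq_convOfSymbol hA
  have hup : upperSymbol A phi = fun z => symbol A z - diagSymbol lam phi z :=
    funext (upperSymbol_eq h)
  have hpow := h.upper_pow_eq_zero
  rw [hconv, hup]
  refine ⟨⟨fun ν => ?_, ?_, ?_, fun ν μ hν hlt => ?_⟩,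
    ⟨isMaximalProjChain_chainOf hd hphi, h.isInvariantChain⟩,
    ⟨?_, h.isReducingChain_diag, h.upper.isInvariantChain, h.isDiagIntegral hd,
      h.isUpperIntegral hd, ⟨d, hpow⟩, Nat.sInf_le hpow⟩,
    ⟨fun ν => ⟨?_, ?_⟩, ?_, h.diag.spectrum_eq hS.continuousOn_lam⟩⟩
  · rw [chainProj_eq hphi]
    exact isSelfAdjoint_frameProj hphi (measurableSet_below _)
  · rw [chainProj_eq hphi, chainFamily_of_nonpos hphi]
    simp [CurvePt.pos]
  · rw [chainProj_eq hphi, chainFamily_of_le hphi]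
    have h2 : ((d - 1 : ℕ) : ℝ) + 1 = d := by exact_mod_cast Nat.sub_add_cancel hd
    simp only [CurvePt.pos]
    rw [← h2]
    linarith
  · have hpos := CurvePt.pos_lt_pos hν hlt
    rw [chainProj_eq hphi, chainProj_eq hphi]
    exact ⟨projLE_chainFamily hphi hpos.le, chainFamily_ne hphi ν.pos_mem.1 hpos μ.pos_mem.2⟩
  · rw [← convOfSymbol_add h.boundedSymbol_diag h.upper.bounded]
    simp only [add_sub_cancel]
  · rw [setOf_prec_eq, chainProj_eq hphi]
    exact h.spectrumOn_frameProj hS.continuousOn_lam (measurableSet_below _) (isRightOpen_below _)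
  · rw [closure_setOf_succ_eq hS.continuousOn_lam, chainProj_eq hphi, chainFamily,
      frameProj_compl hphi (measurableSet_below _)]
    exact h.spectrumOn_frameProj hS.continuousOn_lam
      (fun l => (measurableSet_below _ l).compl) (isRightOpen_compl_below _)
  · rw [h.spectrum_eq hS.continuousOn_lam, h.diag.spectrum_eq hS.continuousOn_lam]
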